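/- **Setting.** All spaces are over $\mathbb C$. Let $\mathfrak g$ be a finite-dimensional simple Lie algebra with a non-degenerate symmetric invariant bilinear form $(\,,)$, let $n\ge 1$, let $\sigma_0,\dots,\sigma_n$ be commuting automorphisms of $\mathfrak g$ of finite orders $m_0,\dots,m_n$, and let $\xi_i$ be a primitive $m_i$-th root of unity. Put $\Gamma_0=m_0\mathbb Z$, $\Gamma=m_1\mathbb Z\oplus\dots\oplus m_n\mathbb Z$, $\Lambda=\mathbb Z^n/\Gamma$, and, for $(k_0,k)\in\mathbb Z\times\mathbb Z^n$, $\mathfrak g(\bar k_0,\bar k)=\{x\in\mathfrak g:\sigma_i x=\xi_i^{k_i}x,\ 0\le i\le n\}$. Let $\tau$ be the twisted full toroidal Lie algebra $$\tau=\Big(\bigoplus_{(k_0,k)}\mathfrak g(\bar k_0,\bar k)\otimes t_0^{k_0}t^k\Big)\oplus Z\oplus D .$$ Here $Z$ is spanned by the symbols $t_0^{r_0}t^rK_i$ and $D$ has the basis $t_0^{r_0}t^rd_i$ ($0\le i\le n$, $(r_0,r)\in\Gamma_0\oplus\Gamma$), with the relations $\sum_i r_i\,t_0^{r_0}t^rK_i=0$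 in $Z$. Write $X(k_0,k)=X\otimes t_0^{k_0}t^k$, and $\underline r=(r_0,r)$, $t^{\underline r}=t_0^{r_0}t^r$. The brackets are: $[X(\underline k),Y(\underline l)]=[X,Y](\underline k+\underline l)+(X,Y)\sum_i k_it^{\underline k+\underline l}K_i$; $Z$ is abelian and commutes with all $X(\underline k)$; $[t^{\underline r}d_a,X(\underline k)]=k_aX(\underline k+\underline r)$; $[t^{\underline r}d_a,t^{\underline s}K_b]=s_at^{\underline r+\underline s}K_b+\delta_{ab}\sum_p r_pt^{\underline r+\underline s}K_p$; $[t^{\underline r}d_a,t^{\underline s}d_b]=s_at^{\underline r+\underline s}d_b-r_bt^{\underline r+\underline s}d_a+(-c_1s_ar_b+c_2r_as_b)\sum_p r_pt^{\underline r+\underline s}K_p$, where $c_1,c_2\in\mathbb C$ are fixed. Assume that $\mathfrak g(\bar0,\bar0)$ is simple, with a Cartan subalgebra $\mathfrak h(0)$ contained in a Cartan subalgebra of $\mathfrak g$ and with root system $\Delta_0^\times$, and that every weight of $\mathfrak h(0)$ on $\mathfrak g$ is $0$, an element of $\Delta_0^\times$, or, when $\Delta_0^\times$ is of type $B_l$ ($l\ge1$,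 $B_1=A_1$), twice a short root of $\Delta_0^\times$. Fix simple roots of $\Delta_0^\times$. Let $H=\mathfrak h(0)\oplus\sum\mathbb CK_i\oplus\sum\mathbb Cd_i$. Let $V$ be an irreducible $\tau$-module which is integrable, that is, $V$ is the direct sum of its $H$-weight spaces, these are finite-dimensional, and $X(k_0,k)$ acts locally nilpotently whenever $X\in\mathfrak g(\bar k_0,\bar k)$ has $\mathfrak h(0)$-weight $\alpha\ne0$. Assume that $K_0$ acts on $V$ as a real number $C_0>0$ and $K_1,\dots,K_n$ act as $0$. Fix a weight $\lambda$ of $V$. Let $\tau^+\subset\tau$ be spanned by the $t_0^{r_0}t^rK_i$ and $t_0^{r_0}t^rd_i$ with $r_0>0$ and by the $X(k_0,k)$, $X$ of weight $\alpha$, with $k_0>0$, or with $k_0=0$ and $\alpha$ a non-zero sum of simple roots. Let $T=\{v\in V:\tau^+v=0\}$ and $T_k=\{v\in T: d_iv=(\lambda(d_i)+k_i)v,\ 1\le i\le n\}$. For $r\in\Gamma$ let $t^r$ act on $T$ as $\frac1{C_0}t^rK_0$, let $W\subseteq T$ be the span of all $t^rv-v$ ($r\in\Gamma$, $v\in T$),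 let $\tilde V=T/W$, and let $\tilde V_{\bar k}$ be the image of $T_k$. Let $\mathring{\mathfrak g}=\{X\in\mathfrak g:\sigma_0X=X,\ [\mathfrak h(0),X]=0\}$ and $\mathring{\mathfrak g}_{\bar k}=\{X\in\mathring{\mathfrak g}:\sigma_iX=\xi_i^{k_i}X,\ 1\le i\le n\}$. For $u\in\mathbb C^n$, $r\in\Gamma$ put $D(u,r)=\sum_{i=1}^nu_it^rd_i$ and $I(u,r)=D(u,r)-D(u,0)$; let $I$ be the span of the $I(u,r)$ in the derivation algebra of $\mathbb C[t_1^{\pm m_1},\dots,t_n^{\pm m_n}]$, let $L(\mathring{\mathfrak g},\sigma)=\bigoplus_{k\in\mathbb Z^n}\mathring{\mathfrak g}_{\bar k}\otimes t^k$, and let $\tilde L=I\ltimes L(\mathring{\mathfrak g},\sigma)$, with $X(k)=X\otimes t^k$ and $[D(u,r),X(k)]=\big(\sum_iu_ik_i\big)X(k+r)$. The elements $X(k)=X(0,k)$ and $I(u,r)$ act on $T$ as elements of $\tau$, preserve $W$, and so act on $\tilde V$. Let $F_1\subseteq L(\mathring{\mathfrak g},\sigma)$ be the span of all $X(k)-X(k+r)$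 ($X\in\mathring{\mathfrak g}_{\bar k}$, $r\in\Gamma$), and $I_2\subseteq I$ the span of all $I(u,r)-I(u,r+s_1)-I(u,r+s_2)+I(u,r+s_1+s_2)$ ($u\in\mathbb C^n$, $r,s_1,s_2\in\Gamma$). Let $p\in\mathbb Z^n$, let $N_p$ be the order of $\bar p$ in $\Lambda$, let $\zeta$ be a primitive $N_p$-th root of unity, and let $\theta$ be a linear automorphism of $\tilde V$ commuting with the action of $\tilde L$, with $\theta(\tilde V_{\bar k})=\tilde V_{\bar k-\bar p}$ for all $k$ and $\theta^{N_p}=1$ (for $\bar p=0$ this means $\theta=1$). For $0\le i<N_p$ let $\tilde M_i=\{v\in\tilde V:\theta(v)=\zeta^{-i}v\}$. **Theorem 9.4.** Assume that each $\tilde M_i$ is irreducible under $\tilde L$ (non-zero, with no $\tilde L$-stable subspaces other than $0$ and itself). Then, for each $i$: 1. $\tilde M_i$ is finite-dimensional, and the action of $\tilde L$ makes it an irreducible module over the Lie algebra $\tilde L$; 2. $I_2\oplus F_1$ acts trivially on $\tilde M_i$; 3. the action factors through $\mathfrak{gl}_n\oplus\mathring{\mathfrak g}$: there is an irreducible representation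 $\rho$ of the Lie algebra $\mathfrak{gl}_n\oplus\mathring{\mathfrak g}$ on $\tilde M_i$ such that, on $\tilde M_i$, $X(k)=\rho(0,X)$ for $k\in\mathbb Z^n$, $X\in\mathring{\mathfrak g}_{\bar k}$, and $I(u,r)=\rho\big(\sum_{i,j}u_ir_jE_{ji},0\big)$ for $u\in\mathbb C^n$, $r\in\Gamma$. -/

import Mathlib

open scoped TensorProduct

set_option linter.unusedSimpArgs false
set_option linter.unusedSectionVars false

noncomputable section

namespace Toroidal

/-- The bilinear map on finitely supported functions determined by its values on the homogeneous
elements `single k x`, `single l y`. -/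
def homogBilin {G M N P : Type*} [AddCommGroup M] [Module ℂ M] [AddCommGroup N] [Module ℂ N]
    [AddCommGroup P] [Module ℂ P] (f : G → G → M →ₗ[ℂ] N →ₗ[ℂ] P) :
    (G →₀ M) →ₗ[ℂ] (G →₀ N) →ₗ[ℂ] P :=
  Finsupp.lsum ℂ fun k => (Finsupp.lsum ℂ fun l => (f k l).flip).flip

theorem homogBilin_single {G M N P : Type*} [AddCommGroup M] [Module ℂ M] [AddCommGroup N]
    [Module ℂ N] [AddCommGroup P] [Module ℂ P] (f : G → G → M →ₗ[ℂ] N →ₗ[ℂ] P)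
    (k l : G) (x : M) (y : N) :
    homogBilin f (Finsupp.single k x) (Finsupp.single l y) = f k l x y := by
  simp [homogBilin]

section General

variable (ι : Type) [Fintype ι]

/-- `(u, k) = ∑ uᵢ kᵢ` for `u ∈ ℂ^ι`, `k ∈ ℤ^ι`, as a linear form in `u`. -/
def pairing (k : ι → ℤ) : (ι → ℂ) →ₗ[ℂ] ℂ := ∑ i, (k i : ℂ) • LinearMap.proj i

variable {ι} in
theorem pairing_apply (k : ι → ℤ) (u : ι → ℂ) : pairing ι k u = ∑ i, (k i : ℂ) * u i := by
  simp [pairing]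

variable {ι} in
theorem pairing_add (k l : ι → ℤ) (u : ι → ℂ) :
    pairing ι (k + l) u = pairing ι k u + pairing ι l u := by
  simp [pairing_apply, add_mul, Finset.sum_add_distrib]

/-- An integer vector regarded as a complex vector. -/
def toC {ι : Type} (k : ι → ℤ) : ι → ℂ := fun i => (k i : ℂ)

theorem toC_add {ι : Type} (k l : ι → ℤ) : toC (k + l) = toC k + toC l := by
  ext i; simp [toC]

/-- Laurent polynomials `ℂ[tᵢ^{±1} : i ∈ ι]`. -/
abbrev Laurent := AddMonoidAlgebra ℂ (ι → ℤ)

/-- The monomial `t^k`. -/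
abbrev mono {ι : Type} (k : ι → ℤ) : Laurent ι := AddMonoidAlgebra.single k 1

/-- The derivations of the Laurent polynomials: finite sums of `t^r ∑ uᵢ dᵢ`, `dᵢ = tᵢ ∂/∂tᵢ`;
the value of the function at `r` is the vector `u`. -/
def VecField : Type := (ι → ℤ) →₀ (ι → ℂ)

instance : AddCommGroup (VecField ι) := inferInstanceAs (AddCommGroup ((ι → ℤ) →₀ (ι → ℂ)))
instance : Module ℂ (VecField ι) := inferInstanceAs (Module ℂ ((ι → ℤ) →₀ (ι → ℂ)))

variable {ι}

/-- `D(u,r) = t^r ∑ uᵢ dᵢ`. -/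
def vf (u : ι → ℂ) (r : ι → ℤ) : VecField ι := Finsupp.single r u

theorem vf_add (u v : ι → ℂ) (r : ι → ℤ) : vf (u + v) r = vf u r + vf v r :=
  Finsupp.single_add ..

theorem vf_smul (c : ℂ) (u : ι → ℂ) (r : ι → ℤ) : vf (c • u) r = c • vf u r :=
  (Finsupp.smul_single ..).symm

theorem VecField.ind {p : VecField ι → Prop} (x : VecField ι) (h0 : p 0)
    (ha : ∀ x y, p x → p y → p (x + y)) (hs : ∀ u r, p (vf u r)) : p x :=
  Finsupp.induction_linear x h0 ha fun r u => hs u r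

/-- `[D(u,r), D(v,s)] = D((u,s)v - (v,r)u, r+s)`, as a bilinear map. -/
def VecField.br : VecField ι →ₗ[ℂ] VecField ι →ₗ[ℂ] VecField ι :=
  homogBilin fun r s => LinearMap.mk₂ ℂ
    (fun u v => vf (pairing ι s u • v - pairing ι r v • u) (r + s))
    (by intros; rw [← vf_add, map_add]; congr 1; module)
    (by intros; rw [← vf_smul, map_smul, smul_eq_mul]; congr 1; module)
    (by intros; rw [← vf_add, map_add]; congr 1; module)
    (by intros; rw [← vf_smul, map_smul, smul_eq_mul]; congr 1; module)

instance : Bracket (VecField ι) (VecField ι) := ⟨fun x y => VecField.br x y⟩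

theorem VecField.lie_def (x y : VecField ι) : ⁅x, y⁆ = VecField.br x y := rfl

theorem VecField.br_vf (u v : ι → ℂ) (r s : ι → ℤ) :
    VecField.br (vf u r) (vf v s) = vf (pairing ι s u • v - pairing ι r v • u) (r + s) :=
  homogBilin_single ..

theorem vf_lie (u v : ι → ℂ) (r s : ι → ℤ) :
    ⁅vf u r, vf v s⁆ = vf (pairing ι s u • v - pairing ι r v • u) (r + s) :=
  VecField.br_vf ..

theorem VecField.br_skew (x y : VecField ι) : VecField.br x y = -VecField.br y x := by
  induction x using VecField.ind with
  | h0 => simp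
  | ha x x' h h' => simp only [map_add, LinearMap.add_apply, h, h']; abel
  | hs u r =>
    induction y using VecField.ind with
    | h0 => simp
    | ha x x' h h' => simp only [map_add, LinearMap.add_apply, h, h']; abel
    | hs v s =>
      rw [VecField.br_vf, VecField.br_vf, add_comm s r, ← neg_one_smul ℂ (vf _ (r + s)), ← vf_smul]
      congr 1; module

theorem VecField.br_jacobi (x y z : VecField ι) : VecField.br x (VecField.br y z) =
    VecField.br (VecField.br x y) z + VecField.br y (VecField.br x z) := by
  induction x using VecField.ind with
  | h0 => simp
  | ha x x' h h' => simp only [map_add, LinearMap.add_apply, h, h']; abel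
  | hs u r =>
    induction y using VecField.ind with
    | h0 => simp
    | ha x x' h h' => simp only [map_add, LinearMap.add_apply, h, h']; abel
    | hs v s =>
      induction z using VecField.ind with
      | h0 => simp
      | ha x x' h h' => simp only [map_add, h, h']; abel
      | hs w q =>
        simp only [VecField.br_vf]
        rw [show s + (r + q) = r + s + q by abel, ← add_assoc, ← vf_add]
        congr 1
        simp only [map_sub, map_smul, pairing_add, smul_eq_mul]
        module

instance : LieRing (VecField ι) where
  add_lie x y z := by simp [VecField.lie_def]
  lie_add x y z := by simp [VecField.lie_def]
  lie_self x := by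
    have h : (2 : ℂ) • VecField.br x x = 0 := by
      rw [two_smul]; nth_rewrite 1 [VecField.br_skew x x]; simp
    exact (smul_eq_zero.1 h).resolve_left two_ne_zero
  leibniz_lie x y z := VecField.br_jacobi x y z

instance : LieAlgebra ℂ (VecField ι) where
  lie_smul c x y := by simp [VecField.lie_def]

/-- The action of vector fields on Laurent polynomials: `D(u,r) t^k = (u,k) t^{k+r}`. -/
def VecField.onLaurent : VecField ι →ₗ[ℂ] Laurent ι →ₗ[ℂ] Laurent ι :=
  (homogBilin fun r k => LinearMap.mk₂ ℂ
    (fun (u : ι → ℂ) (c : ℂ) => (AddMonoidAlgebra.single (k + r) (pairing ι k u * c) : Laurent ι))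
    (by intros; rw [← AddMonoidAlgebra.single_add, map_add]; congr 1; ring)
    (by intros; rw [AddMonoidAlgebra.smul_single, map_smul, smul_eq_mul, smul_eq_mul]; congr 1; ring)
    (by intros; rw [← AddMonoidAlgebra.single_add]; congr 1; ring)
    (by intros; rw [AddMonoidAlgebra.smul_single, smul_eq_mul, smul_eq_mul]; congr 1; ring)).compl₂
  (AddMonoidAlgebra.coeffLinearEquiv ℂ).toLinearMap

theorem VecField.onLaurent_vf (u : ι → ℂ) (r k : ι → ℤ) (c : ℂ) :
    VecField.onLaurent (vf u r) (AddMonoidAlgebra.single k c : Laurent ι) =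
      AddMonoidAlgebra.single (k + r) (pairing ι k u * c) :=
  homogBilin_single ..

theorem VecField.onLaurent_leibniz (x : VecField ι) (f g : Laurent ι) :
    x.onLaurent (f * g) = x.onLaurent f * g + f * x.onLaurent g := by
  induction x using VecField.ind with
  | h0 => simp
  | ha x x' h h' => simp only [map_add, LinearMap.add_apply, h, h']; ring
  | hs u r =>
    induction f using AddMonoidAlgebra.induction_linear with
    | zero => simp
    | add x x' h h' => simp only [map_add, add_mul, h, h']; ring
    | single k c =>
      induction g using AddMonoidAlgebra.induction_linear with
      | zero => simp
      | add x x' h h' => simp only [map_add, mul_add, h, h']; ring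
      | single l d =>
        simp only [AddMonoidAlgebra.single_mul_single, VecField.onLaurent_vf]
        rw [show k + r + l = k + l + r by abel, show k + (l + r) = k + l + r by abel,
          ← AddMonoidAlgebra.single_add, pairing_add]
        congr 1; ring

theorem VecField.onLaurent_lie (x y : VecField ι) (f : Laurent ι) :
    VecField.onLaurent ⁅x, y⁆ f =
      x.onLaurent (y.onLaurent f) - y.onLaurent (x.onLaurent f) := by
  induction x using VecField.ind with
  | h0 => simp
  | ha x x' h h' => simp only [add_lie, map_add, LinearMap.add_apply, h, h']; abel
  | hs u r =>
    induction y using VecField.ind with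
    | h0 => simp
    | ha x x' h h' => simp only [lie_add, map_add, LinearMap.add_apply, h, h']; abel
    | hs v s =>
      induction f using AddMonoidAlgebra.induction_linear with
      | zero => simp
      | add x x' h h' => simp only [map_add, h, h']; abel
      | single k c =>
        simp only [vf_lie, VecField.onLaurent_vf]
        rw [show k + r + s = k + s + r by abel, show k + (r + s) = k + s + r by abel,
          eq_sub_iff_add_eq, ← AddMonoidAlgebra.single_add]
        congr 1
        simp only [map_sub, map_smul, pairing_add, smul_eq_mul]
        ring

/-- The symbols `t^k ∑ uᵢ Kᵢ`, before dividing by exact forms. -/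
def Omega (ι : Type) : Type := (ι → ℤ) →₀ (ι → ℂ)

instance : AddCommGroup (Omega ι) := inferInstanceAs (AddCommGroup ((ι → ℤ) →₀ (ι → ℂ)))
instance : Module ℂ (Omega ι) := inferInstanceAs (Module ℂ ((ι → ℤ) →₀ (ι → ℂ)))

/-- The symbol `t^k ∑ uᵢ Kᵢ`. -/
def om (u : ι → ℂ) (k : ι → ℤ) : Omega ι := Finsupp.single k u

theorem om_add (u v : ι → ℂ) (r : ι → ℤ) : om (u + v) r = om u r + om v r :=
  Finsupp.single_add ..

theorem om_smul (c : ℂ) (u : ι → ℂ) (r : ι → ℤ) : om (c • u) r = c • om u r :=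
  (Finsupp.smul_single ..).symm

theorem Omega.ind {p : Omega ι → Prop} (x : Omega ι) (h0 : p 0)
    (ha : ∀ x y, p x → p y → p (x + y)) (hs : ∀ u r, p (om u r)) : p x :=
  Finsupp.induction_linear x h0 ha fun r u => hs u r

/-- `dA`, spanned by `∑ kᵢ t^k Kᵢ`. -/
def exact (ι : Type) : Submodule ℂ (Omega ι) := Submodule.span ℂ (Set.range fun k => om (toC k) k)

/-- `ΩA / dA`. -/
def Centre (ι : Type) : Type := Omega ι ⧸ exact ι

instance : AddCommGroup (Centre ι) := inferInstanceAs (AddCommGroup (Omega ι ⧸ exact ι))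
instance : Module ℂ (Centre ι) := inferInstanceAs (Module ℂ (Omega ι ⧸ exact ι))

/-- The class of a symbol. -/
def Centre.mk : Omega ι →ₗ[ℂ] Centre ι := (exact ι).mkQ

/-- The class of `t^k ∑ uᵢ Kᵢ` in `ΩA / dA`. -/
def ce (u : ι → ℂ) (k : ι → ℤ) : Centre ι := Centre.mk (om u k)

theorem ce_add (u v : ι → ℂ) (r : ι → ℤ) : ce (u + v) r = ce u r + ce v r := by
  simp [ce, om_add]

theorem ce_smul (c : ℂ) (u : ι → ℂ) (r : ι → ℤ) : ce (c • u) r = c • ce u r := by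
  simp [ce, om_smul]

theorem ce_self (k : ι → ℤ) : ce (toC k) k = 0 :=
  (Submodule.Quotient.mk_eq_zero _).2 (Submodule.subset_span ⟨k, rfl⟩)

theorem Centre.ind {p : Centre ι → Prop} (x : Centre ι) (h0 : p 0)
    (ha : ∀ x y, p x → p y → p (x + y)) (hs : ∀ u r, p (ce u r)) : p x := by
  obtain ⟨y, rfl⟩ := (exact ι).mkQ_surjective x
  induction y using Omega.ind with
  | h0 => exact h0
  | ha x y hx hy => exact ha _ _ hx hy
  | hs u r => exact hs u r

/-- `D(u,r) · t^s ∑ vᵢ Kᵢ = (u,s) t^{r+s} ∑ vᵢ Kᵢ + (∑ uᵢ vᵢ) t^{r+s} ∑ rᵢ Kᵢ`, on symbols. -/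
def VecField.onOmega : VecField ι →ₗ[ℂ] Omega ι →ₗ[ℂ] Omega ι :=
  homogBilin fun r s => LinearMap.mk₂ ℂ
    (fun u v => om (pairing ι s u • v + (u ⬝ᵥ v) • toC r) (r + s))
    (by intros; rw [← om_add, map_add, add_dotProduct]; congr 1; module)
    (by intros; rw [← om_smul, map_smul, smul_dotProduct, smul_eq_mul, smul_eq_mul]
        congr 1; module)
    (by intros; rw [← om_add, dotProduct_add]; congr 1; module)
    (by intros; rw [← om_smul, dotProduct_smul, smul_eq_mul]; congr 1; module)

theorem VecField.onOmega_vf (u v : ι → ℂ) (r s : ι → ℤ) :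
    VecField.onOmega (vf u r) (om v s) = om (pairing ι s u • v + (u ⬝ᵥ v) • toC r) (r + s) :=
  homogBilin_single ..

theorem dotProduct_toC (u : ι → ℂ) (k : ι → ℤ) : u ⬝ᵥ toC k = pairing ι k u := by
  simp [dotProduct, toC, pairing_apply, mul_comm]

theorem VecField.onOmega_exact (x : VecField ι) : exact ι ≤ (exact ι).comap x.onOmega := by
  rw [exact, Submodule.span_le]
  rintro _ ⟨k, rfl⟩
  rw [SetLike.mem_coe, Submodule.mem_comap]
  induction x using VecField.ind with
  | h0 => simp
  | ha x x' h h' => simp only [map_add, LinearMap.add_apply]; exact add_mem h h'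
  | hs u r =>
    rw [VecField.onOmega_vf, dotProduct_toC, ← smul_add, om_smul, add_comm (toC k), ← toC_add]
    exact Submodule.smul_mem _ _ (Submodule.subset_span ⟨_, rfl⟩)

/-- The induced action of vector fields on `ΩA / dA`. -/
def VecField.onCentre : VecField ι →ₗ[ℂ] Centre ι →ₗ[ℂ] Centre ι where
  toFun x := (exact ι).mapQ (exact ι) x.onOmega x.onOmega_exact
  map_add' x y := by
    apply Submodule.linearMap_qext
    ext1 z
    simp; rfl
  map_smul' c y := by
    apply Submodule.linearMap_qext
    ext1 z
    simp; rfl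

theorem VecField.onCentre_vf (u v : ι → ℂ) (r s : ι → ℤ) :
    VecField.onCentre (vf u r) (ce v s) = ce (pairing ι s u • v + (u ⬝ᵥ v) • toC r) (r + s) :=
  congrArg Centre.mk (VecField.onOmega_vf ..)

theorem VecField.onCentre_lie (x y : VecField ι) (z : Centre ι) :
    VecField.onCentre ⁅x, y⁆ z =
      x.onCentre (y.onCentre z) - y.onCentre (x.onCentre z) := by
  induction x using VecField.ind with
  | h0 => simp
  | ha x x' h h' => simp only [add_lie, map_add, LinearMap.add_apply, h, h']; abel
  | hs u r =>
    induction y using VecField.ind with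
    | h0 => simp
    | ha x x' h h' => simp only [lie_add, map_add, LinearMap.add_apply, h, h']; abel
    | hs v s =>
      induction z using Centre.ind with
      | h0 => simp
      | ha x x' h h' => simp only [map_add, h, h']; abel
      | hs w q =>
        simp only [vf_lie, VecField.onCentre_vf]
        rw [show s + (r + q) = r + s + q by abel, ← add_assoc, eq_sub_iff_add_eq, ← ce_add]
        congr 1
        simp only [map_sub, map_smul, pairing_add, smul_eq_mul, dotProduct_add, dotProduct_smul,
          sub_dotProduct, smul_dotProduct, dotProduct_toC, toC_add]
        module


section WithLie

variable (𝔤 : Type*) [LieRing 𝔤] [LieAlgebra ℂ 𝔤]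

/-- The element `X ⊗ t^k` of the loop algebra `𝔤 ⊗ ℂ[t^{±1}]`. -/
abbrev lp {𝔤 : Type*} [LieRing 𝔤] [LieAlgebra ℂ 𝔤] (X : 𝔤) (k : ι → ℤ) :
    LieAlgebra.loopAlgebra ℂ (ι → ℤ) 𝔤 := mono k ⊗ₜ[ℂ] X

variable {𝔤}

theorem lp_lie (X Y : 𝔤) (k l : ι → ℤ) : ⁅lp X k, lp Y l⁆ = lp ⁅X, Y⁆ (k + l) := by
  simp [lp, mono, LieAlgebra.ExtendScalars.bracket_tmul, AddMonoidAlgebra.single_mul_single]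

theorem lp_ind {p : LieAlgebra.loopAlgebra ℂ (ι → ℤ) 𝔤 → Prop}
    (x : LieAlgebra.loopAlgebra ℂ (ι → ℤ) 𝔤) (h0 : p 0)
    (ha : ∀ x y, p x → p y → p (x + y)) (hs : ∀ X k, p (lp X k)) : p x := by
  induction x using TensorProduct.induction_on with
  | zero => exact h0
  | add x y hx hy => exact ha _ _ hx hy
  | tmul f X =>
    induction f using AddMonoidAlgebra.induction_linear with
    | zero => simpa using h0
    | add f g hf hg => rw [TensorProduct.add_tmul]; exact ha _ _ hf hg
    | single k c =>
      have : (AddMonoidAlgebra.single k c : Laurent ι) = c • mono k := by simp [mono]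
      rw [this, TensorProduct.smul_tmul]
      exact hs _ _

variable (ι 𝔤) in
/-- Vector fields act on the loop algebra by derivations, `D(u,r) · X ⊗ t^k = (u,k) X ⊗ t^{k+r}`. -/
def VecField.onLoop : VecField ι →ₗ⁅ℂ⁆ LieDerivation ℂ (LieAlgebra.loopAlgebra ℂ (ι → ℤ) 𝔤)
    (LieAlgebra.loopAlgebra ℂ (ι → ℤ) 𝔤) where
  toFun x :=
    { toLinearMap := x.onLaurent.rTensor 𝔤
      leibniz' := fun a b => by
        induction a using TensorProduct.induction_on with
        | zero => simp
        | add a a' h h' => simp only [add_lie, map_add, lie_add, h, h']; abel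
        | tmul f X =>
          induction b using TensorProduct.induction_on with
          | zero => simp
          | add a a' h h' => simp only [add_lie, map_add, lie_add, h, h']; abel
          | tmul g Y =>
            simp only [LieAlgebra.ExtendScalars.bracket_tmul, LinearMap.rTensor_tmul,
              VecField.onLaurent_leibniz, TensorProduct.add_tmul]
            rw [← lie_skew Y X, TensorProduct.tmul_neg, sub_neg_eq_add, mul_comm g, add_comm] }
  map_add' x y := by ext; simp [LinearMap.rTensor_add]
  map_smul' c x := by ext; simp [LinearMap.rTensor_smul]
  map_lie' {x y} := by
    ext a
    induction a using TensorProduct.induction_on with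
    | zero => simp
    | add a a' h h' => simp only [map_add, h, h']
    | tmul f X =>
      simp [LieDerivation.lie_apply, VecField.onLaurent_lie, TensorProduct.sub_tmul]

theorem VecField.onLoop_vf (u : ι → ℂ) (r k : ι → ℤ) (X : 𝔤) :
    VecField.onLoop ι 𝔤 (vf u r) (lp X k) = pairing ι k u • lp X (k + r) := by
  change (VecField.onLaurent (vf u r)).rTensor 𝔤 (lp X k) = _
  rw [LinearMap.rTensor_tmul, VecField.onLaurent_vf, TensorProduct.smul_tmul']
  simp [mono]

variable (ι 𝔤) in
/-- `(𝔤 ⊗ ℂ[t^{±1}]) ⋊ Der ℂ[t^{±1}]`. -/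
abbrev LoopDer := LieAlgebra.SemiDirectSum (LieAlgebra.loopAlgebra ℂ (ι → ℤ) 𝔤) (VecField ι)
  (VecField.onLoop ι 𝔤)

/-- `X(k) = X ⊗ t^k` in the semidirect sum. -/
def LoopDer.X (X : 𝔤) (k : ι → ℤ) : LoopDer ι 𝔤 := LieAlgebra.SemiDirectSum.inl _ (lp X k)

variable (𝔤) in
/-- `D(u,r)` in the semidirect sum. -/
def LoopDer.D (u : ι → ℂ) (r : ι → ℤ) : LoopDer ι 𝔤 := LieAlgebra.SemiDirectSum.inr _ (vf u r)

theorem LoopDer.ind {p : LoopDer ι 𝔤 → Prop} (x : LoopDer ι 𝔤) (h0 : p 0)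
    (ha : ∀ x y, p x → p y → p (x + y)) (hX : ∀ X k, p (LoopDer.X X k))
    (hD : ∀ u r, p (LoopDer.D 𝔤 u r)) : p x := by
  obtain ⟨a, b⟩ := x
  have h1 : p ⟨a, 0⟩ := by
    induction a using lp_ind with
    | h0 => exact h0
    | ha x y hx hy => simpa using ha _ _ hx hy
    | hs X k => exact hX X k
  have h2 : p ⟨0, b⟩ := by
    induction b using VecField.ind with
    | h0 => exact h0
    | ha x y hx hy => simpa using ha _ _ hx hy
    | hs X k => exact hD X k
  simpa using ha _ _ h1 h2

theorem LoopDer.X_lie_X (X Y : 𝔤) (k l : ι → ℤ) :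
    ⁅LoopDer.X X k, LoopDer.X Y l⁆ = LoopDer.X ⁅X, Y⁆ (k + l) := by
  simp only [LoopDer.X, ← LieHom.map_lie, lp_lie]

theorem LoopDer.D_lie_D (u v : ι → ℂ) (r s : ι → ℤ) :
    ⁅LoopDer.D 𝔤 u r, LoopDer.D 𝔤 v s⁆ =
      LoopDer.D 𝔤 (pairing ι s u • v - pairing ι r v • u) (r + s) := by
  simp only [LoopDer.D, ← LieHom.map_lie, vf_lie]

theorem LoopDer.D_lie_X (u : ι → ℂ) (X : 𝔤) (r k : ι → ℤ) :
    ⁅LoopDer.D 𝔤 u r, LoopDer.X X k⁆ = pairing ι k u • LoopDer.X X (k + r) := by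
  simp [LoopDer.D, LoopDer.X, VecField.onLoop_vf]

instance : LieRingModule (LoopDer ι 𝔤) (Centre ι) where
  bracket x z := x.right.onCentre z
  add_lie x y z := by simp
  lie_add x y z := by simp
  leibniz_lie x y z := by simp [VecField.onCentre_lie]

theorem LoopDer.lie_centre (x : LoopDer ι 𝔤) (z : Centre ι) : ⁅x, z⁆ = x.right.onCentre z := rfl

instance : LieModule ℂ (LoopDer ι 𝔤) (Centre ι) where
  smul_lie c x z := by simp [LoopDer.lie_centre]
  lie_smul c x z := by simp [LoopDer.lie_centre]

/-- The bilinear map `(t^k, t^l) ↦ ∑ kᵢ t^{k+l} Kᵢ` from Laurent polynomials to `ΩA / dA`. -/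
def dPair (ι : Type) : Laurent ι →ₗ[ℂ] Laurent ι →ₗ[ℂ] Centre ι :=
  (homogBilin fun k l => LinearMap.mk₂ ℂ
    (fun c d : ℂ => (c * d) • ce (toC k) (k + l))
    (by intros; module) (by intros; simp only [smul_eq_mul]; module)
    (by intros; module) (by intros; simp only [smul_eq_mul]; module)).compl₁₂
  (AddMonoidAlgebra.coeffLinearEquiv ℂ).toLinearMap
  (AddMonoidAlgebra.coeffLinearEquiv ℂ).toLinearMap

theorem dPair_mono (k l : ι → ℤ) : dPair ι (mono k) (mono l) = ce (toC k) (k + l) := by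
  have : dPair ι (mono k) (mono l) = ((1 : ℂ) * 1) • ce (toC k) (k + l) := homogBilin_single ..
  simpa using this

/-- `(X ⊗ t^k, Y ⊗ t^l) ↦ (X,Y) ∑ kᵢ t^{k+l} Kᵢ`. -/
def loopPair (ι : Type) (B : LinearMap.BilinForm ℂ 𝔤) :
    LieAlgebra.loopAlgebra ℂ (ι → ℤ) 𝔤 →ₗ[ℂ] LieAlgebra.loopAlgebra ℂ (ι → ℤ) 𝔤 →ₗ[ℂ] Centre ι :=
  (TensorProduct.map₂ (dPair ι) B).compr₂ (TensorProduct.rid ℂ (Centre ι)).toLinearMap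

theorem loopPair_lp (B : LinearMap.BilinForm ℂ 𝔤) (X Y : 𝔤) (k l : ι → ℤ) :
    loopPair ι B (lp X k) (lp Y l) = B X Y • ce (toC k) (k + l) := by
  simp [loopPair, dPair_mono]

/-- The combination `c₁ φ₁ + c₂ φ₂` of the two cocycles
`φ₁(D(u,r), D(v,s)) = -(u,s)(v,r) ∑ rₚ t^{r+s} Kₚ`,
`φ₂(D(u,r), D(v,s)) = (u,r)(v,s) ∑ rₚ t^{r+s} Kₚ`. -/
def derPair (ι : Type) [Fintype ι] (c₁ c₂ : ℂ) : VecField ι →ₗ[ℂ] VecField ι →ₗ[ℂ] Centre ι :=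
  homogBilin fun r s => LinearMap.mk₂ ℂ
    (fun u v => (c₁ * (-(pairing ι s u * pairing ι r v)) +
      c₂ * (pairing ι r u * pairing ι s v)) • ce (toC r) (r + s))
    (by intros; simp only [map_add]; module)
    (by intros; simp only [map_smul, smul_eq_mul]; module)
    (by intros; simp only [map_add]; module)
    (by intros; simp only [map_smul, smul_eq_mul]; module)

theorem derPair_vf (c₁ c₂ : ℂ) (u v : ι → ℂ) (r s : ι → ℤ) :
    derPair ι c₁ c₂ (vf u r) (vf v s) = (c₁ * (-(pairing ι s u * pairing ι r v)) +
      c₂ * (pairing ι r u * pairing ι s v)) • ce (toC r) (r + s) :=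
  homogBilin_single ..

/-- The bilinear map on `(𝔤 ⊗ A) ⋊ Der A` defining the extension by `ΩA / dA`. -/
def pairForm (B : LinearMap.BilinForm ℂ 𝔤) (c₁ c₂ : ℂ) :
    LoopDer ι 𝔤 →ₗ[ℂ] LoopDer ι 𝔤 →ₗ[ℂ] Centre ι :=
  LinearMap.mk₂ ℂ
    (fun x y => loopPair ι B x.left y.left + derPair ι c₁ c₂ x.right y.right)
    (by intros; simp; abel) (by intros; simp) (by intros; simp; abel) (by intros; simp)

theorem pairForm_apply (B : LinearMap.BilinForm ℂ 𝔤) (c₁ c₂ : ℂ) (x y : LoopDer ι 𝔤) :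
    pairForm B c₁ c₂ x y = loopPair ι B x.left y.left + derPair ι c₁ c₂ x.right y.right := rfl

theorem pairForm_XX (B : LinearMap.BilinForm ℂ 𝔤) (c₁ c₂ : ℂ) (X Y : 𝔤) (k l : ι → ℤ) :
    pairForm B c₁ c₂ (LoopDer.X X k) (LoopDer.X Y l) = B X Y • ce (toC k) (k + l) := by
  simp [pairForm_apply, LoopDer.X, loopPair_lp]

theorem pairForm_DD (B : LinearMap.BilinForm ℂ 𝔤) (c₁ c₂ : ℂ) (u v : ι → ℂ) (r s : ι → ℤ) :
    pairForm B c₁ c₂ (LoopDer.D 𝔤 u r) (LoopDer.D 𝔤 v s) =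
      (c₁ * (-(pairing ι s u * pairing ι r v)) +
        c₂ * (pairing ι r u * pairing ι s v)) • ce (toC r) (r + s) := by
  simp [pairForm_apply, LoopDer.D, derPair_vf]

theorem pairForm_XD (B : LinearMap.BilinForm ℂ 𝔤) (c₁ c₂ : ℂ) (X : 𝔤) (v : ι → ℂ) (r s : ι → ℤ) :
    pairForm B c₁ c₂ (LoopDer.X X r) (LoopDer.D 𝔤 v s) = 0 := by
  simp [pairForm_apply, LoopDer.D, LoopDer.X]

theorem pairForm_DX (B : LinearMap.BilinForm ℂ 𝔤) (c₁ c₂ : ℂ) (X : 𝔤) (v : ι → ℂ) (r s : ι → ℤ) :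
    pairForm B c₁ c₂ (LoopDer.D 𝔤 v s) (LoopDer.X X r) = 0 := by
  simp [pairForm_apply, LoopDer.D, LoopDer.X]

/-- Exact forms vanish: `∑ lᵢ t^{k+l} Kᵢ = -∑ kᵢ t^{k+l} Kᵢ`. -/
theorem ce_swap (k l : ι → ℤ) : ce (toC l) (l + k) = -ce (toC k) (k + l) := by
  rw [add_comm l k, eq_neg_iff_add_eq_zero, ← ce_add, ← toC_add, add_comm l k, ce_self]

theorem pairForm_skew (B : LinearMap.BilinForm ℂ 𝔤) (hB : B.IsSymm) (c₁ c₂ : ℂ)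
    (x y : LoopDer ι 𝔤) : pairForm B c₁ c₂ x y = -pairForm B c₁ c₂ y x := by
  induction x using LoopDer.ind with
  | h0 => simp only [map_zero, LinearMap.zero_apply, neg_zero]
  | ha x x' h h' => simp only [map_add, LinearMap.add_apply, h, h']; abel
  | hX X k =>
    induction y using LoopDer.ind with
    | h0 => simp only [map_zero, LinearMap.zero_apply, neg_zero]
    | ha x x' h h' => simp only [map_add, LinearMap.add_apply, h, h']; abel
    | hX Y l => rw [pairForm_XX, pairForm_XX, ce_swap k l, hB.eq Y X]; simp
    | hD u r => simp [pairForm_XD, pairForm_DX]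
  | hD u r =>
    induction y using LoopDer.ind with
    | h0 => simp only [map_zero, LinearMap.zero_apply, neg_zero]
    | ha x x' h h' => simp only [map_add, LinearMap.add_apply, h, h']; abel
    | hX Y l => simp [pairForm_XD, pairForm_DX]
    | hD v s => rw [pairForm_DD, pairForm_DD, ce_swap r s]; module

theorem LoopDer.X_lie_D (u : ι → ℂ) (X : 𝔤) (r k : ι → ℤ) :
    ⁅LoopDer.X X k, LoopDer.D 𝔤 u r⁆ = -(pairing ι k u • LoopDer.X X (k + r)) := by
  rw [← LoopDer.D_lie_X, lie_skew]

theorem LoopDer.X_lie_centre (X : 𝔤) (k : ι → ℤ) (z : Centre ι) : ⁅LoopDer.X X k, z⁆ = 0 := by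
  simp [LoopDer.lie_centre, LoopDer.X]

theorem LoopDer.D_lie_ce (u v : ι → ℂ) (r s : ι → ℤ) : ⁅LoopDer.D 𝔤 u r, ce v s⁆ =
    ce (pairing ι s u • v + (u ⬝ᵥ v) • toC r) (r + s) := by
  simp [LoopDer.lie_centre, LoopDer.D, VecField.onCentre_vf]

theorem pairForm_cocycle (B : LinearMap.BilinForm ℂ 𝔤) (hB : B.IsSymm)
    (hinv : ∀ X Y Z : 𝔤, B ⁅X, Y⁆ Z = B X ⁅Y, Z⁆) (c₁ c₂ : ℂ)
    (d : LoopDer ι 𝔤 →ₗ[ℂ] LoopDer ι 𝔤 →ₗ[ℂ] LoopDer ι 𝔤 →ₗ[ℂ] Centre ι)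
    (key : ∀ x y z, d x y z =
      ⁅x, pairForm B c₁ c₂ y z⁆ - ⁅y, pairForm B c₁ c₂ x z⁆ + ⁅z, pairForm B c₁ c₂ x y⁆
        - pairForm B c₁ c₂ ⁅x, y⁆ z + pairForm B c₁ c₂ ⁅x, z⁆ y - pairForm B c₁ c₂ ⁅y, z⁆ x)
    (x y z : LoopDer ι 𝔤) : d x y z = 0 := by
  have hce : ∀ r s q : ι → ℤ, ce (toC q) (r + s + q) =
      -ce (toC r) (r + s + q) - ce (toC s) (r + s + q) := by
    intro r s q
    rw [sub_eq_add_neg, ← neg_add, eq_neg_iff_add_eq_zero, ← ce_add, ← ce_add, ← toC_add,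
      ← toC_add, add_comm q, ce_self]
  have h1 : ∀ X Y Z, B ⁅X, Z⁆ Y = -B ⁅X, Y⁆ Z := fun X Y Z => by
    rw [hinv X Z Y, hinv X Y Z, ← lie_skew Z Y, map_neg]
  have h2 : ∀ X Y Z, B ⁅Y, Z⁆ X = B ⁅X, Y⁆ Z := fun X Y Z => by
    rw [hinv X Y Z]; exact hB.eq ⁅Y, Z⁆ X
  have hp : ∀ r s q : ι → ℤ, r + (s + q) = r + s + q ∧ s + (r + q) = r + s + q ∧
      q + (r + s) = r + s + q ∧ r + (q + s) = r + s + q ∧ s + (q + r) = r + s + q ∧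
      q + (s + r) = r + s + q ∧ r + q + s = r + s + q ∧ s + q + r = r + s + q ∧
      s + r + q = r + s + q ∧ q + r + s = r + s + q ∧ q + s + r = r + s + q := by
    intro r s q; refine ⟨?_, ?_, ?_, ?_, ?_, ?_, ?_, ?_, ?_, ?_, ?_⟩ <;> abel
  induction x using LoopDer.ind with
  | h0 => rw [map_zero, LinearMap.zero_apply, LinearMap.zero_apply]
  | ha a a' h h' => rw [map_add, LinearMap.add_apply, LinearMap.add_apply, h, h', add_zero]
  | hX X r =>
    induction y using LoopDer.ind with
    | h0 => rw [map_zero, LinearMap.zero_apply]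
    | ha a a' h h' => rw [map_add, LinearMap.add_apply, h, h', add_zero]
    | hX Y s =>
      induction z using LoopDer.ind with
      | h0 => rw [map_zero]
      | ha a a' h h' => rw [map_add, h, h', add_zero]
      | hX Z q =>
        simp only [key, pairForm_XX, pairForm_DD, pairForm_XD, pairForm_DX, LoopDer.X_lie_X,
          LoopDer.X_lie_D, LoopDer.D_lie_X, LoopDer.D_lie_D, LoopDer.X_lie_centre, map_neg,
          LinearMap.neg_apply, map_smul, LinearMap.smul_apply, lie_smul, LoopDer.D_lie_ce, lie_zero,
          smul_zero, neg_zero, sub_zero, add_zero, zero_add, zero_sub]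
        simp only [hp r s q]
        rw [h1 X Y Z, h2 X Y Z]
        simp only [toC_add, ce_add, ce_smul, hce r s q, dotProduct_toC, pairing_add, smul_eq_mul,
          map_sub, map_smul]
        module
      | hD w q =>
        simp only [key, pairForm_XX, pairForm_DD, pairForm_XD, pairForm_DX, LoopDer.X_lie_X,
          LoopDer.X_lie_D, LoopDer.D_lie_X, LoopDer.D_lie_D, LoopDer.X_lie_centre, map_neg,
          LinearMap.neg_apply, map_smul, LinearMap.smul_apply, lie_smul, LoopDer.D_lie_ce, lie_zero,
          smul_zero, neg_zero, sub_zero, add_zero, zero_add, zero_sub]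
        simp only [hp r s q]
        rw [show B Y X = B X Y from hB.eq Y X]
        simp only [toC_add, ce_add, ce_smul, hce r s q, dotProduct_toC, pairing_add, smul_eq_mul,
          map_sub, map_smul]
        module
    | hD v s =>
      induction z using LoopDer.ind with
      | h0 => rw [map_zero]
      | ha a a' h h' => rw [map_add, h, h', add_zero]
      | hX Z q =>
        simp only [key, pairForm_XX, pairForm_DD, pairForm_XD, pairForm_DX, LoopDer.X_lie_X,
          LoopDer.X_lie_D, LoopDer.D_lie_X, LoopDer.D_lie_D, LoopDer.X_lie_centre, map_neg,
          LinearMap.neg_apply, map_smul, LinearMap.smul_apply, lie_smul, LoopDer.D_lie_ce, lie_zero,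
          smul_zero, neg_zero, sub_zero, add_zero, zero_add, zero_sub]
        simp only [hp r s q]
        rw [show B Z X = B X Z from hB.eq Z X]
        simp only [toC_add, ce_add, ce_smul, hce r s q, dotProduct_toC, pairing_add, smul_eq_mul,
          map_sub, map_smul]
        module
      | hD w q =>
        simp only [key, pairForm_XX, pairForm_DD, pairForm_XD, pairForm_DX, LoopDer.X_lie_X,
          LoopDer.X_lie_D, LoopDer.D_lie_X, LoopDer.D_lie_D, LoopDer.X_lie_centre, map_neg,
          LinearMap.neg_apply, map_smul, LinearMap.smul_apply, lie_smul, LoopDer.D_lie_ce, lie_zero,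
          smul_zero, neg_zero, sub_zero, add_zero, zero_add, zero_sub]
  | hD u r =>
    induction y using LoopDer.ind with
    | h0 => rw [map_zero, LinearMap.zero_apply]
    | ha a a' h h' => rw [map_add, LinearMap.add_apply, h, h', add_zero]
    | hX Y s =>
      induction z using LoopDer.ind with
      | h0 => rw [map_zero]
      | ha a a' h h' => rw [map_add, h, h', add_zero]
      | hX Z q =>
        simp only [key, pairForm_XX, pairForm_DD, pairForm_XD, pairForm_DX, LoopDer.X_lie_X,
          LoopDer.X_lie_D, LoopDer.D_lie_X, LoopDer.D_lie_D, LoopDer.X_lie_centre, map_neg,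
          LinearMap.neg_apply, map_smul, LinearMap.smul_apply, lie_smul, LoopDer.D_lie_ce, lie_zero,
          smul_zero, neg_zero, sub_zero, add_zero, zero_add, zero_sub]
        simp only [hp r s q]
        rw [show B Z Y = B Y Z from hB.eq Z Y]
        simp only [toC_add, ce_add, ce_smul, hce r s q, dotProduct_toC, pairing_add, smul_eq_mul,
          map_sub, map_smul]
        module
      | hD w q =>
        simp only [key, pairForm_XX, pairForm_DD, pairForm_XD, pairForm_DX, LoopDer.X_lie_X,
          LoopDer.X_lie_D, LoopDer.D_lie_X, LoopDer.D_lie_D, LoopDer.X_lie_centre, map_neg,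
          LinearMap.neg_apply, map_smul, LinearMap.smul_apply, lie_smul, LoopDer.D_lie_ce, lie_zero,
          smul_zero, neg_zero, sub_zero, add_zero, zero_add, zero_sub]
    | hD v s =>
      induction z using LoopDer.ind with
      | h0 => rw [map_zero]
      | ha a a' h h' => rw [map_add, h, h', add_zero]
      | hX Z q =>
        simp only [key, pairForm_XX, pairForm_DD, pairForm_XD, pairForm_DX, LoopDer.X_lie_X,
          LoopDer.X_lie_D, LoopDer.D_lie_X, LoopDer.D_lie_D, LoopDer.X_lie_centre, map_neg,
          LinearMap.neg_apply, map_smul, LinearMap.smul_apply, lie_smul, LoopDer.D_lie_ce, lie_zero,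
          smul_zero, neg_zero, sub_zero, add_zero, zero_add, zero_sub]
      | hD w q =>
        simp only [key, pairForm_XX, pairForm_DD, pairForm_XD, pairForm_DX, LoopDer.X_lie_X,
          LoopDer.X_lie_D, LoopDer.D_lie_X, LoopDer.D_lie_D, LoopDer.X_lie_centre, map_neg,
          LinearMap.neg_apply, map_smul, LinearMap.smul_apply, lie_smul, LoopDer.D_lie_ce, lie_zero,
          smul_zero, neg_zero, sub_zero, add_zero, zero_add, zero_sub]
        simp only [hp r s q]
        simp only [toC_add, ce_add, ce_smul, hce r s q, dotProduct_toC, pairing_add, smul_eq_mul,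
          map_sub, map_smul]
        module

open LieModule.Cohomology in
/-- The 2-cocycle of the semidirect sum with values in `ΩA / dA`. -/
def fullCocycle (ι : Type) [Fintype ι] (B : LinearMap.BilinForm ℂ 𝔤) (hB : B.IsSymm)
    (hinv : ∀ X Y Z : 𝔤, B ⁅X, Y⁆ Z = B X ⁅Y, Z⁆) (c₁ c₂ : ℂ) :
    twoCocycle ℂ (LoopDer ι 𝔤) (Centre ι) where
  val :=
    { val := pairForm B c₁ c₂
      property := fun x => by
        have h : (2 : ℂ) • pairForm B c₁ c₂ x x = 0 := by
          rw [two_smul]; nth_rewrite 1 [pairForm_skew B hB]; simp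
        exact (smul_eq_zero.1 h).resolve_left two_ne_zero }
  property := by
    rw [mem_twoCocycle_iff]
    ext x y z
    exact pairForm_cocycle B hB hinv c₁ c₂ _ (fun _ _ _ => rfl) x y z

end WithLie
end General

section Twisted

variable {𝔤 : Type*} [LieRing 𝔤] [LieAlgebra ℂ 𝔤]

/-- Two invariant forms on a simple Lie algebra over `ℂ` are proportional; the second one is the
Killing form here. -/
theorem invariant_form_eq_killing [FiniteDimensional ℂ 𝔤] [LieAlgebra.IsSimple ℂ 𝔤]
    (B : LinearMap.BilinForm ℂ 𝔤) (hinv : ∀ X Y Z : 𝔤, B ⁅X, Y⁆ Z = B X ⁅Y, Z⁆) :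
    ∃ c : ℂ, ∀ X Y, B X Y = c * killingForm ℂ 𝔤 X Y := by
  have : Nontrivial 𝔤 := LieAlgebra.IsSimple.nontrivial ℂ 𝔤
  have hκ : (killingForm ℂ 𝔤).Nondegenerate := LieAlgebra.IsKilling.killingForm_nondegenerate ℂ 𝔤
  let e := LinearMap.BilinForm.toDual (killingForm ℂ 𝔤) hκ
  let φ : Module.End ℂ 𝔤 := e.symm.toLinearMap ∘ₗ B
  have hφ : ∀ X Y, killingForm ℂ 𝔤 (φ X) Y = B X Y := fun X Y =>
    congrArg (fun f : Module.Dual ℂ 𝔤 => f Y) (e.apply_symm_apply (B X))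
  obtain ⟨c, hc⟩ := Module.End.exists_eigenvalue φ
  obtain ⟨x₀, hx₀⟩ := hc.exists_hasEigenvector
  let I : LieIdeal ℂ 𝔤 :=
    { LinearMap.ker (B - c • killingForm ℂ 𝔤) with
      lie_mem := by
        intro z x hx
        have hx' : ∀ y, B x y = c * killingForm ℂ 𝔤 x y := fun y => by
          have := congrArg (fun f => f y) (LinearMap.mem_ker.1 hx)
          simpa [sub_eq_zero] using this
        refine LinearMap.mem_ker.2 (LinearMap.ext fun y => ?_)
        have h1 : killingForm ℂ 𝔤 ⁅x, z⁆ y = killingForm ℂ 𝔤 x ⁅z, y⁆ :=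
          LieModule.traceForm_apply_lie_apply ℂ 𝔤 𝔤 x z y
        have h2 : B ⁅x, z⁆ y = c * killingForm ℂ 𝔤 ⁅x, z⁆ y := by rw [hinv, hx', h1]
        have h3 : ⁅z, x⁆ = -⁅x, z⁆ := (lie_skew z x).symm
        rw [LinearMap.sub_apply, LinearMap.sub_apply, LinearMap.smul_apply, LinearMap.smul_apply,
          h3, map_neg, map_neg, LinearMap.neg_apply, LinearMap.neg_apply, h2]
        simp }
  have hI : I = ⊤ := by
    refine (LieAlgebra.IsSimple.eq_bot_or_eq_top I).resolve_left fun h => hx₀.2 ?_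
    have : x₀ ∈ I := by
      refine LinearMap.mem_ker.2 (LinearMap.ext fun y => ?_)
      have := hφ x₀ y
      rw [hx₀.apply_eq_smul] at this
      simp [← this]
    rw [h] at this
    simpa using this
  refine ⟨c, fun X Y => ?_⟩
  have : X ∈ I := hI ▸ LieSubmodule.mem_top X
  have := congrArg (fun f => f Y) (LinearMap.mem_ker.1 this)
  simpa [sub_eq_zero] using this

variable (𝔤) in
/-- The data defining the twisted full toroidal Lie algebra: an invariant form `(,)` on `𝔤`, the
commuting automorphisms `σ₀, …, σₙ` of finite orders `m₀, …, mₙ`, primitive roots of unity `ξᵢ`,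
and the coefficients of the cocycle `φ = c₁ φ₁ + c₂ φ₂`. -/
structure TwistData (n : ℕ) where
  B : LinearMap.BilinForm ℂ 𝔤
  symm : B.IsSymm
  inv : ∀ X Y Z : 𝔤, B ⁅X, Y⁆ Z = B X ⁅Y, Z⁆
  nondeg : B.Nondegenerate
  σ : Fin (n + 1) → 𝔤 ≃ₗ⁅ℂ⁆ 𝔤
  comm : ∀ i j x, σ i (σ j x) = σ j (σ i x)
  m : Fin (n + 1) → ℕ
  m_pos : ∀ i, 0 < m i
  order : ∀ i, orderOf (((σ i : 𝔤 →ₗ⁅ℂ⁆ 𝔤) : 𝔤 →ₗ[ℂ] 𝔤) : Module.End ℂ 𝔤) = m i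
  ξ : Fin (n + 1) → ℂ
  prim : ∀ i, IsPrimitiveRoot (ξ i) (m i)
  c₁ : ℂ
  c₂ : ℂ

namespace TwistData

variable {n : ℕ} (S : TwistData 𝔤 n)

/-- `𝔤(k̄₀, k̄) = {x | σᵢ x = ξᵢ^{kᵢ} x, 0 ≤ i ≤ n}`. -/
def comp (k : Fin (n + 1) → ℤ) : Submodule ℂ 𝔤 where
  carrier := {x | ∀ i, S.σ i x = S.ξ i ^ k i • x}
  add_mem' := fun hx hy i => by rw [map_add, hx i, hy i, smul_add]
  zero_mem' := fun i => by simp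
  smul_mem' := fun c x hx i => by rw [map_smul, hx i, smul_comm]

/-- The lattice `Γ₀ ⊕ Γ = m₀ℤ ⊕ ⋯ ⊕ mₙℤ`. -/
def Lam : AddSubgroup (Fin (n + 1) → ℤ) where
  carrier := {r | ∀ i, (S.m i : ℤ) ∣ r i}
  add_mem' := fun hx hy i => dvd_add (hx i) (hy i)
  zero_mem' := fun _ => dvd_zero _
  neg_mem' := fun hx i => (dvd_neg).2 (hx i)

/-- The lattice `Γ = m₁ℤ ⊕ ⋯ ⊕ mₙℤ`. -/
def Gam : AddSubgroup (Fin n → ℤ) where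
  carrier := {r | ∀ i, (S.m i.succ : ℤ) ∣ r i}
  add_mem' := fun {a b} hx hy i => by
    have h1 : (S.m i.succ : ℤ) ∣ a i := hx i
    have h2 : (S.m i.succ : ℤ) ∣ b i := hy i
    exact dvd_add h1 h2
  zero_mem' := fun _ => dvd_zero _
  neg_mem' := fun {a} hx i => by
    have h1 : (S.m i.succ : ℤ) ∣ a i := hx i
    exact (dvd_neg).2 h1

/-- The untwisted full toroidal Lie algebra `𝔤 ⊗ A ⊕ ΩA/dA ⊕ Der A`, `A = ℂ[t₀^{±1}, …, tₙ^{±1}]`,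
with the cocycle `c₁ φ₁ + c₂ φ₂`. -/
abbrev Full : Type _ :=
  LieAlgebra.ofTwoCocycle (fullCocycle (Fin (n + 1)) S.B S.symm S.inv S.c₁ S.c₂)

/-- The linear inclusion of `(𝔤 ⊗ A) ⊕ Der A`. -/
def lift : LoopDer (Fin (n + 1)) 𝔤 →ₗ[ℂ] S.Full where
  toFun x := LieAlgebra.ofProd _ (x, 0)
  map_add' x y := by rw [← LieAlgebra.of_add]; simp
  map_smul' c x := by rw [RingHom.id_apply, ← LieAlgebra.of_smul]; simp

/-- The inclusion of `ΩA/dA`. -/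
def cen : Centre (Fin (n + 1)) →ₗ[ℂ] S.Full where
  toFun x := LieAlgebra.ofProd _ (0, x)
  map_add' x y := by rw [← LieAlgebra.of_add]; simp
  map_smul' c x := by rw [RingHom.id_apply, ← LieAlgebra.of_smul]; simp

/-- `X(k₀,k) = X ⊗ t₀^{k₀} t^k`. -/
def X (x : 𝔤) (k : Fin (n + 1) → ℤ) : S.Full := S.lift (LoopDer.X x k)

/-- `t₀^{r₀} t^r ∑ uᵢ Kᵢ`. -/
def K (u : Fin (n + 1) → ℂ) (r : Fin (n + 1) → ℤ) : S.Full := S.cen (ce u r)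

/-- `t₀^{r₀} t^r ∑ uᵢ dᵢ`. -/
def D (u : Fin (n + 1) → ℂ) (r : Fin (n + 1) → ℤ) : S.Full := S.lift (LoopDer.D 𝔤 u r)

theorem lift_lie (x y : LoopDer (Fin (n + 1)) 𝔤) :
    ⁅S.lift x, S.lift y⁆ = S.lift ⁅x, y⁆ + S.cen (pairForm S.B S.c₁ S.c₂ x y) := by
  change LieAlgebra.ofProd _ (⁅x, y⁆, pairForm S.B S.c₁ S.c₂ x y + ⁅x, (0 : Centre _)⁆
    - ⁅y, (0 : Centre _)⁆) = LieAlgebra.ofProd _ (⁅x, y⁆ + 0, 0 + pairForm S.B S.c₁ S.c₂ x y)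
  simp

theorem lift_lie_cen (x : LoopDer (Fin (n + 1)) 𝔤) (z : Centre (Fin (n + 1))) :
    ⁅S.lift x, S.cen z⁆ = S.cen ⁅x, z⁆ := by
  change LieAlgebra.ofProd _ (⁅x, (0 : LoopDer _ 𝔤)⁆, pairForm S.B S.c₁ S.c₂ x 0 + ⁅x, z⁆
    - ⁅(0 : LoopDer _ 𝔤), (0 : Centre _)⁆) = LieAlgebra.ofProd _ (0, ⁅x, z⁆)
  rw [lie_zero, lie_zero, map_zero, zero_add, sub_zero]

theorem cen_lie_cen (z w : Centre (Fin (n + 1))) : ⁅S.cen z, S.cen w⁆ = 0 := by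
  change LieAlgebra.ofProd _ (⁅(0 : LoopDer _ 𝔤), (0 : LoopDer _ 𝔤)⁆,
    pairForm S.B S.c₁ S.c₂ 0 0 + ⁅(0 : LoopDer _ 𝔤), w⁆ - ⁅(0 : LoopDer _ 𝔤), z⁆) = 0
  rw [lie_zero, map_zero, zero_lie, zero_lie, zero_add, sub_zero]
  rfl

/-! The defining brackets. -/

theorem X_lie_X (x y : 𝔤) (k l : Fin (n + 1) → ℤ) :
    ⁅S.X x k, S.X y l⁆ = S.X ⁅x, y⁆ (k + l) + S.B x y • S.K (toC k) (k + l) := by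
  simp only [X, K, lift_lie, LoopDer.X_lie_X, pairForm_XX, map_smul]

theorem X_lie_K (x : 𝔤) (u : Fin (n + 1) → ℂ) (k l : Fin (n + 1) → ℤ) :
    ⁅S.X x k, S.K u l⁆ = 0 := by
  simp only [X, K, lift_lie_cen, LoopDer.X_lie_centre, map_zero]

theorem K_lie_K (u v : Fin (n + 1) → ℂ) (k l : Fin (n + 1) → ℤ) : ⁅S.K u k, S.K v l⁆ = 0 :=
  S.cen_lie_cen _ _

theorem D_lie_X (u : Fin (n + 1) → ℂ) (x : 𝔤) (r k : Fin (n + 1) → ℤ) :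
    ⁅S.D u r, S.X x k⁆ = pairing _ k u • S.X x (k + r) := by
  simp only [X, D, lift_lie, LoopDer.D_lie_X, pairForm_DX, map_smul, map_zero, add_zero]

theorem D_lie_K (u v : Fin (n + 1) → ℂ) (r s : Fin (n + 1) → ℤ) :
    ⁅S.D u r, S.K v s⁆ = pairing _ s u • S.K v (r + s) + (u ⬝ᵥ v) • S.K (toC r) (r + s) := by
  simp only [K, D, lift_lie_cen, LoopDer.D_lie_ce, ce_add, ce_smul, map_add, map_smul]

theorem D_lie_D (u v : Fin (n + 1) → ℂ) (r s : Fin (n + 1) → ℤ) :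
    ⁅S.D u r, S.D v s⁆ = S.D (pairing _ s u • v - pairing _ r v • u) (r + s) +
      (S.c₁ * (-(pairing _ s u * pairing _ r v)) + S.c₂ * (pairing _ r u * pairing _ s v)) •
        S.K (toC r) (r + s) := by
  simp only [K, D, lift_lie, LoopDer.D_lie_D, pairForm_DD, map_smul]

theorem X_add (x y : 𝔤) (k : Fin (n + 1) → ℤ) : S.X (x + y) k = S.X x k + S.X y k := by
  simp [X, ← map_add, LoopDer.X, TensorProduct.tmul_add]

theorem X_smul (c : ℂ) (x : 𝔤) (k : Fin (n + 1) → ℤ) : S.X (c • x) k = c • S.X x k := by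
  simp [X, ← map_smul, LoopDer.X, -TensorProduct.tmul_smul, ← TensorProduct.tmul_smul]

/-! The grading of `𝔤` by the eigenvalues of the `σᵢ`. -/

theorem ξ_ne_zero (i : Fin (n + 1)) : S.ξ i ≠ 0 := (S.prim i).ne_zero (S.m_pos i).ne'

theorem comp_add_Lam (k r : Fin (n + 1) → ℤ) (hr : r ∈ S.Lam) : S.comp (k + r) = S.comp k := by
  ext x
  refine forall_congr' fun i => ?_
  obtain ⟨a, ha⟩ := hr i
  have : S.ξ i ^ r i = 1 := by rw [ha, zpow_mul, zpow_natCast, (S.prim i).pow_eq_one, one_zpow]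
  rw [Pi.add_apply, zpow_add₀ (S.ξ_ne_zero i), this, mul_one]

theorem lie_mem_comp {x y : 𝔤} {k l : Fin (n + 1) → ℤ} (hx : x ∈ S.comp k) (hy : y ∈ S.comp l) :
    ⁅x, y⁆ ∈ S.comp (k + l) := fun i => by
  rw [LieEquiv.map_lie, hx i, hy i, Pi.add_apply, zpow_add₀ (S.ξ_ne_zero i), smul_lie, lie_smul,
    smul_smul]

/-- The form is invariant under the automorphisms, as it is a multiple of the Killing form. -/
theorem B_σ [FiniteDimensional ℂ 𝔤] [LieAlgebra.IsSimple ℂ 𝔤] (i : Fin (n + 1)) (x y : 𝔤) :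
    S.B (S.σ i x) (S.σ i y) = S.B x y := by
  obtain ⟨c, hc⟩ := invariant_form_eq_killing S.B S.inv
  rw [hc, hc, LieAlgebra.killingForm_of_equiv_apply]

theorem add_mem_Lam [FiniteDimensional ℂ 𝔤] [LieAlgebra.IsSimple ℂ 𝔤] {x y : 𝔤}
    {k l : Fin (n + 1) → ℤ} (hx : x ∈ S.comp k) (hy : y ∈ S.comp l) (hB : S.B x y ≠ 0) :
    k + l ∈ S.Lam := fun i => by
  have h := S.B_σ i x y
  rw [hx i, hy i, map_smul, map_smul, LinearMap.smul_apply, smul_eq_mul, smul_eq_mul, ← mul_assoc,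
    ← zpow_add₀ (S.ξ_ne_zero i), mul_eq_right₀ hB] at h
  rw [Pi.add_apply, add_comm]
  exact ((S.prim i).zpow_eq_one_iff_dvd _).1 h

/-- The spanning elements `X(k₀,k)` with `X ∈ 𝔤(k̄₀,k̄)`, `t₀^{r₀} t^r Kᵢ` and `t₀^{r₀} t^r dᵢ` with
`(r₀, r) ∈ Γ₀ ⊕ Γ`, of the twisted full toroidal Lie algebra. -/
inductive Gen : S.Full → Prop
  | X (k : Fin (n + 1) → ℤ) (x : 𝔤) (hx : x ∈ S.comp k) : Gen (S.X x k)
  | K (u : Fin (n + 1) → ℂ) (r : Fin (n + 1) → ℤ) (hr : r ∈ S.Lam) : Gen (S.K u r)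
  | D (u : Fin (n + 1) → ℂ) (r : Fin (n + 1) → ℤ) (hr : r ∈ S.Lam) : Gen (S.D u r)

/-- The space `L(𝔤,σ) ⊕ Z(m₀,m) ⊕ D(m₀,m)`. -/
def tauSpace : Submodule ℂ S.Full := Submodule.span ℂ {x | S.Gen x}

theorem X_mem {k : Fin (n + 1) → ℤ} {x : 𝔤} (hx : x ∈ S.comp k) : S.X x k ∈ S.tauSpace :=
  Submodule.subset_span (Gen.X k x hx)

theorem K_mem (u : Fin (n + 1) → ℂ) {r : Fin (n + 1) → ℤ} (hr : r ∈ S.Lam) :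
    S.K u r ∈ S.tauSpace := Submodule.subset_span (Gen.K u r hr)

theorem D_mem (u : Fin (n + 1) → ℂ) {r : Fin (n + 1) → ℤ} (hr : r ∈ S.Lam) :
    S.D u r ∈ S.tauSpace := Submodule.subset_span (Gen.D u r hr)

theorem gen_lie_gen [FiniteDimensional ℂ 𝔤] [LieAlgebra.IsSimple ℂ 𝔤] {a b : S.Full}
    (ha : S.Gen a) (hb : S.Gen b) : ⁅a, b⁆ ∈ S.tauSpace := by
  cases ha with
  | X k x hx =>
    cases hb with
    | X l y hy =>
      rw [X_lie_X]
      refine add_mem (S.X_mem (S.lie_mem_comp hx hy)) ?_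
      by_cases hB : S.B x y = 0
      · rw [hB, zero_smul]; exact zero_mem _
      · exact Submodule.smul_mem _ _ (S.K_mem _ (S.add_mem_Lam hx hy hB))
    | K u r hr => rw [X_lie_K]; exact zero_mem _
    | D u r hr =>
      rw [← lie_skew, D_lie_X]
      exact neg_mem (Submodule.smul_mem _ _ (S.X_mem (by rwa [S.comp_add_Lam _ _ hr])))
  | K u r hr =>
    cases hb with
    | X l y hy => rw [← lie_skew, X_lie_K, neg_zero]; exact zero_mem _
    | K v s hs => rw [K_lie_K]; exact zero_mem _
    | D v s hs =>
      rw [← lie_skew, D_lie_K]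
      exact neg_mem (add_mem (Submodule.smul_mem _ _ (S.K_mem _ (add_mem hs hr)))
        (Submodule.smul_mem _ _ (S.K_mem _ (add_mem hs hr))))
  | D u r hr =>
    cases hb with
    | X l y hy =>
      rw [D_lie_X]
      exact Submodule.smul_mem _ _ (S.X_mem (by rwa [S.comp_add_Lam _ _ hr]))
    | K v s hs =>
      rw [D_lie_K]
      exact add_mem (Submodule.smul_mem _ _ (S.K_mem _ (add_mem hr hs)))
        (Submodule.smul_mem _ _ (S.K_mem _ (add_mem hr hs)))
    | D v s hs =>
      rw [D_lie_D]
      exact add_mem (S.D_mem _ (add_mem hr hs))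
        (Submodule.smul_mem _ _ (S.K_mem _ (add_mem hr hs)))

/-- Brackets of spans. -/
theorem lie_span_mem {L : Type*} [LieRing L] [LieAlgebra ℂ L] {s t : Set L} {M : Submodule ℂ L}
    (h : ∀ a ∈ s, ∀ b ∈ t, ⁅a, b⁆ ∈ M) {x y : L} (hx : x ∈ Submodule.span ℂ s)
    (hy : y ∈ Submodule.span ℂ t) : ⁅x, y⁆ ∈ M := by
  induction hx using Submodule.span_induction with
  | zero => simp
  | add a b _ _ ha hb => rw [add_lie]; exact add_mem ha hb
  | smul c a _ ha => rw [smul_lie]; exact M.smul_mem _ ha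
  | mem a ha =>
    induction hy using Submodule.span_induction with
    | zero => simp
    | add a b _ _ ha hb => rw [lie_add]; exact add_mem ha hb
    | smul c a _ ha => rw [lie_smul]; exact M.smul_mem _ ha
    | mem b hb => exact h a ha b hb

/-- The fixed point algebra `𝔤(0̄,0̄)`. -/
def fixed : LieSubalgebra ℂ 𝔤 :=
  { S.comp 0 with lie_mem' := fun hx hy => by simpa using S.lie_mem_comp hx hy }

variable [FiniteDimensional ℂ 𝔤] [LieAlgebra.IsSimple ℂ 𝔤]

/-- The twisted full toroidal Lie algebra `τ = L(𝔤,σ) ⊕ Z(m₀,m) ⊕ D(m₀,m)`. -/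
def tau : LieSubalgebra ℂ S.Full :=
  { S.tauSpace with
    lie_mem' := fun hx hy => lie_span_mem (fun _ ha _ hb => S.gen_lie_gen ha hb) hx hy }

/-- `X(k₀,k)` as an element of `τ`. -/
def tX (k : Fin (n + 1) → ℤ) (x : S.comp k) : S.tau := ⟨S.X x k, S.X_mem x.2⟩

/-- `t₀^{r₀} t^r ∑ uᵢ Kᵢ` as an element of `τ`. -/
def tK (u : Fin (n + 1) → ℂ) (r : S.Lam) : S.tau := ⟨S.K u r, S.K_mem u r.2⟩

/-- `t₀^{r₀} t^r ∑ uᵢ dᵢ` as an element of `τ`. -/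
def tD (u : Fin (n + 1) → ℂ) (r : S.Lam) : S.tau := ⟨S.D u r, S.D_mem u r.2⟩

end TwistData

/-- `{x ∈ 𝔤 | [h,x] = α(h) x for all h ∈ 𝔥}`. -/
def wtSpace (𝔥 : LieSubalgebra ℂ 𝔤) (α : Module.Dual ℂ 𝔥) : Submodule ℂ 𝔤 where
  carrier := {x | ∀ h : 𝔥, ⁅(h : 𝔤), x⁆ = α h • x}
  add_mem' := fun hx hy h => by rw [lie_add, hx h, hy h, smul_add]
  zero_mem' := fun h => by simp
  smul_mem' := fun c x hx h => by rw [lie_smul, hx h, smul_comm]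

theorem wtSpace_lie {𝔥 : LieSubalgebra ℂ 𝔤} {x y : 𝔤} {α β : Module.Dual ℂ 𝔥}
    (hx : x ∈ wtSpace 𝔥 α) (hy : y ∈ wtSpace 𝔥 β) : ⁅x, y⁆ ∈ wtSpace 𝔥 (α + β) := fun h => by
  rw [leibniz_lie, hx h, hy h, smul_lie, lie_smul, LinearMap.add_apply, add_smul]

/-- `Δ(𝔨, 𝔥)`: the weights, zero included, of `𝔥` on the subspace `𝔨`. -/
def weights (𝔥 : LieSubalgebra ℂ 𝔤) (𝔨 : Submodule ℂ 𝔤) : Set (Module.Dual ℂ 𝔥) :=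
  {α | ∃ x ∈ 𝔨, x ≠ 0 ∧ x ∈ wtSpace 𝔥 α}

section Roots

variable {E : Type*} [AddCommGroup E] [Module ℂ E]

/-- The root system of type `B_l` in coordinates (`B₁ = A₁`): the short roots are `± eᵢ`, the long
ones `± eᵢ ± eⱼ`, `i ≠ j`. -/
def rootsB {l : ℕ} (e : Fin l → E) : Set E :=
  {α | (∃ i, α = e i ∨ α = -e i) ∨
    ∃ i j, i ≠ j ∧ (α = e i + e j ∨ α = e i - e j ∨ α = -e i - e j)}

/-- `Φ_en`: zero, the roots in `Φ`, and, when `Φ` is of type `B_l`, the doubles of the short roots. -/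
def enlarged (Φ : Set E) : Set E :=
  {α | α = 0 ∨ α ∈ Φ ∨
    ∃ (l : ℕ) (e : Module.Basis (Fin l) ℂ E), Φ = rootsB e ∧
      ∃ i, α = (2 : ℂ) • e i ∨ α = -((2 : ℂ) • e i)}

/-- A set of simple roots of `Φ`. -/
def IsSimpleRoots (Φ : Set E) {l : ℕ} (b : Fin l → E) : Prop :=
  (∀ i, b i ∈ Φ) ∧ LinearIndependent ℂ b ∧
    ∀ β ∈ Φ, β ∈ AddSubmonoid.closure (Set.range b) ∨ -β ∈ AddSubmonoid.closure (Set.range b)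

end Roots

/-- The standing assumptions on the twisted multiloop algebra, with a choice of a Cartan subalgebra
`𝔥(0)` of the simple Lie algebra `𝔤(0̄,0̄)` and of simple roots for it. The Cartan subalgebra `h0` is
contained in one of `𝔤`, and the weights of `h0` on `𝔤` lie in `Φ_en`, where `Φ` is the root system of
`𝔤(0̄,0̄)` with respect to `h0`. -/
structure CartanData {n : ℕ} (S : TwistData 𝔤 n) where
  simple : LieAlgebra.IsSimple ℂ S.fixed
  h0 : LieSubalgebra ℂ 𝔤
  h0_le : h0 ≤ S.fixed
  cartan : (h0.comap S.fixed.incl).IsCartanSubalgebra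
  exists_cartan : ∃ 𝔥 : LieSubalgebra ℂ 𝔤, 𝔥.IsCartanSubalgebra ∧ h0 ≤ 𝔥
  roots : weights h0 ⊤ ⊆ enlarged (weights h0 S.fixed.toSubmodule \ {0})
  rk : ℕ
  base : Fin rk → Module.Dual ℂ h0
  isBase : IsSimpleRoots (weights h0 S.fixed.toSubmodule \ {0}) base

namespace CartanData

variable {n : ℕ} {S : TwistData 𝔤 n} (C : CartanData S)

/-- `𝔤(k̄₀, k̄, α)`. -/
def comp (k : Fin (n + 1) → ℤ) (α : Module.Dual ℂ C.h0) : Submodule ℂ 𝔤 :=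
  S.comp k ⊓ wtSpace C.h0 α

/-- `α + k₀ δ₀ > 0`: either `k₀ > 0`, or `k₀ = 0` and `α` is a non-zero sum of simple roots. -/
def Pos (k₀ : ℤ) (α : Module.Dual ℂ C.h0) : Prop :=
  0 < k₀ ∨ (k₀ = 0 ∧ α ≠ 0 ∧ α ∈ AddSubmonoid.closure (Set.range C.base))

/-- The spanning elements of `τ⁺ = L⁺(𝔤,σ) ⊕ Z⁺ ⊕ D⁺(m₀,m)`. -/
inductive GenPlus : S.Full → Prop
  | X (k : Fin (n + 1) → ℤ) (α : Module.Dual ℂ C.h0) (hk : C.Pos (k 0) α) (x : 𝔤)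
      (hx : x ∈ C.comp k α) : GenPlus (S.X x k)
  | K (u : Fin (n + 1) → ℂ) (r : Fin (n + 1) → ℤ) (hr : r ∈ S.Lam) (h0 : 0 < r 0) :
      GenPlus (S.K u r)
  | D (u : Fin (n + 1) → ℂ) (r : Fin (n + 1) → ℤ) (hr : r ∈ S.Lam) (h0 : 0 < r 0) :
      GenPlus (S.D u r)

/-- `τ⁺`. -/
def tauPlus : Submodule ℂ S.Full := Submodule.span ℂ {x | C.GenPlus x}

/-- The spanning elements of `τ⁰ = L⁰(𝔤,σ) ⊕ Z⁰ ⊕ D⁰(m₀,m)`. -/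
inductive GenZero : S.Full → Prop
  | X (k : Fin (n + 1) → ℤ) (hk : k 0 = 0) (x : 𝔤) (hx : x ∈ C.comp k 0) : GenZero (S.X x k)
  | K (u : Fin (n + 1) → ℂ) (r : Fin (n + 1) → ℤ) (hr : r ∈ S.Lam) (h0 : r 0 = 0) :
      GenZero (S.K u r)
  | D (u : Fin (n + 1) → ℂ) (r : Fin (n + 1) → ℤ) (hr : r ∈ S.Lam) (h0 : r 0 = 0) :
      GenZero (S.D u r)

/-- `τ⁰`. -/
def tauZero : Submodule ℂ S.Full := Submodule.span ℂ {x | C.GenZero x}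

theorem B_eq_zero {x y : 𝔤} {α : Module.Dual ℂ C.h0} (hα : α ≠ 0) (hx : x ∈ wtSpace C.h0 0)
    (hy : y ∈ wtSpace C.h0 α) : S.B x y = 0 := by
  obtain ⟨h, hh⟩ : ∃ h, α h ≠ 0 := by
    by_contra hc
    push Not at hc
    exact hα (LinearMap.ext hc)
  have h1 : S.B ⁅x, (h : 𝔤)⁆ y = S.B x ⁅(h : 𝔤), y⁆ := S.inv _ _ _
  rw [← lie_skew, hx h, hy h] at h1
  simpa [hh] using h1

theorem comp_add_Lam (k r : Fin (n + 1) → ℤ) (hr : r ∈ S.Lam) (α : Module.Dual ℂ C.h0) :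
    C.comp (k + r) α = C.comp k α := by rw [comp, S.comp_add_Lam k r hr, comp]

theorem genZero_lie_genPlus [FiniteDimensional ℂ 𝔤] [LieAlgebra.IsSimple ℂ 𝔤] {a b : S.Full} (ha : C.GenZero a) (hb : C.GenPlus b) :
    ⁅a, b⁆ ∈ C.tauPlus := by
  cases ha with
  | X k hk x hx =>
    cases hb with
    | X l α hl y hy =>
      rw [S.X_lie_X]
      have hkl : (k + l) 0 = l 0 := by rw [Pi.add_apply, hk, zero_add]
      refine add_mem (Submodule.subset_span (GenPlus.X (k + l) α (by rwa [hkl]) _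
        ⟨S.lie_mem_comp hx.1 hy.1, by simpa using wtSpace_lie hx.2 hy.2⟩)) ?_
      by_cases hB : S.B x y = 0
      · rw [hB, zero_smul]; exact zero_mem _
      · refine Submodule.smul_mem _ _ (Submodule.subset_span (GenPlus.K _ _
          (S.add_mem_Lam hx.1 hy.1 hB) ?_))
        rw [hkl]
        rcases hl with hl | hl
        · exact hl
        · exact absurd (C.B_eq_zero hl.2.1 hx.2 hy.2) hB
    | K u r hr h0 => rw [S.X_lie_K]; exact zero_mem _
    | D u r hr h0 =>
      rw [← lie_skew, S.D_lie_X]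
      refine neg_mem (Submodule.smul_mem _ _ (Submodule.subset_span (GenPlus.X _ 0 (Or.inl ?_) _
        (by rwa [C.comp_add_Lam _ _ hr]))))
      rwa [Pi.add_apply, hk, zero_add]
  | K u r hr h0 =>
    cases hb with
    | X l α hl y hy => rw [← lie_skew, S.X_lie_K, neg_zero]; exact zero_mem _
    | K v s hs hs0 => rw [S.K_lie_K]; exact zero_mem _
    | D v s hs hs0 =>
      have h1 : 0 < (s + r) 0 := by rwa [Pi.add_apply, h0, add_zero]
      rw [← lie_skew, S.D_lie_K]
      exact neg_mem (add_mem
        (Submodule.smul_mem _ _ (Submodule.subset_span (.K _ _ (add_mem hs hr) h1)))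
        (Submodule.smul_mem _ _ (Submodule.subset_span (.K _ _ (add_mem hs hr) h1))))
  | D u r hr h0 =>
    cases hb with
    | X l α hl y hy =>
      rw [S.D_lie_X]
      refine Submodule.smul_mem _ _ (Submodule.subset_span (GenPlus.X _ α ?_ _
        (by rwa [C.comp_add_Lam _ _ hr])))
      rwa [Pi.add_apply, h0, add_zero]
    | K v s hs hs0 =>
      have h1 : 0 < (r + s) 0 := by rwa [Pi.add_apply, h0, zero_add]
      rw [S.D_lie_K]
      exact add_mem (Submodule.smul_mem _ _ (Submodule.subset_span (.K _ _ (add_mem hr hs) h1)))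
        (Submodule.smul_mem _ _ (Submodule.subset_span (.K _ _ (add_mem hr hs) h1)))
    | D v s hs hs0 =>
      have h1 : 0 < (r + s) 0 := by rwa [Pi.add_apply, h0, zero_add]
      rw [S.D_lie_D]
      exact add_mem (Submodule.subset_span (.D _ _ (add_mem hr hs) h1))
        (Submodule.smul_mem _ _ (Submodule.subset_span (.K _ _ (add_mem hr hs) h1)))

/-! ### The Lie algebra `L̃ = I ⋉ L(𝔤°,σ)` -/

/-- `𝔤° = {x | σ₀ x = x, [h,x] = 0 for h ∈ 𝔥(0)}`. -/
def gcirc : LieSubalgebra ℂ 𝔤 where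
  carrier := {x | S.σ 0 x = x ∧ ∀ h ∈ C.h0, ⁅h, x⁆ = 0}
  add_mem' := fun hx hy => ⟨by rw [map_add, hx.1, hy.1], fun h hh => by
    rw [lie_add, hx.2 h hh, hy.2 h hh, add_zero]⟩
  zero_mem' := ⟨map_zero _, fun h _ => lie_zero h⟩
  smul_mem' := fun c x hx => ⟨by rw [map_smul, hx.1], fun h hh => by
    rw [lie_smul, hx.2 h hh, smul_zero]⟩
  lie_mem' := fun hx hy => ⟨by rw [LieEquiv.map_lie, hx.1, hy.1], fun h hh => by
    rw [leibniz_lie, hx.2 h hh, hy.2 h hh, zero_lie, lie_zero, add_zero]⟩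

/-- `𝔤°_{k̄} = {x ∈ 𝔤° | σᵢ x = ξᵢ^{kᵢ} x, 1 ≤ i ≤ n}`. -/
def gcircComp (k : Fin n → ℤ) : Submodule ℂ C.gcirc where
  carrier := {x | ∀ i : Fin n, S.σ i.succ (x : 𝔤) = S.ξ i.succ ^ k i • (x : 𝔤)}
  add_mem' := fun {x y} hx hy i => by
    change S.σ i.succ ((x : 𝔤) + (y : 𝔤)) = _ • ((x : 𝔤) + (y : 𝔤))
    rw [map_add, hx i, hy i, smul_add]
  zero_mem' := fun i => by simp
  smul_mem' := fun c x hx i => by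
    change S.σ i.succ (c • (x : 𝔤)) = _ • (c • (x : 𝔤))
    rw [map_smul, hx i, smul_comm]

theorem gcircComp_le (k : Fin n → ℤ) (x : C.gcirc) (hx : x ∈ C.gcircComp k) :
    (x : 𝔤) ∈ C.comp (Fin.cons 0 k) 0 := by
  refine ⟨fun i => ?_, fun h => ?_⟩
  · refine Fin.cases ?_ (fun i => ?_) i
    · simpa using x.2.1
    · simpa using hx i
  · simpa using x.2.2 h h.2

theorem mem_gcircComp_add (k r : Fin n → ℤ) (hr : r ∈ S.Gam) :
    C.gcircComp (k + r) = C.gcircComp k := by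
  ext x
  refine forall_congr' fun i => ?_
  obtain ⟨a, ha⟩ := hr i
  have : S.ξ i.succ ^ r i = 1 := by
    rw [ha, zpow_mul, zpow_natCast, (S.prim _).pow_eq_one, one_zpow]
  rw [Pi.add_apply, zpow_add₀ (S.ξ_ne_zero _), this, mul_one]

theorem lie_mem_gcircComp {x y : C.gcirc} {k l : Fin n → ℤ} (hx : x ∈ C.gcircComp k)
    (hy : y ∈ C.gcircComp l) : ⁅x, y⁆ ∈ C.gcircComp (k + l) := fun i => by
  rw [LieSubalgebra.coe_bracket, LieEquiv.map_lie, hx i, hy i, Pi.add_apply,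
    zpow_add₀ (S.ξ_ne_zero _), smul_lie, lie_smul, smul_smul]

variable (𝔤) in
/-- `I(u,r) = D(u,r) - D(u,0)`. -/
def elI (u : Fin n → ℂ) (r : Fin n → ℤ) : LoopDer (Fin n) 𝔤 := LoopDer.D 𝔤 u r - LoopDer.D 𝔤 u 0

/-- The spanning elements of `L̃`: `X(k)` with `X ∈ 𝔤°_{k̄}`, and `I(u,r)` with `r ∈ Γ`. -/
inductive GenL : LoopDer (Fin n) 𝔤 → Prop
  | X (k : Fin n → ℤ) (x : C.gcirc) (hx : x ∈ C.gcircComp k) : GenL (LoopDer.X (x : 𝔤) k)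
  | I (u : Fin n → ℂ) (r : Fin n → ℤ) (hr : r ∈ S.Gam) : GenL (elI 𝔤 u r)

theorem genL_lie_genL {a b : LoopDer (Fin n) 𝔤} (ha : C.GenL a) (hb : C.GenL b) :
    ⁅a, b⁆ ∈ Submodule.span ℂ {x | C.GenL x} := by
  have hX : ∀ (k : Fin n → ℤ) (x : C.gcirc), x ∈ C.gcircComp k →
      LoopDer.X (x : 𝔤) k ∈ Submodule.span ℂ {x | C.GenL x} := fun k x hx =>
    Submodule.subset_span (GenL.X k x hx)
  have hI : ∀ (u : Fin n → ℂ) (r : Fin n → ℤ), r ∈ S.Gam →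
      elI 𝔤 u r ∈ Submodule.span ℂ {x | C.GenL x} := fun u r hr =>
    Submodule.subset_span (GenL.I u r hr)
  have hIX : ∀ (u : Fin n → ℂ) (r k : Fin n → ℤ) (x : C.gcirc), r ∈ S.Gam →
      x ∈ C.gcircComp k → ⁅elI 𝔤 u r, LoopDer.X (x : 𝔤) k⁆ ∈ Submodule.span ℂ {x | C.GenL x} := by
    intro u r k x hr hx
    rw [elI, sub_lie, LoopDer.D_lie_X, LoopDer.D_lie_X, add_zero]
    exact sub_mem (Submodule.smul_mem _ _ (hX _ x (by rwa [C.mem_gcircComp_add k r hr])))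
      (Submodule.smul_mem _ _ (hX _ x hx))
  cases ha with
  | X k x hx =>
    cases hb with
    | X l y hy => rw [LoopDer.X_lie_X]; exact hX _ ⁅x, y⁆ (C.lie_mem_gcircComp hx hy)
    | I u r hr => rw [← lie_skew]; exact neg_mem (hIX u r k x hr hx)
  | I u r hr =>
    cases hb with
    | X l y hy => exact hIX u r l y hr hy
    | I v s hs =>
      have h : ⁅elI 𝔤 u r, elI 𝔤 v s⁆ = pairing _ r v • elI 𝔤 u r - pairing _ s u • elI 𝔤 v s +
          elI 𝔤 (pairing _ s u • v - pairing _ r v • u) (r + s) := by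
        have hadd : ∀ (c d : ℂ) (a b : Fin n → ℂ) (q : Fin n → ℤ),
            LoopDer.D 𝔤 (c • a - d • b) q = c • LoopDer.D 𝔤 a q - d • LoopDer.D 𝔤 b q := by
          intro c d a b q
          simp only [LoopDer.D]
          rw [sub_eq_add_neg, ← neg_smul, vf_add, vf_smul, vf_smul, map_add, map_smul, map_smul]
          module
        have h0 : ∀ a : Fin n → ℂ, pairing (Fin n) 0 a = 0 := fun a => by simp [pairing_apply]
        simp only [elI, sub_lie, lie_sub, LoopDer.D_lie_D, hadd, h0, add_zero, zero_add]
        module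
      rw [h]
      exact add_mem (sub_mem (Submodule.smul_mem _ _ (hI u r hr)) (Submodule.smul_mem _ _
        (hI v s hs))) (hI _ _ (add_mem hr hs))

/-- `L̃ = I ⋉ L(𝔤°,σ)`. -/
def Ltilde : LieSubalgebra ℂ (LoopDer (Fin n) 𝔤) :=
  { Submodule.span ℂ {x | C.GenL x} with
    lie_mem' := fun hx hy => TwistData.lie_span_mem (fun _ ha _ hb => C.genL_lie_genL ha hb) hx hy }

/-- `X(k) ∈ L̃` for `X ∈ 𝔤°_{k̄}`. -/
def LX (k : Fin n → ℤ) (x : C.gcircComp k) : C.Ltilde :=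
  ⟨LoopDer.X ((x : C.gcirc) : 𝔤) k, Submodule.subset_span (GenL.X (C := C) k (x : C.gcirc) x.2)⟩

/-- `I(u,r) ∈ L̃` for `r ∈ Γ`. -/
def LI (u : Fin n → ℂ) (r : S.Gam) : C.Ltilde :=
  ⟨elI 𝔤 u r, Submodule.subset_span (GenL.I u r r.2)⟩

/-- `F_d`, spanned by the `X(k, r₁, …, r_d) = ∑_{s ⊆ {1,…,d}} (-1)^{|s|} X(k + ∑_{i ∈ s} rᵢ)`. -/
def idealF (d : ℕ) : Submodule ℂ (LoopDer (Fin n) 𝔤) :=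
  Submodule.span ℂ {y | ∃ (k : Fin n → ℤ) (x : C.gcircComp k) (r : Fin d → S.Gam),
    y = ∑ s : Finset (Fin d), (-1 : ℂ) ^ s.card •
      LoopDer.X ((x : C.gcirc) : 𝔤) (k + ∑ i ∈ s, (r i : Fin n → ℤ))}

variable (S) in
/-- `I_d`, spanned by the
`I_d(u, r, s₁, …, s_d) = ∑_{a ⊆ {1,…,d}} (-1)^{|a|} I(u, r + ∑_{i ∈ a} sᵢ)`. -/
def idealI (d : ℕ) : Submodule ℂ (LoopDer (Fin n) 𝔤) :=
  Submodule.span ℂ {y | ∃ (u : Fin n → ℂ) (r : S.Gam) (s : Fin d → S.Gam),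
    y = ∑ a : Finset (Fin d), (-1 : ℂ) ^ a.card •
      elI 𝔤 u ((r : Fin n → ℤ) + ∑ i ∈ a, (s i : Fin n → ℤ))}

/-! ### From `L̃` to `τ⁰` -/

/-- The linear map sending `D(u,r)` to `∑_{i ≥ 1} uᵢ t^r dᵢ`. -/
def embedVF : VecField (Fin n) →ₗ[ℂ] VecField (Fin (n + 1)) :=
  Finsupp.lsum ℂ fun r : Fin n → ℤ => Finsupp.lsingle (Fin.cons (α := fun _ => ℤ) 0 r) ∘ₗ
    LinearMap.pi (Fin.cons (α := fun _ => (Fin n → ℂ) →ₗ[ℂ] ℂ) 0 fun i => LinearMap.proj i)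

theorem embedVF_vf (u : Fin n → ℂ) (r : Fin n → ℤ) :
    embedVF (vf u r) = vf (Fin.cons 0 u) (Fin.cons 0 r) := by
  have h : embedVF (vf u r) = vf (LinearMap.pi (Fin.cons (α := fun _ => (Fin n → ℂ) →ₗ[ℂ] ℂ) 0
      fun i => LinearMap.proj i) u) (Fin.cons 0 r) := by
    unfold embedVF vf
    exact Finsupp.lsum_single ..
  rw [h]
  congr 1
  ext i
  refine Fin.cases ?_ (fun i => ?_) i <;> simp

variable (S) in
/-- The linear map sending `X(k)`, `D(u,r)` to `X(0,k)` and `∑_{i ≥ 1} uᵢ t^r dᵢ`. -/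
def embed : LoopDer (Fin n) 𝔤 →ₗ[ℂ] S.Full :=
  S.lift ∘ₗ (LieAlgebra.SemiDirectSum.toProdl _).symm.toLinearMap ∘ₗ
    LinearMap.prodMap
      ((AddMonoidAlgebra.mapDomainLinearMap ℂ ℂ (Fin.cons (α := fun _ => ℤ) 0)).rTensor 𝔤)
      embedVF ∘ₗ
    (LieAlgebra.SemiDirectSum.toProdl _).toLinearMap

theorem embed_X (x : 𝔤) (k : Fin n → ℤ) :
    embed S (LoopDer.X x k) = S.X x (Fin.cons 0 k) := by
  have h : embed S (LoopDer.X x k) = S.lift ((LieAlgebra.SemiDirectSum.toProdl _).symm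
    (((AddMonoidAlgebra.mapDomainLinearMap ℂ ℂ (Fin.cons (α := fun _ => ℤ) 0)).rTensor 𝔤) (lp x k),
      embedVF 0)) := rfl
  rw [h, map_zero, LinearMap.rTensor_tmul]
  simp [AddMonoidAlgebra.mapDomainLinearMap_single]
  rfl

theorem embed_D (u : Fin n → ℂ) (r : Fin n → ℤ) :
    embed S (LoopDer.D 𝔤 u r) = S.D (Fin.cons 0 u) (Fin.cons 0 r) := by
  have h : embed S (LoopDer.D 𝔤 u r) = S.lift ((LieAlgebra.SemiDirectSum.toProdl _).symm
    (((AddMonoidAlgebra.mapDomainLinearMap ℂ ℂ (Fin.cons (α := fun _ => ℤ) 0)).rTensor 𝔤) 0,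
      embedVF (vf u r))) := rfl
  rw [h, map_zero, embedVF_vf]
  rfl

variable (S) in
theorem cons_mem_Lam {r : Fin n → ℤ} (hr : r ∈ S.Gam) : (Fin.cons 0 r : Fin (n + 1) → ℤ) ∈ S.Lam :=
  fun i => Fin.cases (by simp) (fun i => by simpa using hr i) i

theorem tauZero_le : C.tauZero ≤ S.tauSpace := by
  refine Submodule.span_le.2 ?_
  rintro _ (⟨k, hk, x, hx⟩ | ⟨u, r, hr, h0⟩ | ⟨u, r, hr, h0⟩)
  · exact S.X_mem hx.1
  · exact S.K_mem u hr
  · exact S.D_mem u hr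

theorem embed_mem {x : LoopDer (Fin n) 𝔤} (hx : x ∈ C.Ltilde) : embed S x ∈ C.tauZero := by
  have : C.Ltilde.toSubmodule ≤ C.tauZero.comap (embed S) := by
    refine Submodule.span_le.2 ?_
    rintro _ (⟨k, x, hx⟩ | ⟨u, r, hr⟩)
    · rw [SetLike.mem_coe, Submodule.mem_comap, embed_X]
      exact Submodule.subset_span (GenZero.X _ (by simp) _ (C.gcircComp_le k x hx))
    · rw [SetLike.mem_coe, Submodule.mem_comap, elI, map_sub, embed_D, embed_D]
      exact sub_mem (Submodule.subset_span (GenZero.D _ _ (cons_mem_Lam S hr) (by simp)))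
        (Submodule.subset_span (GenZero.D _ _ (cons_mem_Lam S (zero_mem _)) (by simp)))
  exact this hx

variable [FiniteDimensional ℂ 𝔤] [LieAlgebra.IsSimple ℂ 𝔤]

/-- The linear map `L̃ → τ⁰ ⊆ τ` sending `X(k)` to `X(0,k)` and `I(u,r)` to
`∑_{i ≥ 1} uᵢ (t^r dᵢ - dᵢ)`. -/
def toTau : C.Ltilde →ₗ[ℂ] S.tau where
  toFun x := ⟨embed S x, C.tauZero_le (C.embed_mem x.2)⟩
  map_add' x y := Subtype.ext (map_add (embed S) (x : LoopDer (Fin n) 𝔤) y)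
  map_smul' c x := Subtype.ext (map_smul (embed S) c (x : LoopDer (Fin n) 𝔤))

/-! ### Modules -/

section Modules

variable (V : Type*) [AddCommGroup V] [Module ℂ V] [LieRingModule S.tau V] [LieModule ℂ S.tau V]

/-- `h ∈ 𝔥(0)` as an element of `τ`. -/
def tH (h : C.h0) : S.tau := S.tX 0 ⟨h, C.h0_le h.2⟩

/-- The dual `H*` of `H = 𝔥(0) ⊕ ∑ ℂ Kᵢ ⊕ ∑ ℂ dᵢ`: a weight is given by its restriction to `𝔥(0)`,
its values at the `Kᵢ` and its values at the `dᵢ`. -/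
abbrev Weight : Type _ := Module.Dual ℂ C.h0 × (Fin (n + 1) → ℂ) × (Fin (n + 1) → ℂ)

/-- The weight space `V_μ`. -/
def weightSpace (μ : C.Weight) : Submodule ℂ V where
  carrier := {v | (∀ h : C.h0, ⁅C.tH h, v⁆ = μ.1 h • v) ∧
    (∀ i, ⁅S.tK (Pi.single i 1) 0, v⁆ = μ.2.1 i • v) ∧
    ∀ i, ⁅S.tD (Pi.single i 1) 0, v⁆ = μ.2.2 i • v}
  add_mem' := fun hx hy => ⟨fun h => by rw [lie_add, hx.1, hy.1, smul_add],
    fun i => by rw [lie_add, hx.2.1, hy.2.1, smul_add],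
    fun i => by rw [lie_add, hx.2.2, hy.2.2, smul_add]⟩
  zero_mem' := by simp
  smul_mem' := fun c x hx => ⟨fun h => by rw [lie_smul, hx.1, smul_comm],
    fun i => by rw [lie_smul, hx.2.1, smul_comm],
    fun i => by rw [lie_smul, hx.2.2, smul_comm]⟩

/-- Integrable modules: `V` is the direct sum of its finite-dimensional weight spaces, and
`𝔤(k̄₀,k̄,α) ⊗ t₀^{k₀} t^k` acts locally nilpotently for `α ≠ 0`. -/
structure IsIntegrable : Prop where
  indep : iSupIndep (C.weightSpace V)
  span : ⨆ μ, C.weightSpace V μ = ⊤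
  finite : ∀ μ, FiniteDimensional ℂ (C.weightSpace V μ)
  nilpotent : ∀ (k : Fin (n + 1) → ℤ) (α : Module.Dual ℂ C.h0), α ≠ 0 →
    ∀ (x : S.comp k), (x : 𝔤) ∈ C.comp k α → ∀ v : V,
      ∃ N : ℕ, ((LieModule.toEnd ℂ S.tau V (S.tX k x)) ^ N) v = 0

/-- `T = {v | τ⁺ v = 0}`. -/
def T : Submodule ℂ V where
  carrier := {v | ∀ x : S.tau, (x : S.Full) ∈ C.tauPlus → ⁅x, v⁆ = 0}
  add_mem' := fun hv hw x hx => by rw [lie_add, hv x hx, hw x hx, add_zero]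
  zero_mem' := fun x _ => lie_zero x
  smul_mem' := fun c v hv x hx => by rw [lie_smul, hv x hx, smul_zero]

variable {V} in
theorem lie_mem_T {x : S.tau} (hx : (x : S.Full) ∈ C.tauZero) {v : V} (hv : v ∈ C.T V) :
    ⁅x, v⁆ ∈ C.T V := fun y hy => by
  have h : ((⁅x, y⁆ : S.tau) : S.Full) ∈ C.tauPlus :=
    TwistData.lie_span_mem (fun _ ha _ hb => C.genZero_lie_genPlus ha hb) hx hy
  have h1 := leibniz_lie x y v
  rw [hv y hy, lie_zero, hv _ h, zero_add] at h1
  exact h1.symm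

/-- The action of `L̃ ⊆ τ⁰` on `T`. -/
def actT : C.Ltilde →ₗ[ℂ] Module.End ℂ (C.T V) where
  toFun x := (LieModule.toEnd ℂ S.tau V (C.toTau x)).restrict
    fun _ hv => C.lie_mem_T (C.embed_mem x.2) hv
  map_add' x y := by
    refine LinearMap.ext fun v => Subtype.ext ?_
    change ⁅C.toTau (x + y), (v : V)⁆ = ⁅C.toTau x, (v : V)⁆ + ⁅C.toTau y, (v : V)⁆
    rw [map_add, add_lie]
  map_smul' c x := by
    refine LinearMap.ext fun v => Subtype.ext ?_
    change ⁅C.toTau (c • x), (v : V)⁆ = c • ⁅C.toTau x, (v : V)⁆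
    rw [map_smul, smul_lie]

theorem coe_actT (x : C.Ltilde) (v : C.T V) : (C.actT V x v : V) = ⁅C.toTau x, (v : V)⁆ := rfl

/-- `t^r K₀ ∈ τ` for `r ∈ Γ`. -/
def tK0 (r : S.Gam) : S.tau := S.tK (Pi.single 0 1) ⟨Fin.cons 0 r, cons_mem_Lam S r.2⟩

theorem tK0_mem (r : S.Gam) : (tK0 r : S.Full) ∈ C.tauZero :=
  Submodule.subset_span (GenZero.K (C := C) _ _ (cons_mem_Lam S r.2) (by simp))

variable (c : ℂ)

/-- The operator `t^r = (1/c) t^r K₀` on `T`; here `c` is the scalar by which `K₀` acts. -/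
def monoT (r : S.Gam) : Module.End ℂ (C.T V) :=
  c⁻¹ • (LieModule.toEnd ℂ S.tau V (tK0 r)).restrict
    fun _ hv => C.lie_mem_T (C.tK0_mem r) hv

theorem coe_monoT (r : S.Gam) (v : C.T V) : (C.monoT V c r v : V) = c⁻¹ • ⁅tK0 r, (v : V)⁆ := rfl

/-- `W`, spanned by the `t^r v - v`. -/
def W : Submodule ℂ (C.T V) :=
  Submodule.span ℂ {w | ∃ (r : S.Gam) (v : C.T V), w = C.monoT V c r v - v}

theorem toTau_X_lie_K0 (k : Fin n → ℤ) (x : C.gcircComp k) (s : S.Gam) :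
    ⁅C.toTau (C.LX k x), tK0 s⁆ = 0 := by
  refine Subtype.ext ?_
  change ⁅embed S (LoopDer.X ((x : C.gcirc) : 𝔤) k), S.K _ _⁆ = 0
  rw [embed_X, S.X_lie_K]

theorem toTau_I_lie_K0 (u : Fin n → ℂ) (r s : S.Gam) :
    ⁅C.toTau (C.LI u r), tK0 s⁆ = pairing _ (s : Fin n → ℤ) u • (tK0 (r + s) - tK0 s) := by
  refine Subtype.ext ?_
  change ⁅embed S (elI 𝔤 u r), S.K _ _⁆ = pairing _ (s : Fin n → ℤ) u • (S.K _ _ - S.K _ _)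
  have h1 : pairing _ (Fin.cons 0 (s : Fin n → ℤ)) (Fin.cons 0 u : Fin (n + 1) → ℂ) =
      pairing _ (s : Fin n → ℤ) u := by
    simp [pairing_apply, Fin.sum_univ_succ]
  have h2 : (Fin.cons 0 u : Fin (n + 1) → ℂ) ⬝ᵥ Pi.single 0 1 = 0 := by simp
  have h3 : ∀ a b : Fin n → ℤ, (Fin.cons 0 a : Fin (n + 1) → ℤ) + Fin.cons 0 b =
      Fin.cons 0 (a + b) := fun a b => by
    ext i; refine Fin.cases ?_ (fun i => ?_) i <;> simp
  rw [elI, map_sub, embed_D, embed_D, sub_lie, S.D_lie_K, S.D_lie_K, h1, h2, h3, h3]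
  simp [smul_sub]

theorem monoT_sub_mem (r : S.Gam) (v : C.T V) : C.monoT V c r v - v ∈ C.W V c :=
  Submodule.subset_span ⟨r, v, rfl⟩

theorem actT_X (k : Fin n → ℤ) (x : C.gcircComp k) (s : S.Gam) (v : C.T V) :
    C.actT V (C.LX k x) (C.monoT V c s v - v) =
      C.monoT V c s (C.actT V (C.LX k x) v) - C.actT V (C.LX k x) v := by
  refine Subtype.ext ?_
  rw [map_sub, AddSubgroupClass.coe_sub, AddSubgroupClass.coe_sub, coe_monoT, coe_actT, coe_actT,
    coe_monoT, lie_smul, leibniz_lie, toTau_X_lie_K0, zero_lie, zero_add]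

theorem actT_I (u : Fin n → ℂ) (r s : S.Gam) (v : C.T V) :
    C.actT V (C.LI u r) (C.monoT V c s v - v) =
      (C.monoT V c s (C.actT V (C.LI u r) v) - C.actT V (C.LI u r) v) +
        pairing _ (s : Fin n → ℤ) u •
          ((C.monoT V c (r + s) v - v) - (C.monoT V c s v - v)) := by
  have h : C.actT V (C.LI u r) (C.monoT V c s v) = C.monoT V c s (C.actT V (C.LI u r) v) +
      pairing _ (s : Fin n → ℤ) u • (C.monoT V c (r + s) v - C.monoT V c s v) := by
    refine Subtype.ext ?_
    rw [coe_actT, coe_monoT, lie_smul, leibniz_lie, toTau_I_lie_K0, smul_lie, sub_lie]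
    change _ = c⁻¹ • ⁅tK0 s, ⁅C.toTau (C.LI u r), (v : V)⁆⁆ + pairing _ (s : Fin n → ℤ) u •
      (c⁻¹ • ⁅tK0 (r + s), (v : V)⁆ - c⁻¹ • ⁅tK0 s, (v : V)⁆)
    module
  rw [map_sub, h]
  module

theorem W_stable (x : C.Ltilde) : C.W V c ≤ (C.W V c).comap (C.actT V x) := by
  suffices h : ∀ y ∈ Submodule.span ℂ {y | C.GenL y}, ∀ x : C.Ltilde, (x : LoopDer (Fin n) 𝔤) = y →
      ∀ w ∈ C.W V c, C.actT V x w ∈ C.W V c from h x x.2 x rfl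
  intro y hy
  induction hy using Submodule.span_induction with
  | zero =>
    intro x hx w _
    obtain rfl : x = 0 := Subtype.ext hx
    rw [map_zero]; exact zero_mem _
  | add a b ha hb iha ihb =>
    intro x hx w hw
    obtain ⟨a, rfl⟩ : ∃ a' : C.Ltilde, (a' : LoopDer (Fin n) 𝔤) = a := ⟨⟨a, ha⟩, rfl⟩
    obtain ⟨b, rfl⟩ : ∃ b' : C.Ltilde, (b' : LoopDer (Fin n) 𝔤) = b := ⟨⟨b, hb⟩, rfl⟩
    obtain rfl : x = a + b := Subtype.ext hx
    rw [map_add]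
    exact add_mem (iha a rfl w hw) (ihb b rfl w hw)
  | smul d a ha iha =>
    intro x hx w hw
    obtain ⟨a, rfl⟩ : ∃ a' : C.Ltilde, (a' : LoopDer (Fin n) 𝔤) = a := ⟨⟨a, ha⟩, rfl⟩
    obtain rfl : x = d • a := Subtype.ext hx
    rw [map_smul]
    exact Submodule.smul_mem _ d (iha a rfl w hw)
  | mem a ha =>
    intro x hx w hw
    have hle : C.W V c ≤ (C.W V c).comap (C.actT V x) := by
      refine Submodule.span_le.2 ?_
      rintro _ ⟨s, v, rfl⟩
      rw [SetLike.mem_coe, Submodule.mem_comap]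
      cases ha with
      | X k y hy =>
        obtain rfl : x = C.LX k ⟨y, hy⟩ := Subtype.ext hx
        rw [actT_X]
        exact C.monoT_sub_mem V c _ _
      | I u r hr =>
        obtain rfl : x = C.LI u ⟨r, hr⟩ := Subtype.ext hx
        rw [actT_I]
        exact add_mem (C.monoT_sub_mem V c _ _) (Submodule.smul_mem _ _
          (sub_mem (C.monoT_sub_mem V c _ _) (C.monoT_sub_mem V c _ _)))
    exact hle hw

/-- `Ṽ = T / W`. -/
abbrev Vtilde : Type _ := C.T V ⧸ C.W V c

/-- The action of `L̃` on `Ṽ`. -/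
def act : C.Ltilde →ₗ[ℂ] Module.End ℂ (C.Vtilde V c) where
  toFun x := (C.W V c).mapQ (C.W V c) (C.actT V x) (C.W_stable V c x)
  map_add' x y := by
    apply Submodule.linearMap_qext
    ext1 z
    simp
  map_smul' d x := by
    apply Submodule.linearMap_qext
    ext1 z
    simp

/-- `Ṽ_{k̄}`, the image of `T_k = {v ∈ T | dᵢ v = (μ(dᵢ) + kᵢ) v, 1 ≤ i ≤ n}`. -/
def gradedPart (μ : C.Weight) (k : Fin n → ℤ) : Submodule ℂ (C.Vtilde V c) :=
  Submodule.map (C.W V c).mkQ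
    { carrier := {v | ∀ i : Fin n, ⁅S.tD (Pi.single i.succ 1) 0, (v : V)⁆ =
        (μ.2.2 i.succ + (k i : ℂ)) • (v : V)}
      add_mem' := fun {v w} hv hw i => by
        change ⁅_, (v : V) + (w : V)⁆ = _ • ((v : V) + (w : V))
        rw [lie_add, hv i, hw i, smul_add]
      zero_mem' := fun i => by simp
      smul_mem' := fun d v hv i => by
        change ⁅_, d • (v : V)⁆ = _ • (d • (v : V))
        rw [lie_smul, hv i, smul_comm] }

/-- A linear automorphism `θ` of `Ṽ` is a `p̄`-graded automorphism of `L̃`-modules: it commutes with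
`L̃`, and `θ(Ṽ_{k̄}) = Ṽ_{k̄ - p̄}`. -/
structure IsGradedAut (μ : C.Weight) (p : Fin n → ℤ) (θ : C.Vtilde V c ≃ₗ[ℂ] C.Vtilde V c) :
    Prop where
  comm : ∀ (x : C.Ltilde) (v : C.Vtilde V c), θ (C.act V c x v) = C.act V c x (θ v)
  graded : ∀ k, (C.gradedPart V c μ k).map (θ : C.Vtilde V c →ₗ[ℂ] C.Vtilde V c) =
    C.gradedPart V c μ (k - p)

variable {V c}

/-- `M̃ᵢ = {v ∈ Ṽ | θ(v) = ζ^{-i} v}`. -/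
def Mtilde (θ : C.Vtilde V c ≃ₗ[ℂ] C.Vtilde V c) (ζ : ℂ) (i : ℕ) : Submodule ℂ (C.Vtilde V c) :=
  Module.End.eigenspace (θ : C.Vtilde V c →ₗ[ℂ] C.Vtilde V c) (ζ⁻¹ ^ i)

/-- A subspace of `Ṽ` is an irreducible `L̃`-submodule. -/
def IsIrreducibleSub (M : Submodule ℂ (C.Vtilde V c)) : Prop :=
  M ≠ ⊥ ∧ (∀ x, M ≤ M.comap (C.act V c x)) ∧
    ∀ N ≤ M, (∀ x, N ≤ N.comap (C.act V c x)) → N = ⊥ ∨ N = M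

end Modules

end CartanData

/-- The space `M` is non-zero, and has no proper non-zero subspaces stable under the operators `f x`. -/
def IsIrreducibleAction {L M : Type*} [AddCommGroup M] [Module ℂ M] (f : L → Module.End ℂ M) : Prop :=
  Nontrivial M ∧ ∀ N : Submodule ℂ M, (∀ x, N ≤ N.comap (f x)) → N = ⊥ ∨ N = ⊤

end Twisted
end Toroidal

end

attribute [local instance 100] LieRing.ofAssociativeRing

/-! At the start $\tilde L$ acts on $\tilde V$ only as a space of operators: the lifts to $\tau$ of
the elements of $\tilde L$ satisfy the relations of $\tilde L$ up to combinations of the central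
symbols $t^qK_i$, $q\in\Gamma$, $i\ge1$ (`toTau_defect`). The proof bounds the dimension, removes
these central terms, and then studies a genuine representation.

Finiteness. In $\tilde V=T/W$ a vector $v$ is identified with $t^rv$, so weights matter only modulo
$\Gamma$. The weights of one class modulo $\mathbb Z^n$ therefore contribute only finitely many
finite-dimensional weight spaces, and their sum is stable under $\tilde L$ and the $t^qK_i$. An
irreducible subspace lies in a finite sum of such spaces (`IsIrreducibleSub.exists_le`).

Central terms. Since $K_1,\dots,K_n$ act as $0$, bracketing with $I(v,-q)$ multiplies $t^qK_i$ by
$-(v,q)$. For $q\ne0$ an eigenvector of an inner derivation with non-zero eigenvalue is nilpotent. A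
commuting space of nilpotent operators normalised by an irreducible family has a non-zero stable
common kernel, so it is zero (`eq_zero_of_normalised`). Hence the brackets of $\tilde L$ hold
exactly on an irreducible subspace.

Jets. With $x_i=t_i^{m_i}$, the element $I(u,r)$ becomes the vector field $(x^r-1)\partial_u$, which
vanishes at $(1,\dots,1)$, and $X(k+r)$ becomes $x^r X(k)$. Let $\mathfrak m$ be the ideal of this
point. In finite dimension some vector field with polynomial coefficient in $x_i$ acts as $0$;
brackets turn this into an ideal of coefficients acting as $0$, stable under $(x_i-1)d_i$. A
polynomial generating a univariate ideal stable in this way has no roots outside $\{0,1\}$, and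
$x_i$ is invertible, so the ideal contains a power of $\mathfrak m$ (`exists_pow_le_kerIdeal`). The
Euler field $\sum(x_i-1)d_i$ has eigenvalue $d$ on the last surviving step of the $\mathfrak m$-adic
filtration. For $d>0$ this step is commuting, nilpotent and normalised, hence zero
(`vanishesAt_of_succ`). Descending to $d=1$ leaves $\mathfrak m/\mathfrak m^2\otimes\mathbb
C^n\cong\mathfrak{gl}_n$ together with $\mathring{\mathfrak g}$. -/

noncomputable section

namespace Toroidal

/-! ### Nilpotent operators normalised by an irreducible family -/

section Nilpotent

variable {M : Type*} [AddCommGroup M] [Module ℂ M] [FiniteDimensional ℂ M]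

/-- An eigenvector of `ad y` with non-zero eigenvalue is nilpotent. -/
theorem isNilpotent_of_lie_eq_smul {y z : Module.End ℂ M} {c : ℂ} (hc : c ≠ 0)
    (h : ⁅y, z⁆ = c • z) : IsNilpotent z := by
  by_contra hz
  have hz' : ∀ k : ℕ, z ^ k ≠ 0 := fun k hk => hz ⟨k, hk⟩
  let ad : Module.End ℂ (Module.End ℂ M) := LinearMap.mulLeft ℂ y - LinearMap.mulRight ℂ y
  -- If no power of `z` vanished, the `z ^ k` would be eigenvectors of `ad y` for the infinitely
  -- many eigenvalues `k * c`, on a finite-dimensional space.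
  have hpow : ∀ k : ℕ, ad (z ^ k) = (k * c : ℂ) • z ^ k := by
    intro k
    induction k with
    | zero => simp [ad]
    | succ k ih =>
      have h' : y * z = z * y + c • z := by
        rw [Ring.lie_def] at h; rw [← h]; abel
      have ih' : y * z ^ k = z ^ k * y + (k * c : ℂ) • z ^ k := by
        have : y * z ^ k - z ^ k * y = (k * c : ℂ) • z ^ k := ih
        rw [← this]; abel
      change y * z ^ (k + 1) - z ^ (k + 1) * y = _
      rw [pow_succ, ← mul_assoc, ih', add_mul, mul_assoc, h', mul_add, smul_mul_assoc,
        mul_smul_comm, mul_assoc]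
      push_cast
      module
  refine (Module.End.finite_hasEigenvalue ad).not_infinite ?_
  refine (Set.infinite_range_of_injective (f := fun k : ℕ => (k * c : ℂ)) ?_).mono ?_
  · intro a b hab
    exact_mod_cast mul_right_cancel₀ hc hab
  · rintro _ ⟨k, rfl⟩
    exact Module.End.hasEigenvalue_of_hasEigenvector
      (Module.End.hasEigenvector_iff.2 ⟨Module.End.mem_eigenspace_iff.2 (hpow k), hz' k⟩)

/-- Commuting nilpotent endomorphisms have a common kernel. -/
theorem exists_common_kernel [Nontrivial M] {S : Set (Module.End ℂ M)}
    (hcomm : ∀ s ∈ S, ∀ t ∈ S, Commute s t) (hnil : ∀ s ∈ S, IsNilpotent s) :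
    ∃ v : M, v ≠ 0 ∧ ∀ s ∈ S, s v = 0 := by
  -- Take a minimal non-zero stable subspace. The kernel of `s` on it is non-zero by nilpotency and
  -- stable by commutativity, hence it is the whole subspace.
  let F : Set (Submodule ℂ M) := {N | N ≠ ⊥ ∧ ∀ s ∈ S, N ≤ N.comap s}
  obtain ⟨N, hN, hmin⟩ := WellFounded.has_min (wellFounded_lt (α := Submodule ℂ M)) F
    ⟨⊤, top_ne_bot, fun s _ => le_top⟩
  obtain ⟨v, hv, hv0⟩ := N.exists_mem_ne_zero_of_ne_bot hN.1
  refine ⟨v, hv0, fun s hs => ?_⟩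
  have hle : N ⊓ LinearMap.ker s ≤ N := inf_le_left
  have hF : N ⊓ LinearMap.ker s ∈ F := by
    constructor
    · obtain ⟨k, hk⟩ := hnil s hs
      have hex : ∃ k, (s ^ k) v = 0 := ⟨k, by rw [hk]; rfl⟩
      classical
      have h0 : Nat.find hex ≠ 0 := by
        intro h
        have := Nat.find_spec hex
        rw [h] at this
        exact hv0 this
      obtain ⟨j, hj⟩ := Nat.exists_eq_succ_of_ne_zero h0
      have hjmin : (s ^ j) v ≠ 0 := Nat.find_min hex (by omega)
      have hjN : ∀ i, (s ^ i) v ∈ N := by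
        intro i
        induction i with
        | zero => exact hv
        | succ i ih => rw [pow_succ', Module.End.mul_apply]; exact hN.2 s hs ih
      refine (Submodule.ne_bot_iff _).2 ⟨(s ^ j) v, ⟨hjN j, ?_⟩, hjmin⟩
      have := Nat.find_spec hex
      rw [hj, Nat.succ_eq_add_one, pow_succ', Module.End.mul_apply] at this
      exact this
    · rintro t ht w ⟨hw, hw'⟩
      refine ⟨hN.2 t ht hw, ?_⟩
      have : s * t = t * s := hcomm s hs t ht
      have h2 := congrArg (fun f => f w) this
      simp only [Module.End.mul_apply] at h2
      rw [SetLike.mem_coe, LinearMap.mem_ker] at hw' ⊢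
      rw [h2, hw', map_zero]
  have := eq_of_le_of_not_lt hle (hmin _ hF)
  rw [← this] at hv
  exact hv.2

/-- A family of commuting nilpotent endomorphisms that is normalised by an irreducible family of
endomorphisms vanishes. -/
theorem eq_zero_of_normalised [Nontrivial M] {R : Set (Module.End ℂ M)}
    (S : Submodule ℂ (Module.End ℂ M))
    (hirr : ∀ N : Submodule ℂ M, (∀ a ∈ R, N ≤ N.comap a) → N = ⊥ ∨ N = ⊤)
    (hcomm : ∀ s ∈ S, ∀ t ∈ S, Commute s t) (hnil : ∀ s ∈ S, IsNilpotent s)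
    (hnorm : ∀ a ∈ R, ∀ s ∈ S, ⁅a, s⁆ ∈ S) {s : Module.End ℂ M} (hs : s ∈ S) : s = 0 := by
  let N : Submodule ℂ M := ⨅ s : S, LinearMap.ker (s : Module.End ℂ M)
  have hmem : ∀ v, v ∈ N ↔ ∀ s ∈ S, s v = 0 := fun v => by
    simp [N, Submodule.mem_iInf]
  have hN : N ≠ ⊥ := by
    obtain ⟨v, hv, hv'⟩ := exists_common_kernel (S := (S : Set (Module.End ℂ M))) hcomm hnil
    exact (Submodule.ne_bot_iff _).2 ⟨v, (hmem v).2 hv', hv⟩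
  have htop : N = ⊤ := by
    refine (hirr N fun a ha v hv => ?_).resolve_left hN
    rw [Submodule.mem_comap, hmem]
    intro s hs
    -- From `⁅a, s⁆ v = 0` and `s v = 0` follows `s (a v) = 0`: the common kernel is stable under
    -- `a`.
    have h1 := (hmem v).1 hv _ (hnorm a ha s hs)
    rw [Ring.lie_def, LinearMap.sub_apply, Module.End.mul_apply, Module.End.mul_apply,
      (hmem v).1 hv s hs, map_zero, zero_sub, neg_eq_zero] at h1
    exact h1
  refine LinearMap.ext fun v => ?_
  have : v ∈ N := htop ▸ Submodule.mem_top
  exact (hmem v).1 this s hs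

end Nilpotent

/-! ### Univariate ideals stable under a logarithmic derivation -/

section Poly

open Polynomial

/-- An ideal of `ℂ[X]` stable under `X (X - 1) d/dX` contains some `X^a (X - 1)^b`. -/
theorem exists_pow_mul_pow_mem (I : Ideal ℂ[X]) (hI : I ≠ ⊥)
    (hd : ∀ p ∈ I, X * (X - C 1) * derivative p ∈ I) :
    ∃ a b : ℕ, X ^ a * (X - C 1) ^ b ∈ I := by
  obtain ⟨p, rfl⟩ := (IsPrincipalIdealRing.principal I).principal
  have hp : p ≠ 0 := fun h => hI (by simp [h])
  -- A root `r ≠ 0, 1` of the generator has multiplicity one less in `X * (X - C 1) * derivative p`,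
  -- which contradicts this divisibility.
  have hdvd : p ∣ X * (X - C 1) * derivative p :=
    Ideal.mem_span_singleton.1 (hd p (Ideal.mem_span_singleton_self p))
  have hroot : ∀ r : ℂ, p.IsRoot r → r = 0 ∨ r = 1 := by
    intro r hr
    by_contra hc
    push Not at hc
    have hp' : derivative p ≠ 0 := by
      intro h
      have h1 := derivative_eq_zero.1 h
      rw [natDegree_eq_zero] at h1
      obtain ⟨c, rfl⟩ := h1
      have : c = 0 := by simpa using hr
      exact hp (by simp [this])
    have hq : X * (X - C 1) ≠ (0 : ℂ[X]) := mul_ne_zero X_ne_zero (X_sub_C_ne_zero 1)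
    have h1 : rootMultiplicity r p ≤ rootMultiplicity r (X * (X - C 1) * derivative p) :=
      rootMultiplicity_le_rootMultiplicity_of_dvd (mul_ne_zero hq hp') hdvd r
    rw [rootMultiplicity_mul (mul_ne_zero hq hp'),
      rootMultiplicity_eq_zero (p := X * (X - C 1)) (x := r), zero_add,
      derivative_rootMultiplicity_of_root hr] at h1
    · have := (rootMultiplicity_pos hp).2 hr
      omega
    · simp [IsRoot, hc.1, sub_eq_zero, hc.2]
  obtain ⟨q, hq, hq'⟩ := exists_eq_pow_rootMultiplicity_mul_and_not_dvd p hp 0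
  generalize rootMultiplicity 0 p = a at hq
  have hq0 : q ≠ 0 := fun h => hq' (by simp [h])
  obtain ⟨s, hs, hs'⟩ := exists_eq_pow_rootMultiplicity_mul_and_not_dvd q hq0 1
  generalize rootMultiplicity 1 q = b at hs
  have hs0 : s ≠ 0 := fun h => hs' (by simp [h])
  -- Once all factors `X` and `X - 1` are removed no root is left, so the cofactor is a unit.
  have hdeg : s.degree = 0 := by
    by_contra hd0
    obtain ⟨r, hr⟩ := IsAlgClosed.exists_root s hd0
    have hpr : p.IsRoot r := by
      rw [hq, hs]
      simp [IsRoot, hr.eq_zero]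
    rcases hroot r hpr with rfl | rfl
    · refine hq' ?_
      rw [dvd_iff_isRoot, hs]
      simp [IsRoot, hr.eq_zero]
    · exact hs' (dvd_iff_isRoot.2 hr)
  have hu : IsUnit s := isUnit_iff_degree_eq_zero.2 hdeg
  obtain ⟨t, ht⟩ := hu.exists_right_inv
  refine ⟨a, b, Ideal.mem_span_singleton.2 ⟨t, ?_⟩⟩
  rw [hq, hs, C_0, sub_zero]
  linear_combination (-(X ^ a * (X - C 1) ^ b)) * ht

end Poly
end Toroidal

namespace Toroidal

/-! ### Laurent polynomials near the point (1, …, 1) and the Euler field -/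

section Laurent

variable {n : ℕ}

theorem mono_add (r s : Fin n → ℤ) : (mono (r + s) : Laurent (Fin n)) = mono r * mono s := by
  simp [mono, AddMonoidAlgebra.single_mul_single]

theorem mono_zero : (mono 0 : Laurent (Fin n)) = 1 := rfl

theorem mono_mul_mono_neg (r : Fin n → ℤ) : (mono r * mono (-r) : Laurent (Fin n)) = 1 := by
  rw [← mono_add, add_neg_cancel, mono_zero]

theorem Laurent.ind {p : Laurent (Fin n) → Prop} (f : Laurent (Fin n)) (h0 : p 0)
    (ha : ∀ f g, p f → p g → p (f + g)) (hs : ∀ (c : ℂ) r, p (c • mono r)) : p f := by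
  induction f using AddMonoidAlgebra.induction_linear with
  | zero => exact h0
  | add f g hf hg => exact ha _ _ hf hg
  | single k c => simpa [mono] using hs c k

/-- Two linear maps agreeing on monomials are equal. -/
theorem Laurent.hom_ext {W : Type*} [AddCommGroup W] [Module ℂ W]
    {F G : Laurent (Fin n) →ₗ[ℂ] W} (h : ∀ r, F (mono r) = G (mono r)) : F = G := by
  refine LinearMap.ext fun f => ?_
  induction f using Laurent.ind with
  | h0 => simp
  | ha f g hf hg => rw [map_add, map_add, hf, hg]
  | hs c r => rw [map_smul, map_smul, h]

/-- The derivation `∑ uᵢ dᵢ` of the Laurent polynomials. -/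
def dd (u : Fin n → ℂ) : Laurent (Fin n) →ₗ[ℂ] Laurent (Fin n) := VecField.onLaurent (vf u 0)

theorem dd_mono (u : Fin n → ℂ) (r : Fin n → ℤ) : dd u (mono r) = pairing _ r u • mono r := by
  simp [dd, VecField.onLaurent_vf, mono]

theorem dd_mul (u : Fin n → ℂ) (f g : Laurent (Fin n)) : dd u (f * g) = dd u f * g + f * dd u g :=
  VecField.onLaurent_leibniz _ _ _

theorem dd_one (u : Fin n → ℂ) : dd u 1 = 0 := by
  rw [← mono_zero, dd_mono]; simp [pairing_apply]

/-- The value of a Laurent polynomial at `(1, …, 1)`. -/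
def augHom (n : ℕ) : Laurent (Fin n) →ₐ[ℂ] ℂ := AddMonoidAlgebra.lift ℂ ℂ _ 1

theorem augHom_mono (r : Fin n → ℤ) : augHom n (mono r) = 1 := by
  simp [augHom, mono, AddMonoidAlgebra.lift_single]

/-- The ideal of Laurent polynomials vanishing at `(1, …, 1)`. -/
def augIdeal (n : ℕ) : Ideal (Laurent (Fin n)) := RingHom.ker (augHom n)

theorem mem_augIdeal {f : Laurent (Fin n)} : f ∈ augIdeal n ↔ augHom n f = 0 := Iff.rfl

theorem mono_sub_one_mem (r : Fin n → ℤ) : mono r - 1 ∈ augIdeal n := by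
  rw [mem_augIdeal, map_sub, augHom_mono, map_one, sub_self]

/-- Subtracting from `f` its value at `(1, …, 1)` replaces each monomial `t^r` by `t^r - 1`, so
these differences span the ideal over `ℂ`, not only as an ideal. -/
theorem augIdeal_ind {p : Laurent (Fin n) → Prop} {f : Laurent (Fin n)} (hf : f ∈ augIdeal n)
    (h0 : p 0) (ha : ∀ f g, p f → p g → p (f + g)) (hs : ∀ (c : ℂ) r, p (c • (mono r - 1))) :
    p f := by
  have : p (f - algebraMap ℂ _ (augHom n f)) := by
    clear hf
    induction f using Laurent.ind with
    | h0 => simpa using h0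
    | ha f g hf hg =>
      rw [map_add, map_add, add_sub_add_comm]
      exact ha _ _ hf hg
    | hs c r =>
      have := hs c r
      rw [map_smul, augHom_mono, smul_eq_mul, mul_one]
      rwa [smul_sub, ← Algebra.algebraMap_eq_smul_one c] at this
  rwa [mem_augIdeal.1 hf, map_zero, sub_zero] at this

/-- The variable `xᵢ`. -/
def xv (i : Fin n) : Laurent (Fin n) := mono (Pi.single i 1)

theorem dd_xv (u : Fin n → ℂ) (i : Fin n) : dd u (xv i) = u i • xv i := by
  rw [xv, dd_mono, pairing_apply]
  congr 1
  rw [Finset.sum_eq_single i] <;> simp +contextual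

theorem dd_xv_sub_one (u : Fin n → ℂ) (i : Fin n) : dd u (xv i - 1) = u i • xv i := by
  rw [map_sub, dd_xv, dd_one, sub_zero]

theorem xv_sub_one_mem (i : Fin n) : xv i - 1 ∈ augIdeal n := mono_sub_one_mem _

/-- A subgroup of `ℤⁿ` containing the standard basis is everything. -/
theorem addSubgroup_eq_top {H : AddSubgroup (Fin n → ℤ)} (h : ∀ i, Pi.single i 1 ∈ H)
    (r : Fin n → ℤ) : r ∈ H := by
  rw [← Finset.univ_sum_single r]
  refine sum_mem fun i _ => ?_
  have : Pi.single i (r i) = r i • (Pi.single i 1 : Fin n → ℤ) := by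
    rw [← Pi.single_smul]; simp
  rw [this]
  exact zsmul_mem (h i) _

/-- The exponents `r` with `t^r - 1` in a given ideal form a subgroup, so it suffices to have the
standard basis. This provides the finite generation used in `JetAction.exists_pow_le_kerIdeal`. -/
theorem augIdeal_eq_span : augIdeal n = Ideal.span (Set.range fun i => xv i - 1) := by
  set I := Ideal.span (Set.range fun i : Fin n => xv i - 1) with hI
  refine le_antisymm (fun f hf => ?_) (Ideal.span_le.2 ?_)
  · let H : AddSubgroup (Fin n → ℤ) :=
      { carrier := {r | (mono r - 1 : Laurent (Fin n)) ∈ I}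
        zero_mem' := by simp [mono_zero]
        add_mem' := fun {r s} hr hs => by
          have : (mono (r + s) - 1 : Laurent (Fin n)) =
            mono s * (mono r - 1) + (mono s - 1) := by rw [mono_add]; ring
          rw [Set.mem_ofPred_eq, this]
          exact add_mem (I.mul_mem_left _ hr) hs
        neg_mem' := fun {r} hr => by
          have : (mono (-r) - 1 : Laurent (Fin n)) = (-mono (-r)) * (mono r - 1) := by
            linear_combination mono_mul_mono_neg r
          rw [Set.mem_ofPred_eq, this]
          exact I.mul_mem_left _ hr }
    have hH : ∀ r, (mono r - 1 : Laurent (Fin n)) ∈ I :=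
      addSubgroup_eq_top (H := H) fun i => Ideal.subset_span ⟨i, rfl⟩
    exact augIdeal_ind (p := (· ∈ I)) hf (zero_mem _) (fun f g hf hg => add_mem hf hg)
      fun c r => Submodule.smul_of_tower_mem _ c (hH r)
  · rintro _ ⟨i, rfl⟩
    exact xv_sub_one_mem i

/-- By the Leibniz rule a derivation lowers the order of vanishing by at most one. -/
theorem dd_mem_pow (u : Fin n → ℂ) (d : ℕ) {f : Laurent (Fin n)} (hf : f ∈ augIdeal n ^ (d + 1)) :
    dd u f ∈ augIdeal n ^ d := by
  induction d generalizing f with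
  | zero => simp
  | succ d ih =>
    rw [pow_succ] at hf
    induction hf using Submodule.mul_induction_on' with
    | mem_mul_mem a ha b hb =>
      rw [dd_mul]
      refine add_mem ?_ (Ideal.mul_mem_right _ _ ha)
      rw [pow_succ]
      exact Ideal.mul_mem_mul (ih ha) hb
    | add a _ b _ ha hb => rw [map_add]; exact add_mem ha hb

/-- The Euler vector field `∑ (xᵢ - 1) dᵢ`. -/
def euler (n : ℕ) : Laurent (Fin n) →ₗ[ℂ] Laurent (Fin n) :=
  ∑ i, LinearMap.mulLeft ℂ (xv i - 1) ∘ₗ dd (Pi.single i 1)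

theorem euler_apply (f : Laurent (Fin n)) :
    euler n f = ∑ i, (xv i - 1) * dd (Pi.single i 1) f := by
  simp [euler]

theorem euler_mul (f g : Laurent (Fin n)) : euler n (f * g) = euler n f * g + f * euler n g := by
  simp only [euler_apply, dd_mul, Finset.sum_mul, Finset.mul_sum, ← Finset.sum_add_distrib]
  exact Finset.sum_congr rfl fun i _ => by ring

/-- The Euler field is the identity on `𝔪/𝔪²`: there `t^r - 1` is congruent to its linear part `∑ rᵢ
(xᵢ - 1)`, because `r ↦ t^r - 1` is additive modulo `𝔪²`. -/
theorem euler_sub_mem {f : Laurent (Fin n)} (hf : f ∈ augIdeal n) :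
    euler n f - f ∈ augIdeal n ^ 2 := by
  set I := augIdeal n ^ 2
  have hsq : ∀ r s, (mono r - 1) * (mono s - 1 : Laurent (Fin n)) ∈ I := fun r s => by
    rw [show I = augIdeal n * augIdeal n from sq _]
    exact Ideal.mul_mem_mul (mono_sub_one_mem r) (mono_sub_one_mem s)
  let e : (Fin n → ℤ) → Laurent (Fin n) := fun r => ∑ i, (r i : ℂ) • (xv i - 1)
  have he : ∀ r s, e (r + s) = e r + e s := fun r s => by
    simp [e, add_smul, Finset.sum_add_distrib]
  let H : AddSubgroup (Fin n → ℤ) :=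
    { carrier := {r | e r - (mono r - 1 : Laurent (Fin n)) ∈ I}
      zero_mem' := by simp [mono_zero, e]
      add_mem' := fun {r s} hr hs => by
        have : e (r + s) - (mono (r + s) - 1 : Laurent (Fin n)) = (e r - (mono r - 1)) +
            (e s - (mono s - 1)) - (mono r - 1) * (mono s - 1) := by rw [mono_add, he]; ring
        rw [Set.mem_ofPred_eq, this]
        exact sub_mem (add_mem hr hs) (hsq r s)
      neg_mem' := fun {r} hr => by
        have h1 : e (-r) = - e r := by simp [e]
        have : e (-r) - (mono (-r) - 1 : Laurent (Fin n)) = -(e r - (mono r - 1)) +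
            (mono r - 1) * (mono (-r) - 1) := by
          rw [h1]; linear_combination -mono_mul_mono_neg r
        rw [Set.mem_ofPred_eq, this]
        exact add_mem (neg_mem hr) (hsq r _) }
  have hH : ∀ r, e r - (mono r - 1 : Laurent (Fin n)) ∈ I := by
    refine addSubgroup_eq_top (H := H) fun i => ?_
    change e (Pi.single i 1) - (xv i - 1) ∈ I
    have : e (Pi.single i 1) = xv i - 1 := by
      simp only [e]
      rw [Finset.sum_eq_single i] <;> simp +contextual
    rw [this, sub_self]; exact zero_mem _
  refine augIdeal_ind (p := fun f => euler n f - f ∈ I) hf (by simp)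
    (fun f g hf hg => by rw [map_add, add_sub_add_comm]; exact add_mem hf hg) fun c r => ?_
  · rw [map_smul, ← smul_sub]
    refine Submodule.smul_of_tower_mem _ c ?_
    -- The Euler field multiplies `t^r` by exactly the linear part `e r`; replacing the remaining
    -- factor `t^r` by `1` costs only an element of `𝔪²`.
    have h1 : euler n (mono r - 1) = e r * mono r := by
      have h : ∀ i : Fin n, dd (Pi.single i 1) (mono r - 1) = (r i : ℂ) • mono r := fun i => by
        rw [map_sub, dd_one, sub_zero, dd_mono, pairing_apply, Finset.sum_eq_single i] <;>
          simp +contextual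
      simp only [euler_apply, h, e, Finset.sum_mul, mul_smul_comm, smul_mul_assoc]
    have h2 : e r ∈ augIdeal n := sum_mem fun i _ =>
      Submodule.smul_of_tower_mem _ _ (xv_sub_one_mem i)
    rw [h1, show e r * mono r - (mono r - 1) = (e r - (mono r - 1)) + e r * (mono r - 1) by ring]
    refine add_mem (hH r) ?_
    rw [show I = augIdeal n * augIdeal n from sq _]
    exact Ideal.mul_mem_mul h2 (mono_sub_one_mem r)

/-- By the Leibniz rule the eigenvalue `1` on `𝔪/𝔪²` becomes `d` on `𝔪^d/𝔪^(d+1)`. -/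
theorem euler_sub_mem_pow (d : ℕ) {f : Laurent (Fin n)} (hf : f ∈ augIdeal n ^ d) :
    euler n f - (d : ℂ) • f ∈ augIdeal n ^ (d + 1) := by
  induction d generalizing f with
  | zero =>
    rw [zero_add, pow_one, Nat.cast_zero, zero_smul, sub_zero, euler_apply]
    exact sum_mem fun i _ => Ideal.mul_mem_right _ _ (xv_sub_one_mem i)
  | succ d ih =>
    rw [pow_succ] at hf
    induction hf using Submodule.mul_induction_on' with
    | mem_mul_mem a ha b hb =>
      have : euler n (a * b) - ((d + 1 : ℕ) : ℂ) • (a * b) =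
          (euler n a - (d : ℂ) • a) * b + a * (euler n b - b) := by
        rw [euler_mul]; push_cast; simp only [Algebra.smul_def, map_add, map_one]; ring
      rw [this]
      refine add_mem ?_ ?_
      · rw [pow_succ _ (d + 1)]
        exact Ideal.mul_mem_mul (ih ha) hb
      · rw [show d + 1 + 1 = d + 2 from rfl, pow_add]
        exact Ideal.mul_mem_mul ha (euler_sub_mem hb)
    | add a _ b _ ha hb =>
      rw [map_add, smul_add, add_sub_add_comm]; exact add_mem ha hb

/-- On polynomials in `xᵢ` the derivation `dᵢ` is `X d/dX`, so `(xᵢ - 1) dᵢ` becomes the operator of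
`exists_pow_mul_pow_mem`. -/
theorem dd_aeval_xv (u : Fin n → ℂ) (i : Fin n) (p : Polynomial ℂ) :
    dd u (Polynomial.aeval (xv i) p) = 
      u i • (xv i * Polynomial.aeval (xv i) (Polynomial.derivative p)) := by
  have hpow : ∀ k : ℕ, dd u (xv i ^ (k + 1)) = (u i * (k + 1)) • xv i ^ (k + 1) := by
    intro k
    induction k with
    | zero => simp [dd_xv]
    | succ k ih =>
      rw [pow_succ, dd_mul, ih, dd_xv, smul_mul_assoc, mul_smul_comm, ← add_smul]
      congr 1; push_cast; ring
  induction p using Polynomial.induction_on with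
  | C a => simp [Polynomial.aeval_C, Algebra.algebraMap_eq_smul_one, dd_one]
  | add p q hp hq => simp only [map_add, hp, hq, mul_add, smul_add]
  | monomial k a ih =>
    simp only [map_mul, Polynomial.aeval_C, map_pow, Polynomial.aeval_X, Polynomial.derivative_mul,
      Polynomial.derivative_C, Polynomial.derivative_X_pow, zero_mul, zero_add]
    rw [← Algebra.smul_def, map_smul, hpow]
    simp only [Algebra.smul_def, map_mul, map_add, map_natCast, map_one, Nat.cast_add,
      Nat.cast_one, Nat.add_sub_cancel]
    ring

end Laurent
end Toroidal

/-! ### Finite-dimensional irreducible actions depend only on low-order jets -/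

namespace Toroidal

/-- Operators `P u f` and `Q a f` on `M`, depending linearly on a Laurent polynomial `f`, that satisfy
the commutation relations of the vector fields `(f - f(1)) ∑ uᵢ dᵢ` and of the elements
`f X ⊗ t^s` of a loop algebra, and that leave no proper non-zero subspace stable. -/
structure JetAction (n : ℕ) (κ M : Type*) [AddCommGroup M] [Module ℂ M] where
  P : (Fin n → ℂ) →ₗ[ℂ] Laurent (Fin n) →ₗ[ℂ] Module.End ℂ M
  Q : κ → Laurent (Fin n) →ₗ[ℂ] Module.End ℂ M
  s : κ → Fin n → ℂ
  bracket : κ → κ → κ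
  PP : ∀ u v, ∀ f ∈ augIdeal n, ∀ g ∈ augIdeal n,
    ⁅P u f, P v g⁆ = P v (f * dd u g) - P u (g * dd v f)
  PQ : ∀ u a, ∀ f ∈ augIdeal n, ∀ g, ⁅P u f, Q a g⁆ = Q a (f * (dd u g + (u ⬝ᵥ s a) • g))
  QQ : ∀ a b f g, ⁅Q a f, Q b g⁆ = Q (bracket a b) (f * g)
  irr : ∀ N : Submodule ℂ M, (∀ u, ∀ f ∈ augIdeal n, N ≤ N.comap (P u f)) →
    (∀ a f, N ≤ N.comap (Q a f)) → N = ⊥ ∨ N = ⊤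

namespace JetAction

variable {n : ℕ} {κ M : Type*} [AddCommGroup M] [Module ℂ M] (R : JetAction n κ M)

theorem P_eq_sum (u : Fin n → ℂ) (f : Laurent (Fin n)) :
    R.P u f = ∑ j, u j • R.P (Pi.single j 1) f := by
  conv_lhs => rw [pi_eq_sum_univ' u]
  simp only [map_sum, map_smul, LinearMap.sum_apply, LinearMap.smul_apply]

/-- The cube of an element `f` of the kernel of `P u`, multiplied by `d_u g d_u k`. -/
theorem P_cube {u : Fin n → ℂ} {f : Laurent (Fin n)} (hf : f ∈ augIdeal n) (h : R.P u f = 0)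
    (g k : Laurent (Fin n)) : R.P u (f ^ 3 * (dd u g * dd u k)) = 0 := by
  -- One vanishing operator yields others: its bracket with any `P u b` also vanishes.
  have hbr : ∀ a ∈ augIdeal n, R.P u a = 0 → ∀ b ∈ augIdeal n,
      R.P u (a * dd u b - b * dd u a) = 0 := fun a ha ha' b hb => by
    rw [map_sub, ← R.PP u u a ha b hb, ha', zero_lie]
  have hsq : ∀ g, R.P u (f ^ 2 * dd u g) = 0 := fun g => by
    have := hbr f hf h (f * g) (Ideal.mul_mem_right _ _ hf)
    rwa [show f * dd u (f * g) - f * g * dd u f = f ^ 2 * dd u g by rw [dd_mul]; ring] at this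
  -- Writing `∂` for `dd u`, this bracket has coefficient `f³ ∂g ∂k - f² k ∂f ∂g - f³ k ∂²g`, while
  -- `h2` has `f² k ∂f ∂g + f³ ∂g ∂k + f³ k ∂²g`. In the sum only `2 f³ ∂g ∂k` survives.
  have h1 := hbr (f ^ 2 * dd u g) (Ideal.mul_mem_right _ _ (Ideal.pow_mem_of_mem _ hf 2 two_pos))
    (hsq g) (f * k) (Ideal.mul_mem_right _ _ hf)
  have h2 := hsq (f * k * dd u g)
  have h3 : (2 : ℂ) • R.P u (f ^ 3 * (dd u g * dd u k)) = 0 := by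
    rw [← map_smul, ← add_zero (0 : Module.End ℂ M)]
    nth_rewrite 2 [← h1]
    rw [← h2, ← map_add]
    congr 1
    rw [two_smul]
    simp only [dd_mul, pow_two]
    ring
  exact (smul_eq_zero.1 h3).resolve_left two_ne_zero

/-- The products `dᵢ g · dᵢ k` span all Laurent polynomials: any monomial is a product of two
monomials of non-zero degree in `xᵢ`. So `P_cube` applies with an arbitrary factor. -/
theorem P_cube_mul {i : Fin n} {f : Laurent (Fin n)} (hf : f ∈ augIdeal n)
    (h : R.P (Pi.single i 1) f = 0) (g : Laurent (Fin n)) :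
    R.P (Pi.single i 1) (f ^ 3 * g) = 0 := by
  induction g using Laurent.ind with
  | h0 => simp
  | ha g g' hg hg' => rw [mul_add, map_add, hg, hg', add_zero]
  | hs c q =>
    have hp : ∀ r : Fin n → ℤ, pairing _ r (Pi.single i 1) = (r i : ℂ) := fun r => by
      rw [pairing_apply, Finset.sum_eq_single i] <;> simp +contextual
    -- The degree `q i` is split as `a + (q i - a)` with both parts non-zero; `a = 1` serves unless
    -- `q i = 1`.
    obtain ⟨a, ha, ha'⟩ : ∃ a : ℤ, a ≠ 0 ∧ q i - a ≠ 0 := by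
      by_cases h1 : q i = 1
      · exact ⟨2, by norm_num, by rw [h1]; norm_num⟩
      · exact ⟨1, by norm_num, sub_ne_zero.2 h1⟩
    have h1 := R.P_cube hf h (mono (Pi.single i a)) (mono (q - Pi.single i a))
    rw [dd_mono, dd_mono, smul_mul_smul_comm, ← mono_add, add_sub_cancel, mul_smul_comm, map_smul,
      hp, hp] at h1
    have h2 := (smul_eq_zero.1 h1).resolve_left (mul_ne_zero (by simpa using ha) (by
      rw [Pi.sub_apply, Pi.single_eq_same]; exact_mod_cast ha'))
    rw [mul_smul_comm, map_smul, h2, smul_zero]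

/-- The ideal of those `f` for which all `P u (f h)` and `Q a (f h)` vanish. -/
def kerIdeal : Ideal (Laurent (Fin n)) where
  carrier := {f | f ∈ augIdeal n ∧ ∀ h, (∀ u, R.P u (f * h) = 0) ∧ ∀ a, R.Q a (f * h) = 0}
  zero_mem' := ⟨zero_mem _, fun h => by simp⟩
  add_mem' := fun {f g} hf hg => ⟨add_mem hf.1 hg.1, fun h =>
    ⟨fun u => by rw [add_mul, map_add, (hf.2 h).1, (hg.2 h).1, add_zero],
      fun a => by rw [add_mul, map_add, (hf.2 h).2, (hg.2 h).2, add_zero]⟩⟩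
  smul_mem' := fun c f hf => ⟨Ideal.mul_mem_left _ _ hf.1, fun h => by
    rw [smul_eq_mul, show c * f * h = f * (c * h) by ring]; exact hf.2 _⟩

/-- `P_cube_mul` handles the operators `P`. Those of type `Q` follow by bracketing a vanishing `P`
with `Q`, provided that `dᵢ` acts on the second argument with a non-zero eigenvalue. -/
theorem cube_mem_kerIdeal {f : Laurent (Fin n)} (i : Fin n) (hf : f ∈ augIdeal n)
    (h : ∀ j, R.P (Pi.single j 1) f = 0) : f ^ 3 ∈ R.kerIdeal := by
  have hf3 : f ^ 3 ∈ augIdeal n := Ideal.pow_mem_of_mem _ hf 3 (by norm_num)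
  refine ⟨hf3, fun g => ⟨fun u => ?_, fun a => ?_⟩⟩
  · rw [P_eq_sum]
    exact Finset.sum_eq_zero fun j _ => by rw [R.P_cube_mul hf (h j), smul_zero]
  · induction g using Laurent.ind with
    | h0 => simp
    | ha g g' hg hg' => rw [mul_add, map_add, hg, hg', add_zero]
    | hs c q =>
      -- `b + s a i` is the eigenvalue of `dᵢ`, shift included, on `xᵢ^b`; it scales `Q a (f³ t^q)`
      -- in the bracket below.
      obtain ⟨b, hb⟩ : ∃ b : ℤ, (b : ℂ) + R.s a i ≠ 0 := by
        by_cases h1 : R.s a i = 0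
        · exact ⟨1, by simp [h1]⟩
        · exact ⟨0, by simpa using h1⟩
      have h1 := R.PQ (Pi.single i 1) a (f ^ 3 * mono (q - Pi.single i b))
        (Ideal.mul_mem_right _ _ hf3) (mono (Pi.single i b))
      rw [R.P_cube_mul hf (h i), zero_lie, dd_mono, ← add_smul, mul_smul_comm, mul_assoc,
        ← mono_add, sub_add_cancel, map_smul] at h1
      have h2 : pairing _ (Pi.single i b) (Pi.single i 1) + Pi.single i 1 ⬝ᵥ R.s a ≠ 0 := by
        convert! hb using 2
        · rw [pairing_apply, Finset.sum_eq_single i] <;> simp +contextual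
        · simp
      rw [mul_smul_comm, map_smul, (smul_eq_zero.1 h1.symm).resolve_left h2, smul_zero]

/-- Bracketing with `P eᵢ (xᵢ - 1)` differentiates the coefficient along `(xᵢ - 1) dᵢ`; the
remaining terms have a coefficient divisible by `f` and vanish already. This is the stability
required by `exists_pow_mul_pow_mem`. -/
theorem dd_mem_kerIdeal {f : Laurent (Fin n)} (i : Fin n) (hf : f ∈ R.kerIdeal) :
    (xv i - 1) * dd (Pi.single i 1) f ∈ R.kerIdeal := by
  refine ⟨Ideal.mul_mem_right _ _ (xv_sub_one_mem i), fun h => ⟨fun u => ?_, fun a => ?_⟩⟩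
  · have h1 := R.PP u (Pi.single i 1) (f * h) (Ideal.mul_mem_right _ _ hf.1) (xv i - 1)
      (xv_sub_one_mem i)
    rw [(hf.2 h).1, zero_lie, mul_assoc, (hf.2 _).1, zero_sub, eq_comm, neg_eq_zero, dd_mul,
      show (xv i - 1) * (dd (Pi.single i 1) f * h + f * dd (Pi.single i 1) h) =
        (xv i - 1) * dd (Pi.single i 1) f * h + f * ((xv i - 1) * dd (Pi.single i 1) h) by ring,
      map_add, (hf.2 _).1, add_zero] at h1
    exact h1
  · have h1 := R.PQ (Pi.single i 1) a (xv i - 1) (xv_sub_one_mem i) (f * h)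
    rw [(hf.2 h).2, lie_zero, dd_mul, mul_add, mul_smul_comm,
      show (xv i - 1) * (dd (Pi.single i 1) f * h + f * dd (Pi.single i 1) h) =
        (xv i - 1) * dd (Pi.single i 1) f * h + f * ((xv i - 1) * dd (Pi.single i 1) h) by ring,
      show (xv i - 1) * (f * h) = f * ((xv i - 1) * h) by ring,
      map_add, map_add, map_smul, (hf.2 _).2, (hf.2 _).2, add_zero, smul_zero, add_zero] at h1
    exact h1.symm

-- A linear map from the infinite-dimensional space `ℂ[X]` to tuples of endomorphisms of `M` cannot
-- be injective. The factor `xᵢ - 1` keeps the coefficient in the augmentation ideal.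
open Polynomial in
theorem exists_univariate [FiniteDimensional ℂ M] (i : Fin n) : ∃ p : ℂ[X], p ≠ 0 ∧
    ∀ j, R.P (Pi.single j 1) ((xv i - 1) * aeval (xv i) p) = 0 := by
  obtain ⟨F, hF⟩ : ∃ F : ℂ[X] →ₗ[ℂ] (Fin n → Module.End ℂ M), ∀ p j, F p j =
      R.P (Pi.single j 1) ((xv i - 1) * aeval (xv i) p) :=
    ⟨LinearMap.pi fun j => R.P (Pi.single j 1) ∘ₗ LinearMap.mulLeft ℂ (xv i - 1) ∘ₗ
      (aeval (xv i)).toLinearMap, fun _ _ => rfl⟩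
  by_contra hc
  push Not at hc
  have hinj : Function.Injective F := (injective_iff_map_eq_zero F).2 fun p hp => by
    by_contra hp0
    obtain ⟨j, hj⟩ := hc p hp0
    exact hj (by rw [← hF, hp]; rfl)
  exact Polynomial.not_finite (R := ℂ) (Module.Finite.of_injective F hinj)

-- The kernel ideal meets the polynomials in `xᵢ` in a non-zero ideal stable under `X (X - 1) d/dX`,
-- so it contains some `xᵢ^a (xᵢ - 1)^b`.
open Polynomial in
theorem xv_sub_one_pow_mem [FiniteDimensional ℂ M] (i : Fin n) :
    ∃ e : ℕ, (xv i - 1) ^ e ∈ R.kerIdeal := by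
  obtain ⟨p, hp0, hp⟩ := R.exists_univariate i
  have hI : R.kerIdeal.comap (aeval (xv i) : ℂ[X] →ₐ[ℂ] Laurent (Fin n)) ≠ ⊥ := by
    refine (Submodule.ne_bot_iff _).2 ⟨((X - C 1) * p) ^ 3, ?_,
      pow_ne_zero 3 (mul_ne_zero (X_sub_C_ne_zero 1) hp0)⟩
    rw [Ideal.mem_comap, map_pow]
    have h1 : aeval (xv i) ((X - C 1) * p) = (xv i - 1) * aeval (xv i) p := by simp
    rw [h1]
    exact R.cube_mem_kerIdeal i (Ideal.mul_mem_right _ _ (xv_sub_one_mem i)) hp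
  obtain ⟨a, b, hab⟩ := exists_pow_mul_pow_mem _ hI fun p hp => by
    rw [Ideal.mem_comap] at hp ⊢
    have h1 := R.dd_mem_kerIdeal i hp
    rw [dd_aeval_xv, Pi.single_eq_same, one_smul] at h1
    have h2 : aeval (xv i) (X * (X - C 1) * derivative p) =
        (xv i - 1) * (xv i * aeval (xv i) (derivative p)) := by
      simp only [map_mul, map_sub, aeval_X, map_one]
      ring
    rwa [h2]
  rw [Ideal.mem_comap] at hab
  refine ⟨b, ?_⟩
  simp only [map_mul, map_pow, map_sub, aeval_X, map_one] at hab
  -- `xᵢ` is invertible, so the factor `xᵢ^a` can be cancelled.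
  have h2 := R.kerIdeal.mul_mem_left (mono (-Pi.single i 1) ^ a) hab
  rwa [← mul_assoc, ← mul_pow, mul_comm (mono _), xv, mono_mul_mono_neg, one_pow, one_mul] at h2

/-- The finitely many generators `xᵢ - 1` of the augmentation ideal all lie in the radical of
`kerIdeal`. -/
theorem exists_pow_le_kerIdeal [FiniteDimensional ℂ M] : ∃ d, augIdeal n ^ d ≤ R.kerIdeal := by
  refine Ideal.exists_pow_le_of_le_radical_of_fg ?_ ?_
  · rw [augIdeal_eq_span, Ideal.span_le]
    rintro _ ⟨i, rfl⟩
    exact R.xv_sub_one_pow_mem i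
  · rw [augIdeal_eq_span]
    exact Submodule.fg_span (Set.finite_range _)

/-- The operators `P u f`, `f ∈ 𝔪^{d+1}`, and `Q a f`, `f ∈ 𝔪^d`, vanish. -/
def VanishesAt (d : ℕ) : Prop :=
  (∀ u, ∀ f ∈ augIdeal n ^ (d + 1), R.P u f = 0) ∧ ∀ a, ∀ f ∈ augIdeal n ^ d, R.Q a f = 0

/-- The generators of the `d`-th term of the filtration. -/
inductive FilGen (d : ℕ) : Module.End ℂ M → Prop
  | P (u : Fin n → ℂ) (f : Laurent (Fin n)) (hf : f ∈ augIdeal n ^ (d + 1)) : FilGen d (R.P u f)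
  | Q (a : κ) (f : Laurent (Fin n)) (hf : f ∈ augIdeal n ^ d) : FilGen d (R.Q a f)

theorem mul_dd_mem {d : ℕ} (u : Fin n → ℂ) {f g : Laurent (Fin n)} (hf : f ∈ augIdeal n)
    (hg : g ∈ augIdeal n ^ d) : f * dd u g ∈ augIdeal n ^ d := by
  cases d with
  | zero => simp
  | succ d => rw [pow_succ']; exact Ideal.mul_mem_mul hf (dd_mem_pow u d hg)

/-- Modulo the next step, the Euler field scales a coefficient in `𝔪^(d+1)` by `d + 1`; for `P` its
bracket with the constant direction field subtracts `1`. For `Q` the coefficient lies in `𝔪^d` and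
nothing is subtracted. Both eigenvalues are `d`, which explains the offset between `P` and `Q` in
`VanishesAt`. -/
theorem euler_lie (d : ℕ) (hv : R.VanishesAt (d + 1)) {s : Module.End ℂ M} (hs : R.FilGen d s) :
    ⁅∑ i, R.P (Pi.single i 1) (xv i - 1), s⁆ = (d : ℂ) • s := by
  rw [sum_lie]
  cases hs with
  | P v g hg =>
    have hg1 : g ∈ augIdeal n := Ideal.pow_le_self (by omega) hg
    have h1 : ∀ i, ⁅R.P (Pi.single i 1) (xv i - 1), R.P v g⁆ =
        R.P v ((xv i - 1) * dd (Pi.single i 1) g) - v i • R.P (Pi.single i 1) g := fun i => by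
      rw [R.PP _ _ _ (xv_sub_one_mem i) _ hg1, dd_xv_sub_one, ← map_smul, mul_smul_comm]
      congr 1
      -- `dᵢ (xᵢ - 1) = xᵢ`, and multiplication of `g` by `xᵢ` may be dropped modulo `𝔪^(d+2)`.
      have h2 : R.P (Pi.single i 1) (g * (xv i - 1)) = 0 := hv.1 _ _ (by
        rw [pow_succ]; exact Ideal.mul_mem_mul hg (xv_sub_one_mem i))
      rw [mul_sub, mul_one, map_sub, sub_eq_zero] at h2
      rw [map_smul, h2, map_smul]
    simp only [h1]
    rw [Finset.sum_sub_distrib, ← P_eq_sum, ← map_sum, ← euler_apply]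
    have h3 := hv.1 v _ (euler_sub_mem_pow (d + 1) hg)
    rw [map_sub, sub_eq_zero, map_smul] at h3
    rw [h3]
    push_cast
    module
  | Q a g hg =>
    have h1 : ∀ i, ⁅R.P (Pi.single i 1) (xv i - 1), R.Q a g⁆ =
        R.Q a ((xv i - 1) * dd (Pi.single i 1) g) := fun i => by
      rw [R.PQ _ _ _ (xv_sub_one_mem i), mul_add, map_add, mul_smul_comm, map_smul, hv.2 a
        ((xv i - 1) * g), smul_zero, add_zero]
      rw [pow_succ']; exact Ideal.mul_mem_mul (xv_sub_one_mem i) hg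
    simp only [h1]
    rw [← map_sum, ← euler_apply]
    have h3 := hv.2 a _ (euler_sub_mem_pow d hg)
    rwa [map_sub, sub_eq_zero, map_smul] at h3

/-- Filtration degrees add under the bracket, and `2 d ≥ d + 1` for `d > 0`, so brackets inside step
`d` fall into the vanishing step `d + 1`. -/
theorem filGen_commute (d : ℕ) (hd : 0 < d) (hv : R.VanishesAt (d + 1)) {s t : Module.End ℂ M}
    (hs : R.FilGen d s) (ht : R.FilGen d t) : ⁅s, t⁆ = 0 := by
  have hle : augIdeal n ^ (d + 1) ≤ augIdeal n := Ideal.pow_le_self (by omega)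
  have hPP : ∀ u, ∀ f ∈ augIdeal n ^ (d + 1), ∀ g ∈ augIdeal n ^ (d + 1),
      f * dd u g ∈ augIdeal n ^ (d + 1 + 1) := fun u f hf g hg => by
    have := Ideal.mul_mem_mul hf (dd_mem_pow u d hg)
    rw [← pow_add] at this
    exact Ideal.pow_le_pow_right (by omega) this
  have hPQ : ∀ u a, ∀ f ∈ augIdeal n ^ (d + 1), ∀ g, ⁅R.P u f, R.Q a g⁆ = 0 := fun u a f hf g => by
    rw [R.PQ _ _ _ (hle hf), hv.2 _ _ (Ideal.mul_mem_right _ _ hf)]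
  cases hs with
  | P u f hf =>
    cases ht with
    | P v g hg =>
      rw [R.PP _ _ _ (hle hf) _ (hle hg), hv.1 _ _ (hPP u f hf g hg), hv.1 _ _ (hPP v g hg f hf),
        sub_zero]
    | Q b g hg => exact hPQ _ _ _ hf _
  | Q a f hf =>
    cases ht with
    | P v g hg => rw [← lie_skew, hPQ _ _ _ hg, neg_zero]
    | Q b g hg =>
      rw [R.QQ]
      refine hv.2 _ _ ?_
      have := Ideal.mul_mem_mul hf hg
      rw [← pow_add] at this
      exact Ideal.pow_le_pow_right (by omega) this

/-- The generators of the action. -/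
inductive ActGen : Module.End ℂ M → Prop
  | P (u : Fin n → ℂ) (f : Laurent (Fin n)) (hf : f ∈ augIdeal n) : ActGen (R.P u f)
  | Q (a : κ) (f : Laurent (Fin n)) : ActGen (R.Q a f)

/-- The vector fields vanish at `(1, …, 1)`: the factor in `𝔪` makes up for the order lost by
differentiating, so every step of the filtration is normalised by the whole action. -/
theorem actGen_lie (d : ℕ) {a s : Module.End ℂ M}
    (ha : R.ActGen a) (hs : R.FilGen d s) : ⁅a, s⁆ ∈ Submodule.span ℂ {s | R.FilGen d s} := by
  have hle : augIdeal n ^ (d + 1) ≤ augIdeal n := Ideal.pow_le_self (by omega)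
  have hle' : augIdeal n ^ (d + 1) ≤ augIdeal n ^ d := Ideal.pow_le_pow_right (by omega)
  cases ha with
  | P u f hf =>
    cases hs with
    | P v g hg =>
      rw [R.PP _ _ _ hf _ (hle hg)]
      exact sub_mem (Submodule.subset_span (FilGen.P _ _ (mul_dd_mem u hf hg)))
        (Submodule.subset_span (FilGen.P _ _ (Ideal.mul_mem_right _ _ hg)))
    | Q b g hg =>
      rw [R.PQ _ _ _ hf]
      refine Submodule.subset_span (FilGen.Q _ _ ?_)
      rw [mul_add, mul_smul_comm]
      exact add_mem (mul_dd_mem u hf hg)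
        (Submodule.smul_of_tower_mem _ _ (Ideal.mul_mem_left _ _ hg))
  | Q a f =>
    cases hs with
    | P v g hg =>
      rw [← lie_skew, R.PQ _ _ _ (hle hg)]
      exact neg_mem (Submodule.subset_span (FilGen.Q _ _ (Ideal.mul_mem_right _ _ (hle' hg))))
    | Q b g hg =>
      rw [R.QQ]
      exact Submodule.subset_span (FilGen.Q _ _ (Ideal.mul_mem_left _ _ hg))

/-- If step `d + 1` acts as zero, step `d` is a commuting space on which the bracket with the Euler
operator is the scalar `d ≠ 0`. Its elements are therefore nilpotent, and irreducibility forces them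
to vanish. -/
theorem vanishesAt_of_succ [FiniteDimensional ℂ M] [Nontrivial M] (d : ℕ) (hd : 0 < d) (hv : R.VanishesAt (d + 1)) :
    R.VanishesAt d := by
  let S := Submodule.span ℂ {s | R.FilGen d s}
  have hcomm : ∀ s ∈ S, ∀ t ∈ S, Commute s t := by
    intro s hs t ht
    rw [commute_iff_lie_eq]
    exact (Submodule.mem_bot ℂ).1 (TwistData.lie_span_mem (M := (⊥ : Submodule ℂ (Module.End ℂ M)))
      (fun a ha b hb => (Submodule.mem_bot ℂ).2 (R.filGen_commute d hd hv ha hb)) hs ht)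
  have heul : ∀ s ∈ S, ⁅∑ i, R.P (Pi.single i 1) (xv i - 1), s⁆ = (d : ℂ) • s := by
    intro s hs
    induction hs using Submodule.span_induction with
    | zero => simp
    | add a b _ _ ha hb => rw [lie_add, ha, hb, smul_add]
    | smul c a _ ha => rw [lie_smul, ha, smul_comm]
    | mem a ha => exact R.euler_lie d hv ha
  have hnil : ∀ s ∈ S, IsNilpotent s := fun s hs =>
    isNilpotent_of_lie_eq_smul (by exact_mod_cast hd.ne') (heul s hs)
  have hzero : ∀ s ∈ S, s = 0 := fun s hs =>
    eq_zero_of_normalised (R := {a | R.ActGen a}) S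
      (fun N hN => R.irr N (fun u f hf => hN _ (ActGen.P u f hf)) fun a f => hN _ (ActGen.Q a f))
      hcomm hnil
      (fun a ha s hs => TwistData.lie_span_mem (fun a ha b hb => R.actGen_lie d ha hb)
        (Submodule.subset_span ha) hs) hs
  exact ⟨fun u f hf => hzero _ (Submodule.subset_span (FilGen.P u f hf)),
    fun a f hf => hzero _ (Submodule.subset_span (FilGen.Q a f hf))⟩

/-- In an irreducible finite-dimensional action, `P u f` depends only on the linear part of `f` at
`(1, …, 1)`, and `Q a f` only on the value of `f` there. -/
theorem vanishesAt_one [FiniteDimensional ℂ M] [Nontrivial M] : R.VanishesAt 1 := by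
  obtain ⟨d, hd⟩ := R.exists_pow_le_kerIdeal
  have h : ∀ k, R.VanishesAt (k + 1) → R.VanishesAt 1 := by
    intro k
    induction k with
    | zero => exact id
    | succ k ih => exact fun hk => ih (R.vanishesAt_of_succ (k + 1) (by omega) hk)
  -- Vanishing at `d + 1` concerns `𝔪^(d+2)` and `𝔪^(d+1)`, both inside `𝔪^d`; starting there also
  -- makes the descent end at `1` when `d = 0`.
  refine h d ⟨fun u f hf => ?_, fun a f hf => ?_⟩
  · have := hd (Ideal.pow_le_pow_right (by omega) hf)
    simpa using (this.2 1).1 u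
  · have := hd (Ideal.pow_le_pow_right (by omega) hf)
    simpa using (this.2 1).2 a

end JetAction
end Toroidal

/-! ### Lifting to τ: a homomorphism up to central terms -/

namespace Toroidal

/-- In an independent family of submodules, a finite sum of elements vanishes only if each does. -/
theorem eq_zero_of_finsupp_sum_eq_zero {ι W : Type*} [AddCommGroup W] [Module ℂ W]
    {p : ι → Submodule ℂ W} (hp : iSupIndep p) (s : Finset ι) (f : ι → W)
    (hf : ∀ i ∈ s, f i ∈ p i) (h : ∑ i ∈ s, f i = 0) {i : ι} (hi : i ∈ s) : f i = 0 :=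
  iSupIndep_iff_finsetSum_eq_zero_imp_eq_zero p |>.1 hp s f hf h i hi

section Twisted

variable {𝔤 : Type*} [LieRing 𝔤] [LieAlgebra ℂ 𝔤] {n : ℕ} {S : TwistData 𝔤 n}

theorem toC_zero {ι : Type} : toC (0 : ι → ℤ) = 0 := by ext; simp [toC]

theorem pairing_single {ι : Type} [Fintype ι] [DecidableEq ι] (k : ι → ℤ) (i : ι) :
    pairing ι k (Pi.single i 1) = k i := by
  rw [pairing_apply, Finset.sum_eq_single i] <;> simp +contextual

theorem pairing_zero {ι : Type} [Fintype ι] (u : ι → ℂ) : pairing ι 0 u = 0 := by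
  simp [pairing_apply]

theorem pairing_cons (k : Fin n → ℤ) (u : Fin n → ℂ) :
    pairing _ (Fin.cons 0 k : Fin (n + 1) → ℤ) (Fin.cons 0 u) = pairing _ k u := by
  simp [pairing_apply, Fin.sum_univ_succ]

theorem cons_add_cons (k l : Fin n → ℤ) :
    (Fin.cons 0 k : Fin (n + 1) → ℤ) + Fin.cons 0 l = Fin.cons 0 (k + l) := by
  ext i; refine Fin.cases ?_ (fun i => ?_) i <;> simp

theorem cons_zero_zero : (Fin.cons 0 (0 : Fin n → ℤ) : Fin (n + 1) → ℤ) = 0 := by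
  ext i; refine Fin.cases ?_ (fun i => ?_) i <;> simp

theorem toC_cons (k : Fin n → ℤ) : toC (Fin.cons 0 k : Fin (n + 1) → ℤ) = Fin.cons 0 (toC k) := by
  ext i; refine Fin.cases ?_ (fun i => ?_) i <;> simp [toC]

namespace TwistData

theorem K_toC_self (k : Fin (n + 1) → ℤ) : S.K (toC k) k = 0 := by
  rw [K, ce_self, map_zero]

theorem K_zero (k : Fin (n + 1) → ℤ) : S.K 0 k = 0 := by
  have : ce (0 : Fin (n + 1) → ℂ) k = 0 := by simpa using ce_smul 0 (0 : Fin (n + 1) → ℂ) k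
  rw [K, this, map_zero]

theorem K_smul (c : ℂ) (u : Fin (n + 1) → ℂ) (k : Fin (n + 1) → ℤ) :
    S.K (c • u) k = c • S.K u k := by rw [K, ce_smul, map_smul, K]

theorem K_add (u v : Fin (n + 1) → ℂ) (k : Fin (n + 1) → ℤ) :
    S.K (u + v) k = S.K u k + S.K v k := by rw [K, ce_add, map_add, K, K]

theorem D_smul (c : ℂ) (u : Fin (n + 1) → ℂ) (k : Fin (n + 1) → ℤ) :
    S.D (c • u) k = c • S.D u k := by
  rw [D, LoopDer.D, vf_smul, map_smul, map_smul, D, LoopDer.D]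

theorem D_lie_D_cons (u v : Fin n → ℂ) (r s : Fin n → ℤ) :
    ⁅S.D (Fin.cons 0 u) (Fin.cons 0 r), S.D (Fin.cons 0 v) (Fin.cons 0 s)⁆ =
      pairing _ s u • S.D (Fin.cons 0 v) (Fin.cons 0 (r + s)) -
        pairing _ r v • S.D (Fin.cons 0 u) (Fin.cons 0 (r + s)) +
      (S.c₁ * (-(pairing _ s u * pairing _ r v)) + S.c₂ * (pairing _ r u * pairing _ s v)) •
        S.K (Fin.cons 0 (toC r)) (Fin.cons 0 (r + s)) := by
  have hD : ∀ (a b : Fin (n + 1) → ℂ) (c d : ℂ) q, S.D (c • a - d • b) q =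
      c • S.D a q - d • S.D b q := by
    intro a b c d q
    rw [← D_smul, ← D_smul, eq_sub_iff_add_eq]
    simp only [D, LoopDer.D]
    rw [← map_add, ← map_add, ← vf_add, sub_add_cancel]
  rw [S.D_lie_D, hD, cons_add_cons, toC_cons]
  simp only [pairing_cons]

end TwistData

namespace CartanData

variable (C : CartanData S)

/-- Induction over the spanning set of `L̃`. -/
theorem Ltilde_ind {p : C.Ltilde → Prop} (x : C.Ltilde) (h0 : p 0)
    (ha : ∀ x y, p x → p y → p (x + y)) (hs : ∀ (c : ℂ) x, p x → p (c • x))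
    (hX : ∀ k x, p (C.LX k x)) (hI : ∀ u r, p (C.LI u r)) : p x := by
  suffices h : ∀ y ∈ Submodule.span ℂ {y | C.GenL y}, ∃ h : y ∈ C.Ltilde, p ⟨y, h⟩ from
    (h x x.2).2
  intro y hy
  induction hy using Submodule.span_induction with
  | zero => exact ⟨zero_mem _, h0⟩
  | add a b _ _ iha ihb => exact ⟨add_mem iha.1 ihb.1, ha _ _ iha.2 ihb.2⟩
  | smul d a _ iha => exact ⟨C.Ltilde.smul_mem d iha.1, hs d _ iha.2⟩
  | mem a ha =>
    cases ha with
    | X k x hx => exact ⟨(C.LX k ⟨x, hx⟩).2, hX k ⟨x, hx⟩⟩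
    | I u r hr => exact ⟨(C.LI u ⟨r, hr⟩).2, hI u ⟨r, hr⟩⟩

theorem D_sub (a b : Fin n → ℂ) (c d : ℂ) (q : Fin n → ℤ) :
    LoopDer.D 𝔤 (c • a - d • b) q = c • LoopDer.D 𝔤 a q - d • LoopDer.D 𝔤 b q := by
  simp only [LoopDer.D]
  rw [sub_eq_add_neg, ← neg_smul, vf_add, vf_smul, vf_smul, map_add, map_smul, map_smul]
  module

theorem LI_lie_LI (u v : Fin n → ℂ) (r s : S.Gam) : ⁅C.LI u r, C.LI v s⁆ =
    pairing _ (s : Fin n → ℤ) u • (C.LI v (r + s) - C.LI v s) -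
      pairing _ (r : Fin n → ℤ) v • (C.LI u (r + s) - C.LI u r) := by
  refine Subtype.ext ?_
  change ⁅elI 𝔤 u r, elI 𝔤 v s⁆ = pairing _ (s : Fin n → ℤ) u •
    (elI 𝔤 v ((r : Fin n → ℤ) + s) - elI 𝔤 v s) - pairing _ (r : Fin n → ℤ) v •
      (elI 𝔤 u ((r : Fin n → ℤ) + s) - elI 𝔤 u r)
  simp only [elI, sub_lie, lie_sub, LoopDer.D_lie_D, D_sub, pairing_zero, add_zero, zero_add]
  module

/-- `X(k + r)` for `X ∈ 𝔤°_{k̄}` and `r ∈ Γ`. -/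
def LXs (k : Fin n → ℤ) (x : C.gcircComp k) (r : S.Gam) : C.Ltilde :=
  C.LX (k + r) ⟨x, by rw [C.mem_gcircComp_add k r r.2]; exact x.2⟩

theorem LXs_zero (k : Fin n → ℤ) (x : C.gcircComp k) : C.LXs k x 0 = C.LX k x := by
  refine Subtype.ext ?_
  change LoopDer.X ((x : C.gcirc) : 𝔤) (k + 0) = LoopDer.X ((x : C.gcirc) : 𝔤) k
  rw [add_zero]

theorem LI_lie_LXs (u : Fin n → ℂ) (r s : S.Gam) (k : Fin n → ℤ) (x : C.gcircComp k) :
    ⁅C.LI u r, C.LXs k x s⁆ =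
      pairing _ (k + (s : Fin n → ℤ)) u • (C.LXs k x (r + s) - C.LXs k x s) := by
  refine Subtype.ext ?_
  change ⁅elI 𝔤 u r, LoopDer.X ((x : C.gcirc) : 𝔤) (k + (s : Fin n → ℤ))⁆ = pairing _ (k + (s : Fin n → ℤ)) u •
    (LoopDer.X ((x : C.gcirc) : 𝔤) (k + ((r : Fin n → ℤ) + (s : Fin n → ℤ))) -
      LoopDer.X ((x : C.gcirc) : 𝔤) (k + (s : Fin n → ℤ)))
  rw [elI, sub_lie, LoopDer.D_lie_X, LoopDer.D_lie_X, add_zero,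
    show k + ((r : Fin n → ℤ) + s) = k + s + r by abel, smul_sub]

/-- The bracket of homogeneous elements of `𝔤°`. -/
def gcircBracket {k l : Fin n → ℤ} (x : C.gcircComp k) (y : C.gcircComp l) : C.gcircComp (k + l) :=
  ⟨⁅(x : C.gcirc), (y : C.gcirc)⁆, C.lie_mem_gcircComp x.2 y.2⟩

theorem LXs_lie_LXs (r s : S.Gam) (k l : Fin n → ℤ) (x : C.gcircComp k) (y : C.gcircComp l) :
    ⁅C.LXs k x r, C.LXs l y s⁆ = C.LXs (k + l) (C.gcircBracket x y) (r + s) := by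
  refine Subtype.ext ?_
  change ⁅LoopDer.X ((x : C.gcirc) : 𝔤) (k + (r : Fin n → ℤ)), LoopDer.X ((y : C.gcirc) : 𝔤) (l + (s : Fin n → ℤ))⁆ =
    LoopDer.X ⁅((x : C.gcirc) : 𝔤), ((y : C.gcirc) : 𝔤)⁆ (k + l + ((r : Fin n → ℤ) + (s : Fin n → ℤ)))
  rw [LoopDer.X_lie_X]
  congr 1
  abel

theorem LX_lie_LX (k l : Fin n → ℤ) (x : C.gcircComp k) (y : C.gcircComp l) :
    ⁅C.LX k x, C.LX l y⁆ = C.LX (k + l) (C.gcircBracket x y) := by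
  rw [← LXs_zero, ← LXs_zero, ← LXs_zero, LXs_lie_LXs, add_zero]

variable [FiniteDimensional ℂ 𝔤] [LieAlgebra.IsSimple ℂ 𝔤]

variable (S) in
/-- `t^q ∑ uᵢ Kᵢ ∈ τ` for `q ∈ Γ`, the sum running over `1 ≤ i ≤ n`. -/
def centralElt (u : Fin n → ℂ) (q : S.Gam) : S.tau :=
  S.tK (Fin.cons 0 u) ⟨Fin.cons 0 q, cons_mem_Lam S q.2⟩

variable (S) in
/-- The span of the `t^q ∑ uᵢ Kᵢ`, `q ∈ Γ`, `1 ≤ i ≤ n`. -/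
def centralSpan : Submodule ℂ S.tau := Submodule.span ℂ {z | ∃ u q, z = centralElt S u q}

theorem centralElt_mem (u : Fin n → ℂ) (q : S.Gam) : centralElt S u q ∈ centralSpan S :=
  Submodule.subset_span ⟨u, q, rfl⟩

theorem coe_toTau_LX (k : Fin n → ℤ) (x : C.gcircComp k) :
    (C.toTau (C.LX k x) : S.Full) = S.X ((x : C.gcirc) : 𝔤) (Fin.cons 0 k) := embed_X _ _

theorem coe_toTau_LI (u : Fin n → ℂ) (r : S.Gam) :
    (C.toTau (C.LI u r) : S.Full) = S.D (Fin.cons 0 u) (Fin.cons 0 r) - S.D (Fin.cons 0 u) (Fin.cons 0 0) := by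
  change embed S (elI 𝔤 u r) = _
  rw [elI, map_sub, embed_D, embed_D]

theorem toTau_LI_lie_central (v u : Fin n → ℂ) (r q : S.Gam) :
    ⁅C.toTau (C.LI v r), centralElt S u q⁆ =
      pairing _ (q : Fin n → ℤ) v • (centralElt S u (r + q) - centralElt S u q) +
        (v ⬝ᵥ u) • centralElt S (toC (r : Fin n → ℤ)) (r + q) := by
  refine Subtype.ext ?_
  change ⁅(C.toTau (C.LI v r) : S.Full), S.K (Fin.cons 0 u) (Fin.cons 0 q)⁆ =
    pairing _ (q : Fin n → ℤ) v • (S.K (Fin.cons 0 u) (Fin.cons 0 ((r : Fin n → ℤ) + q)) -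
      S.K (Fin.cons 0 u) (Fin.cons 0 q)) + (v ⬝ᵥ u) •
        S.K (Fin.cons 0 (toC (r : Fin n → ℤ))) (Fin.cons 0 ((r : Fin n → ℤ) + q))
  have h : (Fin.cons 0 v : Fin (n + 1) → ℂ) ⬝ᵥ Fin.cons 0 u = v ⬝ᵥ u := by
    simp [dotProduct, Fin.sum_univ_succ]
  rw [coe_toTau_LI, cons_zero_zero, sub_lie, S.D_lie_K, S.D_lie_K, pairing_cons, cons_add_cons, toC_zero, S.K_zero,
    toC_cons, h, zero_add, smul_zero, add_zero]
  module

theorem toTau_LX_lie_central (k : Fin n → ℤ) (x : C.gcircComp k) (u : Fin n → ℂ) (q : S.Gam) :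
    ⁅C.toTau (C.LX k x), centralElt S u q⁆ = 0 := by
  refine Subtype.ext ?_
  change ⁅(C.toTau (C.LX k x) : S.Full), S.K (Fin.cons 0 u) (Fin.cons 0 q)⁆ = 0
  rw [coe_toTau_LX, S.X_lie_K]

theorem central_lie_central (v u : Fin n → ℂ) (r q : S.Gam) :
    ⁅centralElt S v r, centralElt S u q⁆ = 0 := Subtype.ext (S.K_lie_K _ _ _ _)

/-- The central terms are normalised by the lifted `L̃`, as `eq_zero_of_normalised` will require. -/
theorem toTau_lie_mem_central (a : C.Ltilde) {z : S.tau} (hz : z ∈ centralSpan S) :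
    ⁅C.toTau a, z⁆ ∈ centralSpan S := by
  induction hz using Submodule.span_induction with
  | zero => rw [lie_zero]; exact zero_mem _
  | add a b _ _ ha hb => rw [lie_add]; exact add_mem ha hb
  | smul c a _ ha => rw [lie_smul]; exact Submodule.smul_mem _ _ ha
  | mem z hz =>
    obtain ⟨u, q, rfl⟩ := hz
    induction a using C.Ltilde_ind with
    | h0 => rw [map_zero, zero_lie]; exact zero_mem _
    | ha x y hx hy => rw [map_add, add_lie]; exact add_mem hx hy
    | hs c x hx => rw [map_smul, smul_lie]; exact Submodule.smul_mem _ _ hx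
    | hX k x => rw [toTau_LX_lie_central]; exact zero_mem _
    | hI v r =>
      rw [toTau_LI_lie_central]
      exact add_mem (Submodule.smul_mem _ _ (sub_mem (centralElt_mem _ _) (centralElt_mem _ _)))
        (Submodule.smul_mem _ _ (centralElt_mem _ _))

/-- Neither the invariant form nor the cocycle pairs a derivation with a loop element, so mixed
brackets lift without error. -/
theorem toTau_LI_lie_LX (u : Fin n → ℂ) (r : S.Gam) (k : Fin n → ℤ) (x : C.gcircComp k) :
    ⁅C.toTau (C.LI u r), C.toTau (C.LX k x)⁆ = C.toTau ⁅C.LI u r, C.LX k x⁆ := by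
  rw [← C.LXs_zero k x, LI_lie_LXs, map_smul, map_sub, add_zero]
  refine Subtype.ext ?_
  change ⁅(C.toTau (C.LI u r) : S.Full), (C.toTau (C.LXs k x 0) : S.Full)⁆ =
    _ • ((C.toTau (C.LXs k x r) : S.Full) - (C.toTau (C.LXs k x 0) : S.Full))
  rw [coe_toTau_LI, cons_zero_zero, LXs, LXs, coe_toTau_LX, coe_toTau_LX, sub_lie, S.D_lie_X, S.D_lie_X,
    pairing_cons, cons_add_cons, add_zero, smul_sub]
  simp

/-- The error is `(X,Y) t^(k+l) ∑ kᵢ Kᵢ`. Invariance of the form under the automorphisms makes it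
vanish unless `k + l ∈ Γ`, so it belongs to the span of the available central elements. -/
theorem toTau_LX_lie_LX (k l : Fin n → ℤ) (x : C.gcircComp k) (y : C.gcircComp l) :
    ⁅C.toTau (C.LX k x), C.toTau (C.LX l y)⁆ - C.toTau ⁅C.LX k x, C.LX l y⁆ ∈ centralSpan S := by
  rw [LX_lie_LX]
  have h : ((⁅C.toTau (C.LX k x), C.toTau (C.LX l y)⁆ -
      C.toTau (C.LX (k + l) (C.gcircBracket x y)) : S.tau) : S.Full) =
      S.B ((x : C.gcirc) : 𝔤) ((y : C.gcirc) : 𝔤) •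
        S.K (Fin.cons 0 (toC k)) (Fin.cons 0 (k + l)) := by
    change ⁅(C.toTau (C.LX k x) : S.Full), (C.toTau (C.LX l y) : S.Full)⁆ -
      (C.toTau (C.LX (k + l) (C.gcircBracket x y)) : S.Full) = _
    rw [coe_toTau_LX, coe_toTau_LX, coe_toTau_LX, S.X_lie_X, cons_add_cons, toC_cons]
    exact add_sub_cancel_left _ _
  by_cases hB : S.B ((x : C.gcirc) : 𝔤) ((y : C.gcirc) : 𝔤) = 0
  · rw [hB, zero_smul] at h
    rw [show _ - _ = (0 : S.tau) from Subtype.ext h]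
    exact zero_mem _
  · have hm := S.add_mem_Lam (C.gcircComp_le k x x.2).1 (C.gcircComp_le l y y.2).1 hB
    rw [cons_add_cons] at hm
    have hg : k + l ∈ S.Gam := fun i => by simpa using hm i.succ
    rw [show _ - _ = S.B ((x : C.gcirc) : 𝔤) ((y : C.gcirc) : 𝔤) •
      centralElt S (toC k) ⟨k + l, hg⟩ from Subtype.ext h]
    exact Submodule.smul_mem _ _ (centralElt_mem _ _)

/-- The error is the cocycle of the two vector fields. -/
theorem toTau_LI_lie_LI (u v : Fin n → ℂ) (r s : S.Gam) :
    ⁅C.toTau (C.LI u r), C.toTau (C.LI v s)⁆ - C.toTau ⁅C.LI u r, C.LI v s⁆ ∈ centralSpan S := by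
  have h : ⁅C.toTau (C.LI u r), C.toTau (C.LI v s)⁆ - C.toTau ⁅C.LI u r, C.LI v s⁆ =
      (S.c₁ * (-(pairing _ (s : Fin n → ℤ) u * pairing _ (r : Fin n → ℤ) v)) +
        S.c₂ * (pairing _ (r : Fin n → ℤ) u * pairing _ (s : Fin n → ℤ) v)) •
          centralElt S (toC (r : Fin n → ℤ)) (r + s) := by
    rw [LI_lie_LI, sub_eq_iff_eq_add, map_sub, map_smul, map_smul, map_sub, map_sub]
    refine Subtype.ext ?_
    change ⁅(C.toTau (C.LI u r) : S.Full), (C.toTau (C.LI v s) : S.Full)⁆ =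
      _ • S.K (Fin.cons 0 (toC (r : Fin n → ℤ))) (Fin.cons 0 ((r : Fin n → ℤ) + s)) +
      (_ • ((C.toTau (C.LI v (r + s)) : S.Full) - (C.toTau (C.LI v s) : S.Full)) -
        _ • ((C.toTau (C.LI u (r + s)) : S.Full) - (C.toTau (C.LI u r) : S.Full)))
    rw [coe_toTau_LI, coe_toTau_LI, coe_toTau_LI, coe_toTau_LI, sub_lie, lie_sub, lie_sub,
      S.D_lie_D_cons, S.D_lie_D_cons, S.D_lie_D_cons, S.D_lie_D_cons]
    -- Of the four brackets only the one of degrees `r` and `s` has a central term: the cocycle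
    -- vanishes when either degree is zero.
    rw [add_zero (r : Fin n → ℤ), zero_add (s : Fin n → ℤ), add_zero (0 : Fin n → ℤ),
      pairing_zero, pairing_zero]
    change _ = _ + (_ • (S.D _ (Fin.cons 0 ((r : Fin n → ℤ) + s)) - _ - _) -
      _ • (S.D _ (Fin.cons 0 ((r : Fin n → ℤ) + s)) - _ - _))
    module
  rw [h]
  exact Submodule.smul_mem _ _ (centralElt_mem _ _)

/-- `L̃ → τ` is a homomorphism of Lie algebras up to central terms. -/
theorem toTau_defect (a b : C.Ltilde) :
    ⁅C.toTau a, C.toTau b⁆ - C.toTau ⁅a, b⁆ ∈ centralSpan S := by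
  have hadd : ∀ a, ∀ x y : C.Ltilde,
      ⁅C.toTau a, C.toTau x⁆ - C.toTau ⁅a, x⁆ ∈ centralSpan S →
      ⁅C.toTau a, C.toTau y⁆ - C.toTau ⁅a, y⁆ ∈ centralSpan S →
      ⁅C.toTau a, C.toTau (x + y)⁆ - C.toTau ⁅a, x + y⁆ ∈ centralSpan S := fun a x y hx hy => by
    rw [map_add, lie_add, lie_add, map_add, add_sub_add_comm]; exact add_mem hx hy
  have hsmul : ∀ a (c : ℂ) (x : C.Ltilde),
      ⁅C.toTau a, C.toTau x⁆ - C.toTau ⁅a, x⁆ ∈ centralSpan S →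
      ⁅C.toTau a, C.toTau (c • x)⁆ - C.toTau ⁅a, c • x⁆ ∈ centralSpan S := fun a c x hx => by
    rw [map_smul, lie_smul, lie_smul, map_smul, ← smul_sub]; exact Submodule.smul_mem _ _ hx
  have hzero : ∀ a, ⁅C.toTau a, C.toTau 0⁆ - C.toTau ⁅a, 0⁆ ∈ centralSpan S := fun a => by
    rw [lie_zero, map_zero, lie_zero, sub_zero]; exact zero_mem _
  -- Antisymmetry reduces linearity in the first argument to linearity in the second.
  have hskew : ∀ a b, ⁅C.toTau a, C.toTau b⁆ - C.toTau ⁅a, b⁆ ∈ centralSpan S →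
      ⁅C.toTau b, C.toTau a⁆ - C.toTau ⁅b, a⁆ ∈ centralSpan S := fun a b h => by
    rw [← lie_skew, ← lie_skew b, map_neg, ← neg_sub', neg_mem_iff]
    exact h
  induction a using C.Ltilde_ind with
  | h0 => exact hskew _ _ (hzero b)
  | ha x y hx hy => exact hskew _ _ (hadd b x y (hskew _ _ hx) (hskew _ _ hy))
  | hs c x hx => exact hskew _ _ (hsmul b c x (hskew _ _ hx))
  | hX k x =>
    induction b using C.Ltilde_ind with
    | h0 => exact hzero _
    | ha x y hx hy => exact hadd _ x y hx hy
    | hs c x hx => exact hsmul _ c x hx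
    | hX l y => exact C.toTau_LX_lie_LX k l x y
    | hI u r => exact hskew _ _ (by rw [toTau_LI_lie_LX, sub_self]; exact zero_mem _)
  | hI u r =>
    induction b using C.Ltilde_ind with
    | h0 => exact hzero _
    | ha x y hx hy => exact hadd _ x y hx hy
    | hs c x hx => exact hsmul _ c x hx
    | hX l y => rw [toTau_LI_lie_LX, sub_self]; exact zero_mem _
    | hI v s => exact C.toTau_LI_lie_LI u v r s

end CartanData
end Twisted
end Toroidal

/-! ### Operators on T / W induced by elements of τ -/

namespace Toroidal
section Twisted
variable {𝔤 : Type*} [LieRing 𝔤] [LieAlgebra ℂ 𝔤] {n : ℕ} {S : TwistData 𝔤 n}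
namespace CartanData
variable (C : CartanData S) [FiniteDimensional ℂ 𝔤] [LieAlgebra.IsSimple ℂ 𝔤]
variable (V : Type*) [AddCommGroup V] [Module ℂ V] [LieRingModule S.tau V] [LieModule ℂ S.tau V]
variable (c : ℂ)

theorem centralElt_mem_tauZero (u : Fin n → ℂ) (q : S.Gam) :
    (centralElt S u q : S.Full) ∈ C.tauZero :=
  Submodule.subset_span (GenZero.K (C := C) _ _ (cons_mem_Lam S q.2) (by simp))

/-- The action of `t^q ∑ uᵢ Kᵢ` on `T`. -/
def centralT (u : Fin n → ℂ) (q : S.Gam) : Module.End ℂ (C.T V) :=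
  (LieModule.toEnd ℂ S.tau V (centralElt S u q)).restrict fun _ hv =>
    C.lie_mem_T (C.centralElt_mem_tauZero u q) hv

theorem coe_centralT (u : Fin n → ℂ) (q : S.Gam) (v : C.T V) :
    (C.centralT V u q v : V) = ⁅centralElt S u q, (v : V)⁆ := rfl

/-- The symbols `t^q Kᵢ` commute with `t^r K₀`, hence with the operators `t^r` whose differences
from the identity generate `W`. -/
theorem centralT_W (u : Fin n → ℂ) (q : S.Gam) :
    C.W V c ≤ (C.W V c).comap (C.centralT V u q) := by
  refine Submodule.span_le.2 ?_
  rintro _ ⟨r, v, rfl⟩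
  rw [SetLike.mem_coe, Submodule.mem_comap]
  have h : C.centralT V u q (C.monoT V c r v - v) =
      C.monoT V c r (C.centralT V u q v) - C.centralT V u q v := by
    have h0 : ⁅centralElt S u q, tK0 r⁆ = 0 := Subtype.ext (S.K_lie_K _ _ _ _)
    refine Subtype.ext ?_
    rw [map_sub, AddSubgroupClass.coe_sub, AddSubgroupClass.coe_sub, coe_monoT, coe_centralT,
      coe_centralT, coe_monoT, lie_smul, leibniz_lie, h0, zero_lie, zero_add]
  rw [h]
  exact C.monoT_sub_mem V c _ _

/-- The action of `t^q ∑ uᵢ Kᵢ` on `Ṽ`. -/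
def centralV (u : Fin n → ℂ) (q : S.Gam) : Module.End ℂ (C.Vtilde V c) :=
  (C.W V c).mapQ (C.W V c) (C.centralT V u q) (C.centralT_W V c u q)

/-- The operator `Z` on `Ṽ` is induced by the element `x` of `τ`. -/
def Induces (x : S.tau) (Z : Module.End ℂ (C.Vtilde V c)) : Prop :=
  ∀ v : C.T V, ∃ w : C.T V, (w : V) = ⁅x, (v : V)⁆ ∧ Z ((C.W V c).mkQ v) = (C.W V c).mkQ w

variable {V c}

/-- Uniqueness, together with compatibility with brackets, transports identities from `τ` to `Ṽ`,
although not every element of `τ` acts there. -/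
theorem Induces.unique {x : S.tau} {Y Z : Module.End ℂ (C.Vtilde V c)}
    (hY : C.Induces V c x Y) (hZ : C.Induces V c x Z) : Y = Z := by
  apply Submodule.linearMap_qext
  refine LinearMap.ext fun v => ?_
  obtain ⟨w, hw, hw'⟩ := hY v
  obtain ⟨w₁, hw₁, hw₁'⟩ := hZ v
  obtain rfl : w = w₁ := Subtype.ext (hw.trans hw₁.symm)
  exact hw'.trans hw₁'.symm

theorem Induces.add {x y : S.tau} {X Y : Module.End ℂ (C.Vtilde V c)}
    (hX : C.Induces V c x X) (hY : C.Induces V c y Y) : C.Induces V c (x + y) (X + Y) := fun v => by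
  obtain ⟨w, hw, hw'⟩ := hX v
  obtain ⟨w₁, hw₁, hw₁'⟩ := hY v
  exact ⟨w + w₁, by rw [add_lie, ← hw, ← hw₁]; rfl,
    by rw [LinearMap.add_apply, hw', hw₁', map_add]⟩

theorem Induces.smul {x : S.tau} {X : Module.End ℂ (C.Vtilde V c)} (d : ℂ)
    (hX : C.Induces V c x X) : C.Induces V c (d • x) (d • X) := fun v => by
  obtain ⟨w, hw, hw'⟩ := hX v
  exact ⟨d • w, by rw [smul_lie, ← hw]; rfl, by rw [LinearMap.smul_apply, hw', map_smul]⟩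

theorem Induces.sub {x y : S.tau} {X Y : Module.End ℂ (C.Vtilde V c)}
    (hX : C.Induces V c x X) (hY : C.Induces V c y Y) : C.Induces V c (x - y) (X - Y) := fun v => by
  obtain ⟨w, hw, hw'⟩ := hX v
  obtain ⟨w₁, hw₁, hw₁'⟩ := hY v
  exact ⟨w - w₁, by rw [sub_lie, ← hw, ← hw₁]; rfl,
    by rw [LinearMap.sub_apply, hw', hw₁', map_sub]⟩

theorem Induces.lie {x y : S.tau} {X Y : Module.End ℂ (C.Vtilde V c)}
    (hX : C.Induces V c x X) (hY : C.Induces V c y Y) : C.Induces V c ⁅x, y⁆ ⁅X, Y⁆ := fun v => by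
  obtain ⟨w, hw, hw'⟩ := hX v
  obtain ⟨w₁, hw₁, hw₁'⟩ := hY v
  obtain ⟨a, ha, ha'⟩ := hX w₁
  obtain ⟨b, hb, hb'⟩ := hY w
  refine ⟨a - b, ?_, ?_⟩
  · rw [lie_lie, ← hw, ← hw₁, ← ha, ← hb]; rfl
  · rw [Ring.lie_def, LinearMap.sub_apply, Module.End.mul_apply, Module.End.mul_apply, hw', hw₁',
      ha', hb', map_sub]

variable (V c)

theorem induces_zero : C.Induces V c 0 0 := fun v => ⟨0, by simp, by simp⟩

theorem induces_act (a : C.Ltilde) : C.Induces V c (C.toTau a) (C.act V c a) :=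
  fun v => ⟨C.actT V a v, rfl, rfl⟩

theorem induces_centralV (u : Fin n → ℂ) (q : S.Gam) :
    C.Induces V c (centralElt S u q) (C.centralV V c u q) :=
  fun v => ⟨C.centralT V u q v, rfl, rfl⟩

/-- The span of the operators `t^q ∑ uᵢ Kᵢ` on `Ṽ`. -/
def centralSpanV : Submodule ℂ (Module.End ℂ (C.Vtilde V c)) :=
  Submodule.span ℂ {Z | ∃ u q, Z = C.centralV V c u q}

theorem exists_induces {z : S.tau} (hz : z ∈ centralSpan S) :
    ∃ Z ∈ C.centralSpanV V c, C.Induces V c z Z := by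
  induction hz using Submodule.span_induction with
  | zero => exact ⟨0, zero_mem _, C.induces_zero V c⟩
  | add a b _ _ ha hb =>
    obtain ⟨A, hA, hA'⟩ := ha
    obtain ⟨B, hB, hB'⟩ := hb
    exact ⟨A + B, add_mem hA hB, Induces.add C hA' hB'⟩
  | smul d a _ ha =>
    obtain ⟨A, hA, hA'⟩ := ha
    exact ⟨d • A, Submodule.smul_mem _ d hA, Induces.smul C d hA'⟩
  | mem z hz =>
    obtain ⟨u, q, rfl⟩ := hz
    exact ⟨_, Submodule.subset_span ⟨u, q, rfl⟩, C.induces_centralV V c u q⟩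

theorem mem_centralSpanV {z : S.tau} (hz : z ∈ centralSpan S) {Z : Module.End ℂ (C.Vtilde V c)}
    (hZ : C.Induces V c z Z) : Z ∈ C.centralSpanV V c := by
  obtain ⟨Z', hZ', h⟩ := C.exists_induces V c hz
  rwa [Induces.unique C hZ h]

theorem act_defect (a b : C.Ltilde) :
    ⁅C.act V c a, C.act V c b⁆ - C.act V c ⁅a, b⁆ ∈ C.centralSpanV V c :=
  C.mem_centralSpanV V c (C.toTau_defect a b) (Induces.sub C
    (Induces.lie C (C.induces_act V c a) (C.induces_act V c b)) (C.induces_act V c _))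

theorem act_lie_mem_centralSpanV (a : C.Ltilde) {Z : Module.End ℂ (C.Vtilde V c)}
    (hZ : Z ∈ C.centralSpanV V c) : ⁅C.act V c a, Z⁆ ∈ C.centralSpanV V c := by
  induction hZ using Submodule.span_induction with
  | zero => rw [lie_zero]; exact zero_mem _
  | add a b _ _ ha hb => rw [lie_add]; exact add_mem ha hb
  | smul c a _ ha => rw [lie_smul]; exact Submodule.smul_mem _ _ ha
  | mem z hz =>
    obtain ⟨u, q, rfl⟩ := hz
    exact C.mem_centralSpanV V c (C.toTau_lie_mem_central a (centralElt_mem u q))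
      (Induces.lie C (C.induces_act V c a) (C.induces_centralV V c u q))

theorem central_commute {Z Y : Module.End ℂ (C.Vtilde V c)} (hZ : Z ∈ C.centralSpanV V c)
    (hY : Y ∈ C.centralSpanV V c) : Commute Z Y := by
  rw [commute_iff_lie_eq]
  refine (Submodule.mem_bot ℂ).1 (TwistData.lie_span_mem
    (M := (⊥ : Submodule ℂ (Module.End ℂ (C.Vtilde V c)))) ?_ hZ hY)
  rintro _ ⟨u, q, rfl⟩ _ ⟨v, r, rfl⟩
  refine (Submodule.mem_bot ℂ).2 ?_
  have h := Induces.lie C (C.induces_centralV V c u q) (C.induces_centralV V c v r)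
  rw [central_lie_central] at h
  exact Induces.unique C h (C.induces_zero V c)

/-- In degree zero the symbol is a combination of `K₁, …, Kₙ`, which act as zero. -/
theorem centralV_zero (hK : ∀ i ≠ 0, ∀ v : V, ⁅S.tK (Pi.single i 1) 0, v⁆ = 0)
    (u : Fin n → ℂ) : C.centralV V c u 0 = 0 := by
  have h : centralElt S u 0 = ∑ i : Fin n, u i • S.tK (Pi.single i.succ 1) 0 := by
    refine Subtype.ext ?_
    have h1 : ((∑ i : Fin n, u i • S.tK (Pi.single i.succ 1) 0 : S.tau) : S.Full) =
        ∑ i : Fin n, u i • S.K (Pi.single i.succ 1) 0 := by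
      rw [AddSubmonoidClass.coe_finsetSum]; rfl
    rw [h1]
    change S.K (Fin.cons 0 u) (Fin.cons 0 ((0 : S.Gam) : Fin n → ℤ)) = _
    have h2 : (Fin.cons 0 u : Fin (n + 1) → ℂ) = ∑ i : Fin n, u i • Pi.single i.succ 1 := by
      ext j
      refine Fin.cases ?_ (fun j => ?_) j
      · simp [Finset.sum_apply]
      · simp [Finset.sum_apply, Pi.single_apply]
    let φ : (Fin (n + 1) → ℂ) →ₗ[ℂ] S.Full :=
      { toFun := fun u => S.K u 0
        map_add' := fun u v => S.K_add u v 0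
        map_smul' := fun d u => S.K_smul d u 0 }
    rw [show (Fin.cons 0 ((0 : S.Gam) : Fin n → ℤ) : Fin (n + 1) → ℤ) = 0 from cons_zero_zero, h2]
    change φ _ = ∑ i : Fin n, u i • φ _
    rw [map_sum]
    exact Finset.sum_congr rfl fun i _ => map_smul φ _ _
  refine Induces.unique C (C.induces_centralV V c u 0) fun v => ⟨0, ?_, by simp⟩
  rw [h]
  have h2 : ∀ i : Fin n, (u i • S.tK (Pi.single i.succ 1) 0 : S.tau) ∈
      LinearMap.ker ((LieModule.toEnd ℂ S.tau V : S.tau →ₗ[ℂ] Module.End ℂ V).flip (v : V)) :=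
    fun i => LinearMap.mem_ker.2 (by
      change ⁅u i • S.tK (Pi.single i.succ 1) 0, (v : V)⁆ = 0
      rw [smul_lie, hK _ (Fin.succ_ne_zero i), smul_zero])
  exact (LinearMap.mem_ker.1 (sum_mem fun i _ => h2 i)).symm

/-- The part `D(v,-q)` moves `t^q Kᵢ` to degree zero, where it acts as zero. Only the subtracted
part `D(v,0)` remains, and it reads off the degree: the central operator is an eigenvector with
eigenvalue `-(v,q)`. -/
theorem act_LI_lie_centralV (hK : ∀ i ≠ 0, ∀ v : V, ⁅S.tK (Pi.single i 1) 0, v⁆ = 0)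
    (v u : Fin n → ℂ) (q : S.Gam) : ⁅C.act V c (C.LI v (-q)), C.centralV V c u q⁆ =
      (-pairing _ (q : Fin n → ℤ) v) • C.centralV V c u q := by
  have h := Induces.lie C (C.induces_act V c (C.LI v (-q))) (C.induces_centralV V c u q)
  rw [toTau_LI_lie_central, neg_add_cancel] at h
  have h1 := Induces.add C (Induces.smul C (pairing _ (q : Fin n → ℤ) v)
    (Induces.sub C (C.induces_centralV V c u 0) (C.induces_centralV V c u q)))
    (Induces.smul C (v ⬝ᵥ u)
      (C.induces_centralV V c (toC ((-q : S.Gam) : Fin n → ℤ)) 0))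
  rw [Induces.unique C h h1, C.centralV_zero V c hK, C.centralV_zero V c hK]
  rw [zero_sub, smul_zero, add_zero]
  refine LinearMap.ext fun w => ?_
  change pairing _ (q : Fin n → ℤ) v • -(C.centralV V c u q w) =
    (-pairing _ (q : Fin n → ℤ) v) • C.centralV V c u q w
  rw [smul_neg, neg_smul]

end CartanData
end Twisted
end Toroidal

/-! ### Weights and finite-dimensional stable subspaces -/

namespace Toroidal
section Twisted
variable {𝔤 : Type*} [LieRing 𝔤] [LieAlgebra ℂ 𝔤] {n : ℕ} {S : TwistData 𝔤 n}
namespace CartanData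
variable (C : CartanData S) [FiniteDimensional ℂ 𝔤] [LieAlgebra.IsSimple ℂ 𝔤]

/-- The element `x` of `τ` is homogeneous for `ad H`: it has weight `α` for `𝔥(0)`, weight `0` for the
`Kᵢ` and weight `a i` for `dᵢ`. -/
structure HasDegree (x : S.tau) (α : Module.Dual ℂ C.h0) (a : Fin (n + 1) → ℂ) : Prop where
  cartan : ∀ h : C.h0, ⁅C.tH h, x⁆ = α h • x
  central : ∀ i, ⁅S.tK (Pi.single i 1) 0, x⁆ = 0
  der : ∀ i, ⁅S.tD (Pi.single i 1) 0, x⁆ = a i • x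

theorem hasDegree_X {k : Fin (n + 1) → ℤ} {α : Module.Dual ℂ C.h0} {x : S.tau} {y : 𝔤}
    (hy : y ∈ C.comp k α) (hx : (x : S.Full) = S.X y k) : C.HasDegree x α (toC k) where
  cartan h := by
    refine Subtype.ext ?_
    change ⁅S.X (h : 𝔤) 0, (x : S.Full)⁆ = α h • (x : S.Full)
    rw [hx, S.X_lie_X, toC_zero, S.K_zero, smul_zero, add_zero, zero_add, hy.2 h, S.X_smul]
  central i := by
    refine Subtype.ext ?_
    change ⁅S.K (Pi.single i 1) 0, (x : S.Full)⁆ = 0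
    rw [hx, ← lie_skew, S.X_lie_K, neg_zero]
  der i := by
    refine Subtype.ext ?_
    change ⁅S.D (Pi.single i 1) 0, (x : S.Full)⁆ = toC k i • (x : S.Full)
    rw [hx, S.D_lie_X, pairing_single, add_zero, toC]

theorem hasDegree_K {u : Fin (n + 1) → ℂ} {r : Fin (n + 1) → ℤ} {x : S.tau}
    (hx : (x : S.Full) = S.K u r) : C.HasDegree x 0 (toC r) where
  cartan h := by
    refine Subtype.ext ?_
    change ⁅S.X (h : 𝔤) 0, (x : S.Full)⁆ = (0 : ℂ) • (x : S.Full)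
    rw [hx, S.X_lie_K, zero_smul]
  central i := by
    refine Subtype.ext ?_
    change ⁅S.K (Pi.single i 1) 0, (x : S.Full)⁆ = 0
    rw [hx, S.K_lie_K]
  der i := by
    refine Subtype.ext ?_
    change ⁅S.D (Pi.single i 1) 0, (x : S.Full)⁆ = toC r i • (x : S.Full)
    rw [hx, S.D_lie_K, pairing_single, toC_zero, S.K_zero, smul_zero, add_zero, zero_add, toC]

theorem hasDegree_D {u : Fin (n + 1) → ℂ} {r : Fin (n + 1) → ℤ} {x : S.tau}
    (hx : (x : S.Full) = S.D u r) : C.HasDegree x 0 (toC r) where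
  cartan h := by
    refine Subtype.ext ?_
    change ⁅S.X (h : 𝔤) 0, (x : S.Full)⁆ = (0 : ℂ) • (x : S.Full)
    rw [hx, ← lie_skew, S.D_lie_X, pairing_zero, zero_smul, zero_smul, neg_zero]
  central i := by
    refine Subtype.ext ?_
    change ⁅S.K (Pi.single i 1) 0, (x : S.Full)⁆ = 0
    rw [hx, ← lie_skew, S.D_lie_K, pairing_zero, zero_smul, zero_add, add_zero, S.K_toC_self,
      smul_zero, neg_zero]
  der i := by
    refine Subtype.ext ?_
    change ⁅S.D (Pi.single i 1) 0, (x : S.Full)⁆ = toC r i • (x : S.Full)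
    rw [hx, S.D_lie_D, pairing_single, pairing_zero, toC_zero, S.K_zero, smul_zero, add_zero,
      zero_smul, sub_zero, zero_add, S.D_smul, toC]

variable (V : Type*) [AddCommGroup V] [Module ℂ V] [LieRingModule S.tau V] [LieModule ℂ S.tau V]
variable (c : ℂ)

variable {V} in
theorem lie_mem_weightSpace {x : S.tau} {α : Module.Dual ℂ C.h0} {a : Fin (n + 1) → ℂ}
    (hx : C.HasDegree x α a) {μ : C.Weight} {v : V} (hv : v ∈ C.weightSpace V μ) :
    ⁅x, v⁆ ∈ C.weightSpace V (μ + (α, 0, a)) := by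
  refine ⟨fun h => ?_, fun i => ?_, fun i => ?_⟩
  · rw [leibniz_lie, hx.cartan, hv.1, lie_smul, smul_lie, ← add_smul, add_comm]
    rfl
  · rw [leibniz_lie, hx.central, hv.2.1, lie_smul, zero_lie, zero_add]
    change _ = (μ.2.1 i + 0) • _
    rw [add_zero]
  · rw [leibniz_lie, hx.der, hv.2.2, lie_smul, smul_lie, ← add_smul, add_comm]
    rfl

theorem exists_hasDegree_of_genPlus {y : S.Full} (hy : C.GenPlus y) :
    ∃ x : S.tau, (x : S.Full) = y ∧ ∃ α a, C.HasDegree x α a := by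
  cases hy with
  | X k α hk y hy => exact ⟨⟨_, S.X_mem hy.1⟩, rfl, _, _, C.hasDegree_X hy rfl⟩
  | K u r hr h0 => exact ⟨⟨_, S.K_mem u hr⟩, rfl, _, _, C.hasDegree_K rfl⟩
  | D u r hr h0 => exact ⟨⟨_, S.D_mem u hr⟩, rfl, _, _, C.hasDegree_D rfl⟩

variable {V} in
-- Membership in `T` is tested on homogeneous elements, which shift weights by a fixed amount; this
-- is what makes `T` a sum of weight spaces.
theorem mem_T_iff (v : V) : v ∈ C.T V ↔ ∀ x : S.tau, C.GenPlus (x : S.Full) → ⁅x, v⁆ = 0 := by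
  refine ⟨fun h x hx => h x (Submodule.subset_span hx), fun h x hx => ?_⟩
  have hle : C.tauPlus ≤ (LinearMap.ker
      ((LieModule.toEnd ℂ S.tau V : S.tau →ₗ[ℂ] Module.End ℂ V).flip v)).map
        S.tau.toSubmodule.subtype := by
    refine Submodule.span_le.2 fun y hy => ?_
    obtain ⟨x, rfl, -⟩ := C.exists_hasDegree_of_genPlus hy
    exact ⟨x, LinearMap.mem_ker.2 (h x hy), rfl⟩
  obtain ⟨x', hx', h'⟩ := hle hx
  obtain rfl : x' = x := Subtype.ext h'
  exact LinearMap.mem_ker.1 hx'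

/-- The part of `Ṽ` coming from `T ∩ V_{μ + k}`. -/
def weightPart (μ : C.Weight) (k : Fin n → ℤ) : Submodule ℂ (C.Vtilde V c) :=
  Submodule.map (C.W V c).mkQ ((C.weightSpace V (μ + (0, 0, toC (Fin.cons 0 k)))).comap
    (C.T V).subtype)

/-- The part of `Ṽ` coming from the weights in the class of `μ` modulo `ℤⁿ`. -/
def classPart (μ : C.Weight) : Submodule ℂ (C.Vtilde V c) := ⨆ k, C.weightPart V c μ k

theorem weight_add_add (μ : C.Weight) (k l : Fin n → ℤ) :
    μ + (0, 0, toC (Fin.cons 0 k)) + (0, 0, toC (Fin.cons 0 l)) =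
      μ + (0, 0, toC (Fin.cons 0 (k + l))) := by
  rw [add_assoc, ← cons_add_cons, toC_add]
  simp

variable {V c} in
theorem mkQ_mem_classPart {μ : C.Weight} {k l : Fin n → ℤ} {x : S.tau}
    (hx : C.HasDegree x 0 (toC (Fin.cons 0 l))) {v w : C.T V}
    (hv : (v : V) ∈ C.weightSpace V (μ + (0, 0, toC (Fin.cons 0 k)))) (hw : (w : V) = ⁅x, (v : V)⁆) :
    (C.W V c).mkQ w ∈ C.weightPart V c μ (k + l) := by
  refine ⟨w, ?_, rfl⟩
  have h := C.lie_mem_weightSpace hx hv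
  rw [weight_add_add] at h
  rw [SetLike.mem_coe, Submodule.mem_comap, Submodule.subtype_apply, hw]
  exact h

/-- Modulo `W` the vectors `v` and `t^r v` agree, while their weights differ by `r`. -/
theorem weightPart_le_add (μ : C.Weight) (k : Fin n → ℤ) (r : S.Gam) :
    C.weightPart V c μ k ≤ C.weightPart V c μ (k + r) := by
  rintro _ ⟨v, hv, rfl⟩
  have h : (C.W V c).mkQ v = (C.W V c).mkQ (C.monoT V c r v) :=
    ((Submodule.Quotient.eq _).2 (C.monoT_sub_mem V c r v)).symm
  rw [h]
  have h1 : C.HasDegree (c⁻¹ • tK0 r) 0 (toC (Fin.cons 0 (r : Fin n → ℤ))) :=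
    C.hasDegree_K (u := c⁻¹ • Pi.single 0 1) (by rw [S.K_smul]; rfl)
  exact C.mkQ_mem_classPart h1 hv (by rw [coe_monoT, smul_lie])

variable {V} in
instance finiteDimensional_weightPart [hf : ∀ μ, FiniteDimensional ℂ (C.weightSpace V μ)]
    (μ : C.Weight) (k : Fin n → ℤ) : FiniteDimensional ℂ (C.weightPart V c μ k) := by
  have : FiniteDimensional ℂ ((C.weightSpace V (μ + (0, 0, toC (Fin.cons 0 k)))).comap
      (C.T V).subtype) := by
    refine Module.Finite.of_injective (M := _) (N := C.weightSpace V (μ + (0, 0, toC (Fin.cons 0 k))))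
      ((C.T V).subtype.restrict fun v hv => hv) fun v w h => ?_
    have h' := congrArg Subtype.val h
    exact Subtype.ext (Subtype.ext h')
  exact Module.Finite.map _ _

/-- By `weightPart_le_add` only the residues of `k` modulo `Γ` matter, and the box `0 ≤ kᵢ < mᵢ`
represents them all. -/
theorem finiteDimensional_classPart (hf : ∀ μ, FiniteDimensional ℂ (C.weightSpace V μ))
    (μ : C.Weight) : FiniteDimensional ℂ (C.classPart V c μ) := by
  let box : (∀ i : Fin n, Fin (S.m i.succ)) → Fin n → ℤ := fun j i => ((j i : ℕ) : ℤ)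
  have hle : C.classPart V c μ ≤ ⨆ j, C.weightPart V c μ (box j) := by
    refine iSup_le fun k => ?_
    have hm : ∀ i : Fin n, 0 < (S.m i.succ : ℤ) := fun i => by exact_mod_cast S.m_pos i.succ
    -- This shift in `Γ` replaces each coordinate by its remainder modulo `mᵢ`.
    let r : S.Gam := ⟨fun i => -(S.m i.succ * (k i / S.m i.succ)),
      fun i => (dvd_mul_right _ _).neg_right⟩
    have hb : k + r = box fun i => ⟨(k i % S.m i.succ).toNat, by
        have := Int.emod_lt_of_pos (k i) (hm i)
        have := Int.emod_nonneg (k i) (hm i).ne'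
        omega⟩ := by
      ext i
      have := Int.emod_nonneg (k i) (hm i).ne'
      change k i + -(S.m i.succ * (k i / S.m i.succ)) = (((k i % S.m i.succ).toNat : ℕ) : ℤ)
      rw [Int.toNat_of_nonneg this, Int.emod_def]
      ring
    exact (C.weightPart_le_add V c μ k r).trans (hb ▸ le_iSup (fun j => C.weightPart V c μ (box j)) _)
  exact Submodule.finiteDimensional_of_le hle

/-- A subspace of `Ṽ` stable under `L̃` and the central elements. -/
def IsStable (G : Submodule ℂ (C.Vtilde V c)) : Prop :=
  (∀ a, G ≤ G.comap (C.act V c a)) ∧ ∀ u q, G ≤ G.comap (C.centralV V c u q)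

theorem isStable_iSup {ι : Type*} {G : ι → Submodule ℂ (C.Vtilde V c)}
    (h : ∀ i, C.IsStable V c (G i)) : C.IsStable V c (⨆ i, G i) :=
  ⟨fun a => iSup_le fun i => ((h i).1 a).trans (Submodule.comap_mono (le_iSup G i)),
    fun u q => iSup_le fun i => ((h i).2 u q).trans (Submodule.comap_mono (le_iSup G i))⟩

/-- All the operators come from elements of `𝔥(0)`-weight zero and of degree zero in `t₀`, so they
move weights only inside their class modulo `ℤⁿ`. -/
theorem isStable_classPart (μ : C.Weight) : C.IsStable V c (C.classPart V c μ) := by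
  refine ⟨fun a => ?_, fun u q => ?_⟩
  · induction a using C.Ltilde_ind with
    | h0 => rw [map_zero]; exact fun v _ => Submodule.mem_comap.2 (zero_mem (C.classPart V c μ))
    | ha x y hx hy =>
      rw [map_add]
      exact fun v hv => Submodule.mem_comap.2
        ((C.classPart V c μ).add_mem (Submodule.mem_comap.1 (hx hv)) (Submodule.mem_comap.1 (hy hv)))
    | hs d x hx =>
      rw [map_smul]
      exact fun v hv => Submodule.mem_comap.2
        ((C.classPart V c μ).smul_mem d (Submodule.mem_comap.1 (hx hv)))
    | hX k x =>
      refine iSup_le fun l => ?_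
      rintro _ ⟨v, hv, rfl⟩
      exact (le_iSup (C.weightPart V c μ) (l + k)) (C.mkQ_mem_classPart
        (C.hasDegree_X (C.gcircComp_le k x x.2) (C.coe_toTau_LX k x)) hv (C.coe_actT V _ v))
    | hI u r =>
      refine iSup_le fun l => ?_
      rintro _ ⟨v, hv, rfl⟩
      -- `I(u,r)` is not homogeneous, but its two terms are. They are separated already on `T`,
      -- since `t^r dᵢ` alone need not preserve `W`.
      have hz : ∀ s : S.Gam, ((S.tD (Fin.cons 0 u) ⟨Fin.cons 0 s, cons_mem_Lam S s.2⟩ : S.tau) :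
          S.Full) ∈ C.tauZero := fun s =>
        Submodule.subset_span (GenZero.D (C := C) _ _ (cons_mem_Lam S s.2) (by simp))
      let w : S.Gam → C.T V := fun s => ⟨_, C.lie_mem_T (hz s) v.2⟩
      have hw : C.actT V (C.LI u r) v = w r - w 0 := by
        refine Subtype.ext ?_
        rw [coe_actT, AddSubgroupClass.coe_sub, ← sub_lie]
        congr 1
        exact Subtype.ext (C.coe_toTau_LI u r)
      have hm : ∀ s : S.Gam, (C.W V c).mkQ (w s) ∈ C.classPart V c μ := fun s =>
        (le_iSup (C.weightPart V c μ) (l + s)) (C.mkQ_mem_classPart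
          (C.hasDegree_D (u := Fin.cons 0 u) (r := Fin.cons 0 (s : Fin n → ℤ)) rfl) hv rfl)
      change (C.W V c).mkQ (C.actT V (C.LI u r) v) ∈ C.classPart V c μ
      rw [hw, map_sub]
      exact sub_mem (hm r) (hm 0)
  · refine iSup_le fun l => ?_
    rintro _ ⟨v, hv, rfl⟩
    exact (le_iSup (C.weightPart V c μ) (l + q)) (C.mkQ_mem_classPart
      (C.hasDegree_K (u := Fin.cons 0 u) (r := Fin.cons 0 (q : Fin n → ℤ)) rfl) hv
      (C.coe_centralT V u q v))

variable {V} in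
/-- `T` is the sum of its weight spaces. -/
theorem exists_weight_decomposition (hint : C.IsIntegrable V) (v : C.T V) :
    ∃ (s : Finset C.Weight) (f : C.Weight → C.T V),
      (∀ μ, (f μ : V) ∈ C.weightSpace V μ) ∧ v = ∑ μ ∈ s, f μ := by
  classical
  have hv : (v : V) ∈ ⨆ μ, C.weightSpace V μ := by rw [hint.span]; exact Submodule.mem_top
  obtain ⟨f, hf, hfv⟩ := (Submodule.mem_iSup_iff_exists_finsupp _ _).1 hv
  have hT : ∀ μ, f μ ∈ C.T V := by
    intro μ
    rw [mem_T_iff]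
    intro x hx
    obtain ⟨x', hx', α, a, hdeg⟩ := C.exists_hasDegree_of_genPlus hx
    obtain rfl : x' = x := Subtype.ext hx'
    by_cases hμ : μ ∈ f.support
    -- A homogeneous element sends different weight spaces to different weight spaces, so from `x v
    -- = 0` it kills each component of `v`.
    · refine eq_zero_of_finsupp_sum_eq_zero (hint.indep.comp (add_left_injective (α, 0, a)))
        f.support (fun ν => ⁅x', f ν⁆) (fun ν _ => C.lie_mem_weightSpace hdeg (hf ν)) ?_ hμ
      have h1 := (C.mem_T_iff _).1 v.2 x' hx
      rw [← hfv, Finsupp.sum] at h1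
      rw [← h1]
      exact (map_sum (LieModule.toEnd ℂ S.tau V x') _ _).symm
    · rw [Finsupp.notMem_support_iff.1 hμ, lie_zero]
  refine ⟨f.support, fun μ => ⟨f μ, hT μ⟩, hf, Subtype.ext ?_⟩
  rw [← hfv, Finsupp.sum, AddSubmonoidClass.coe_finsetSum]

theorem iSup_classPart (hint : C.IsIntegrable V) : ⨆ μ, C.classPart V c μ = ⊤ := by
  refine eq_top_iff.2 fun y _ => ?_
  obtain ⟨v, rfl⟩ := (C.W V c).mkQ_surjective y
  obtain ⟨s, f, hf, rfl⟩ := C.exists_weight_decomposition hint v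
  rw [map_sum]
  refine sum_mem fun μ _ => ?_
  refine (le_iSup (C.classPart V c) μ) ((le_iSup (C.weightPart V c μ) 0) ⟨f μ, ?_, rfl⟩)
  have h : μ + (0, 0, toC (Fin.cons 0 (0 : Fin n → ℤ))) = μ := by
    rw [cons_zero_zero, toC_zero]; simp
  rw [SetLike.mem_coe, Submodule.mem_comap, h]
  exact hf μ

/-- Every vector of `Ṽ` lies in a finite-dimensional stable subspace. -/
theorem exists_finiteDimensional_stable (hint : C.IsIntegrable V) (y : C.Vtilde V c) :
    ∃ G : Submodule ℂ (C.Vtilde V c), FiniteDimensional ℂ G ∧ C.IsStable V c G ∧ y ∈ G := by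
  have hy : y ∈ ⨆ μ, C.classPart V c μ := by rw [C.iSup_classPart V c hint]; exact Submodule.mem_top
  obtain ⟨s, hs⟩ := Submodule.mem_iSup_iff_exists_finset.1 hy
  have hfd := C.finiteDimensional_classPart V c hint.finite
  refine ⟨⨆ μ : s, C.classPart V c μ, inferInstance,
    C.isStable_iSup V c fun μ => C.isStable_classPart V c μ, ?_⟩
  rwa [iSup_subtype]

/-- An irreducible subspace of `Ṽ` lies in a finite-dimensional stable subspace. -/
theorem IsIrreducibleSub.exists_le (hint : C.IsIntegrable V) {M : Submodule ℂ (C.Vtilde V c)}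
    (hM : C.IsIrreducibleSub M) :
    ∃ G : Submodule ℂ (C.Vtilde V c), FiniteDimensional ℂ G ∧ C.IsStable V c G ∧ M ≤ G := by
  obtain ⟨y, hy, hy0⟩ := M.exists_mem_ne_zero_of_ne_bot hM.1
  obtain ⟨G, hG, hst, hyG⟩ := C.exists_finiteDimensional_stable V c hint y
  refine ⟨G, hG, hst, ?_⟩
  -- The intersection contains `y ≠ 0` and is stable, so irreducibility gives `M ⊓ G = M`.
  have := (hM.2.2 (M ⊓ G) inf_le_left fun x v hv => ⟨hM.2.1 x hv.1, hst.1 x hv.2⟩).resolve_left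
    ((Submodule.ne_bot_iff _).2 ⟨y, ⟨hy, hyG⟩, hy0⟩)
  exact inf_eq_left.1 this

end CartanData
end Twisted
end Toroidal

/-! ### Vanishing of the central terms on irreducible subspaces -/

namespace Toroidal
section Twisted
variable {𝔤 : Type*} [LieRing 𝔤] [LieAlgebra ℂ 𝔤] {n : ℕ} {S : TwistData 𝔤 n}
namespace CartanData
variable (C : CartanData S) [FiniteDimensional ℂ 𝔤] [LieAlgebra.IsSimple ℂ 𝔤]
variable {V : Type*} [AddCommGroup V] [Module ℂ V] [LieRingModule S.tau V] [LieModule ℂ S.tau V]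
variable {c : ℂ}

/-- The central elements `t^q ∑ uᵢ Kᵢ` act nilpotently on finite-dimensional stable subspaces. -/
theorem isNilpotent_central (hK : ∀ i ≠ 0, ∀ v : V, ⁅S.tK (Pi.single i 1) 0, v⁆ = 0)
    {G : Submodule ℂ (C.Vtilde V c)} [FiniteDimensional ℂ G] (hG : C.IsStable V c G)
    {Z : Module.End ℂ (C.Vtilde V c)} (hZ : Z ∈ C.centralSpanV V c) :
    ∃ h : ∀ v ∈ G, Z v ∈ G, IsNilpotent (Z.restrict h) := by
  -- Membership in the central span is carried through the induction, because the sum of two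
  -- nilpotents is handled by their commutativity.
  suffices h : ∃ h : ∀ v ∈ G, Z v ∈ G, IsNilpotent (Z.restrict h) ∧ Z ∈ C.centralSpanV V c from
    ⟨h.1, h.2.1⟩
  induction hZ using Submodule.span_induction with
  | zero =>
    refine ⟨fun v _ => zero_mem G, ⟨1, ?_⟩, zero_mem _⟩
    rw [pow_one]; rfl
  | add a b _ _ ha hb =>
    obtain ⟨ha, ha', ha''⟩ := ha
    obtain ⟨hb, hb', hb''⟩ := hb
    refine ⟨fun v hv => G.add_mem (ha v hv) (hb v hv), ?_, add_mem ha'' hb''⟩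
    have hcomm : Commute (a.restrict ha) (b.restrict hb) := by
      refine LinearMap.ext fun v => Subtype.ext ?_
      exact congrArg (fun f => f (v : C.Vtilde V c)) (C.central_commute V c ha'' hb'').eq
    exact hcomm.isNilpotent_add ha' hb'
  | smul d a _ ha =>
    obtain ⟨ha, ha', ha''⟩ := ha
    exact ⟨fun v hv => G.smul_mem d (ha v hv), ha'.smul d, Submodule.smul_mem _ d ha''⟩
  | mem z hz =>
    obtain ⟨u, q, rfl⟩ := hz
    refine ⟨fun v hv => hG.2 u q hv, ?_, Submodule.subset_span ⟨u, q, rfl⟩⟩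
    by_cases hq : (q : Fin n → ℤ) = 0
    · obtain rfl : q = 0 := Subtype.ext hq
      refine ⟨1, ?_⟩
      rw [pow_one]
      refine LinearMap.ext fun v => Subtype.ext ?_
      rw [LinearMap.restrict_apply]
      change C.centralV V c u 0 v = 0
      rw [C.centralV_zero V c hK]; rfl
    · obtain ⟨i, hi⟩ := Function.ne_iff.1 hq
      have hne : -pairing _ (q : Fin n → ℤ) (Pi.single i 1) ≠ 0 := by
        rw [pairing_single, neg_ne_zero]; exact_mod_cast hi
      -- For `q i ≠ 0` the operator `I(eᵢ,-q)` has the central operator as an eigenvector with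
      -- eigenvalue `-q i`.
      refine isNilpotent_of_lie_eq_smul
        (y := ((C.act V c (C.LI (Pi.single i 1) (-q))).restrict (p := G) (q := G)
          fun v hv => hG.1 _ hv : Module.End ℂ G)) hne ?_
      refine LinearMap.ext fun v => Subtype.ext ?_
      exact congrArg (fun f => f (v : C.Vtilde V c))
        (C.act_LI_lie_centralV V c hK (Pi.single i 1) u q)

variable {C}

theorem IsIrreducibleSub.nontrivial {M : Submodule ℂ (C.Vtilde V c)}
    (hM : C.IsIrreducibleSub M) : Nontrivial M :=
  Submodule.nontrivial_iff_ne_bot.2 hM.1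

/-- The operators of `L̃` on an irreducible subspace of `Ṽ`. -/
def IsIrreducibleSub.op {M : Submodule ℂ (C.Vtilde V c)} (hM : C.IsIrreducibleSub M)
    (x : C.Ltilde) : Module.End ℂ M := (C.act V c x).restrict fun _ hv => hM.2.1 x hv

theorem IsIrreducibleSub.coe_op {M : Submodule ℂ (C.Vtilde V c)} (hM : C.IsIrreducibleSub M)
    (x : C.Ltilde) (v : M) : (hM.op x v : C.Vtilde V c) = C.act V c x v := rfl

theorem IsIrreducibleSub.irr {M : Submodule ℂ (C.Vtilde V c)} (hM : C.IsIrreducibleSub M)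
    (N : Submodule ℂ M) (hN : ∀ x, N ≤ N.comap (hM.op x)) : N = ⊥ ∨ N = ⊤ := by
  rcases hM.2.2 (N.map M.subtype) (Submodule.map_subtype_le M N) (fun x => by
    rintro _ ⟨v, hv, rfl⟩
    exact ⟨hM.op x v, hN x hv, rfl⟩) with h | h
  · left
    exact Submodule.map_injective_of_injective M.injective_subtype
      (h.trans (Submodule.map_bot _).symm)
  · right
    refine eq_top_iff.2 fun v _ => ?_
    have : (v : C.Vtilde V c) ∈ N.map M.subtype := by rw [h]; exact v.2
    obtain ⟨w, hw, hw'⟩ := this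
    obtain rfl : w = v := Subtype.ext hw'
    exact hw

theorem IsIrreducibleSub.finiteDimensional (hint : C.IsIntegrable V)
    {M : Submodule ℂ (C.Vtilde V c)} (hM : C.IsIrreducibleSub M) : FiniteDimensional ℂ M := by
  obtain ⟨G, hG, -, hle⟩ := IsIrreducibleSub.exists_le C V c hint hM
  exact Submodule.finiteDimensional_of_le hle

/-- Central operators that preserve an irreducible subspace of `Ṽ` vanish on it. -/
theorem IsIrreducibleSub.central_eq_zero (hint : C.IsIntegrable V)
    (hK : ∀ i ≠ 0, ∀ v : V, ⁅S.tK (Pi.single i 1) 0, v⁆ = 0)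
    {M : Submodule ℂ (C.Vtilde V c)} (hM : C.IsIrreducibleSub M) {s : Module.End ℂ M}
    {Z : Module.End ℂ (C.Vtilde V c)} (hZ : Z ∈ C.centralSpanV V c)
    (hs : ∀ v : M, (s v : C.Vtilde V c) = Z v) : s = 0 := by
  obtain ⟨G, hG, hst, hle⟩ := IsIrreducibleSub.exists_le C V c hint hM
  have := hM.nontrivial
  have := hM.finiteDimensional hint
  -- A single `t^q Kᵢ` need not preserve `M`; the space collects the restrictions of those
  -- combinations that do. Nilpotency is therefore proved on the larger space `G` and then
  -- restricted.
  let A : Submodule ℂ (Module.End ℂ M) :=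
    { carrier := {s | ∃ Z ∈ C.centralSpanV V c, ∀ v : M, (s v : C.Vtilde V c) = Z v}
      zero_mem' := ⟨0, zero_mem _, fun v => rfl⟩
      add_mem' := by
        rintro s t ⟨Z, hZ, hs⟩ ⟨Y, hY, ht⟩
        refine ⟨Z + Y, add_mem hZ hY, fun v => ?_⟩
        rw [LinearMap.add_apply, LinearMap.add_apply, Submodule.coe_add, hs, ht]
      smul_mem' := by
        rintro d s ⟨Z, hZ, hs⟩
        refine ⟨d • Z, Submodule.smul_mem _ d hZ, fun v => ?_⟩
        rw [LinearMap.smul_apply, LinearMap.smul_apply, Submodule.coe_smul, hs] }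
  refine eq_zero_of_normalised (R := Set.range hM.op) A
    (fun N hN => hM.irr N fun x => hN _ ⟨x, rfl⟩) ?_ ?_ ?_ (s := s) ⟨Z, hZ, hs⟩
  · rintro s ⟨Z, hZ, hs⟩ t ⟨Y, hY, ht⟩
    refine LinearMap.ext fun v => Subtype.ext ?_
    rw [Module.End.mul_apply, Module.End.mul_apply, hs, ht, ht, hs]
    exact congrArg (fun f => f (v : C.Vtilde V c)) (C.central_commute V c hZ hY).eq
  · rintro s ⟨Z, hZ, hs⟩
    obtain ⟨hZG, k, hk⟩ := C.isNilpotent_central hK hst hZ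
    refine ⟨k, LinearMap.ext fun v => Subtype.ext ?_⟩
    have h1 : ∀ j : ℕ, (((s ^ j) v : M) : C.Vtilde V c) =
        (((Z.restrict hZG) ^ j) ⟨v, hle v.2⟩ : G) := fun j => by
      induction j with
      | zero => rfl
      | succ j ih =>
        rw [pow_succ', pow_succ', Module.End.mul_apply, Module.End.mul_apply, hs, ih]; rfl
    rw [h1, hk]; rfl
  · rintro _ ⟨x, rfl⟩ s ⟨Z, hZ, hs⟩
    refine ⟨⁅C.act V c x, Z⁆, C.act_lie_mem_centralSpanV V c x hZ, fun v => ?_⟩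
    change ((hM.op x (s v) - s (hM.op x v) : M) : C.Vtilde V c) =
      C.act V c x (Z v) - Z (C.act V c x v)
    rw [AddSubgroupClass.coe_sub, hM.coe_op, hs, hs, hM.coe_op]

/-- The action of `L̃` on an irreducible subspace of `Ṽ` is a representation. -/
def IsIrreducibleSub.rep (hint : C.IsIntegrable V)
    (hK : ∀ i ≠ 0, ∀ v : V, ⁅S.tK (Pi.single i 1) 0, v⁆ = 0)
    {M : Submodule ℂ (C.Vtilde V c)} (hM : C.IsIrreducibleSub M) :
    C.Ltilde →ₗ⁅ℂ⁆ Module.End ℂ M where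
  toFun := hM.op
  map_add' x y := by
    refine LinearMap.ext fun v => Subtype.ext ?_
    rw [hM.coe_op, map_add]; rfl
  map_smul' d x := by
    refine LinearMap.ext fun v => Subtype.ext ?_
    rw [hM.coe_op, map_smul]; rfl
  map_lie' {x y} := by
    -- The bracket defect preserves `M`, being made of operators of `L̃`, and lies in the central
    -- span; hence it is zero on `M`.
    refine (sub_eq_zero.1 (hM.central_eq_zero hint hK (C.act_defect V c x y) fun v => ?_)).symm
    rfl

end CartanData
end Twisted
end Toroidal

/-! ### Representations of L̃ as jet actions -/

namespace Toroidal

/-- The linear map on Laurent polynomials with given values on monomials. -/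
def Laurent.lin {n : ℕ} {W : Type*} [AddCommGroup W] [Module ℂ W] (F : (Fin n → ℤ) → W) :
    Laurent (Fin n) →ₗ[ℂ] W :=
  (Finsupp.lsum ℂ (fun r => LinearMap.toSpanSingleton ℂ W (F r)) :
    ((Fin n → ℤ) →₀ ℂ) →ₗ[ℂ] W) ∘ₗ
    (AddMonoidAlgebra.coeffLinearEquiv ℂ).toLinearMap

theorem Laurent.lin_mono {n : ℕ} {W : Type*} [AddCommGroup W] [Module ℂ W] (F : (Fin n → ℤ) → W)
    (r : Fin n → ℤ) : Laurent.lin F (mono r) = F r := by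
  have : Laurent.lin F (mono r) = (1 : ℂ) • F r :=
    Finsupp.lsum_single ℂ (fun r => LinearMap.toSpanSingleton ℂ W (F r)) r 1
  rw [this, one_smul]

/-- Linear maps on the summands of a direct sum decomposition extend to the sum. -/
theorem exists_linearMap_of_iSupIndep {ι E W : Type*} [AddCommGroup E] [Module ℂ E]
    [AddCommGroup W] [Module ℂ W] {p : ι → Submodule ℂ E} (hp : iSupIndep p) (htop : ⨆ i, p i = ⊤)
    (g : ∀ i, p i →ₗ[ℂ] W) : ∃ F : E →ₗ[ℂ] W, ∀ i (x : p i), F x = g i x := by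
  classical
  have hint := DirectSum.isInternal_submodule_of_iSupIndep_of_iSup_eq_top hp htop
  let e := LinearEquiv.ofBijective (DirectSum.coeLinearMap p) hint
  refine ⟨DirectSum.toModule ℂ ι W g ∘ₗ e.symm.toLinearMap, fun i x => ?_⟩
  have h : e.symm (x : E) = DirectSum.lof ℂ ι (fun i => p i) i x := by
    rw [LinearEquiv.symm_apply_eq]
    exact (DirectSum.coeLinearMap_lof p i x).symm
  rw [LinearMap.comp_apply, LinearEquiv.coe_coe, h, DirectSum.toModule_lof]

/-- Commuting automorphisms of finite orders are simultaneously diagonalizable. -/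
theorem iSupIndep_iInf_eigenspace {ι E : Type*} [AddCommGroup E] [Module ℂ E]
    [FiniteDimensional ℂ E] (f : ι → Module.End ℂ E) (m : ι → ℕ) (hm : ∀ i, 0 < m i)
    (hf : ∀ i, f i ^ m i = 1) (hcomm : ∀ i j, Commute (f i) (f j)) :
    iSupIndep (fun χ : ι → ℂ => ⨅ i, (f i).eigenspace (χ i)) ∧
      ⨆ χ : ι → ℂ, ⨅ i, (f i).eigenspace (χ i) = ⊤ := by
  have hss : ∀ i, (f i).IsSemisimple := fun i => by
    -- An operator of finite order is killed by the separable polynomial `X^m - 1`.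
    refine Module.End.isSemisimple_of_squarefree_aeval_eq_zero (p := Polynomial.X ^ m i - 1) ?_ ?_
    · exact ((Polynomial.X_pow_sub_one_separable_iff).2
        (by exact_mod_cast (hm i).ne')).squarefree
    · simp [hf]
  have heq : ∀ i μ, (f i).maxGenEigenspace μ = (f i).eigenspace μ := fun i μ =>
    (hss i).isFinitelySemisimple.maxGenEigenspace_eq_eigenspace μ
  simp only [← heq]
  exact ⟨Module.End.independent_iInf_maxGenEigenspace_of_forall_mapsTo f
    fun i j φ => Module.End.mapsTo_maxGenEigenspace_of_comm (hcomm j i) φ,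
    Module.End.iSup_iInf_maxGenEigenspace_eq_top_of_iSup_maxGenEigenspace_eq_top_of_commute f
      (fun i j _ => hcomm i j) fun i => Module.End.iSup_maxGenEigenspace_eq_top _⟩

section Twisted
variable {𝔤 : Type*} [LieRing 𝔤] [LieAlgebra ℂ 𝔤] {n : ℕ} {S : TwistData 𝔤 n}

namespace TwistData

variable (S) in
/-- The element `(m₁ r₁, …, mₙ rₙ)` of `Γ`. -/
def dil : (Fin n → ℤ) →+ S.Gam where
  toFun r := ⟨fun i => S.m i.succ * r i, fun _ => dvd_mul_right _ _⟩
  map_zero' := Subtype.ext (funext fun _ => mul_zero _)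
  map_add' _ _ := Subtype.ext (funext fun _ => mul_add _ _ _)

theorem dil_surjective : Function.Surjective (dil S) := fun r => by
  choose a ha using r.2
  exact ⟨a, Subtype.ext (funext fun i => (ha i).symm)⟩

theorem m_ne_zero (i : Fin (n + 1)) : (S.m i : ℂ) ≠ 0 := by exact_mod_cast (S.m_pos i).ne'

variable (S) in
/-- The vector `(u₁ / m₁, …, uₙ / mₙ)`. -/
def rescale : (Fin n → ℂ) →ₗ[ℂ] Fin n → ℂ where
  toFun u i := u i * (S.m i.succ : ℂ)⁻¹
  map_add' _ _ := funext fun _ => add_mul _ _ _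
  map_smul' _ _ := funext fun _ => mul_assoc _ _ _

theorem rescale_surjective : Function.Surjective (rescale S) := fun u =>
  ⟨fun i => u i * S.m i.succ, funext fun _ => mul_inv_cancel_right₀ (m_ne_zero _) _⟩

/-- In the coordinates `xᵢ = tᵢ^{mᵢ}` exponents are divided by `mᵢ` and `tᵢ ∂/∂tᵢ = mᵢ xᵢ ∂/∂xᵢ`;
the two rescalings preserve the pairing, so the untwisted relations apply. -/
theorem pairing_dil_rescale (r : Fin n → ℤ) (u : Fin n → ℂ) :
    pairing _ (dil S r : Fin n → ℤ) (rescale S u) = pairing _ r u := by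
  rw [pairing_apply, pairing_apply]
  refine Finset.sum_congr rfl fun i _ => ?_
  change ((S.m i.succ * r i : ℤ) : ℂ) * (u i * (S.m i.succ : ℂ)⁻¹) = r i * u i
  have := m_ne_zero (S := S) i.succ
  push_cast
  field_simp

end TwistData

namespace CartanData
open TwistData
variable (C : CartanData S)

theorem LI_zero (u : Fin n → ℂ) : C.LI u 0 = 0 := Subtype.ext (sub_self _)

theorem LI_add (u v : Fin n → ℂ) (r : S.Gam) : C.LI (u + v) r = C.LI u r + C.LI v r := by
  refine Subtype.ext ?_
  change elI 𝔤 (u + v) r = elI 𝔤 u r + elI 𝔤 v r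
  simp only [elI, LoopDer.D, vf_add, map_add]
  abel

theorem LI_smul (d : ℂ) (u : Fin n → ℂ) (r : S.Gam) : C.LI (d • u) r = d • C.LI u r := by
  refine Subtype.ext ?_
  change elI 𝔤 (d • u) r = d • elI 𝔤 u r
  simp only [elI, LoopDer.D, vf_smul, map_smul, smul_sub]

theorem LX_add (k : Fin n → ℤ) (x y : C.gcircComp k) : C.LX k (x + y) = C.LX k x + C.LX k y := by
  refine Subtype.ext ?_
  change LoopDer.X (((x : C.gcirc) : 𝔤) + ((y : C.gcirc) : 𝔤)) k = LoopDer.X _ k + LoopDer.X _ k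
  simp only [LoopDer.X, lp, TensorProduct.tmul_add, map_add]

theorem LX_smul (k : Fin n → ℤ) (d : ℂ) (x : C.gcircComp k) : C.LX k (d • x) = d • C.LX k x := by
  refine Subtype.ext ?_
  change LoopDer.X (d • ((x : C.gcirc) : 𝔤)) k = d • LoopDer.X _ k
  simp only [LoopDer.X, lp, TensorProduct.tmul_smul, map_smul]

variable {C} {M : Type*} [AddCommGroup M] [Module ℂ M]

/-- The operators `I(u, r)`, as functions of Laurent polynomials in `tᵢ^{mᵢ}`. -/
def laurentI (Φ : C.Ltilde →ₗ⁅ℂ⁆ Module.End ℂ M) (u : Fin n → ℂ) :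
    Laurent (Fin n) →ₗ[ℂ] Module.End ℂ M :=
  Laurent.lin fun r => Φ (C.LI (rescale S u) (dil S r))

/-- The operators `X(k + r)`, as functions of Laurent polynomials in `tᵢ^{mᵢ}`. -/
def laurentX (Φ : C.Ltilde →ₗ⁅ℂ⁆ Module.End ℂ M) (a : Σ k, C.gcircComp k) :
    Laurent (Fin n) →ₗ[ℂ] Module.End ℂ M :=
  Laurent.lin fun r => Φ (C.LXs a.1 a.2 (dil S r))

theorem laurentI_mono (Φ : C.Ltilde →ₗ⁅ℂ⁆ Module.End ℂ M) (u : Fin n → ℂ) (r : Fin n → ℤ) :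
    laurentI Φ u (mono r) = Φ (C.LI (rescale S u) (dil S r)) := Laurent.lin_mono _ _

theorem laurentX_mono (Φ : C.Ltilde →ₗ⁅ℂ⁆ Module.End ℂ M) (a : Σ k, C.gcircComp k)
    (r : Fin n → ℤ) : laurentX Φ a (mono r) = Φ (C.LXs a.1 a.2 (dil S r)) := Laurent.lin_mono _ _

theorem laurentI_one (Φ : C.Ltilde →ₗ⁅ℂ⁆ Module.End ℂ M) (u : Fin n → ℂ) : laurentI Φ u 1 = 0 := by
  rw [← mono_zero, laurentI_mono, map_zero, LI_zero, map_zero]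

/-- Since `laurentI` kills constants, `I(u,r)` is its value at `x^r - 1`. By bilinearity it suffices
to check these elements, which span the augmentation ideal. -/
theorem laurentI_lie_laurentI (Φ : C.Ltilde →ₗ⁅ℂ⁆ Module.End ℂ M) (u v : Fin n → ℂ)
    {f g : Laurent (Fin n)} (hf : f ∈ augIdeal n) (hg : g ∈ augIdeal n) :
    ⁅laurentI Φ u f, laurentI Φ v g⁆ =
      laurentI Φ v (f * dd u g) - laurentI Φ u (g * dd v f) := by
  refine augIdeal_ind (p := fun f => ⁅laurentI Φ u f, laurentI Φ v g⁆ =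
      laurentI Φ v (f * dd u g) - laurentI Φ u (g * dd v f)) hf (by simp)
    (fun f f' h h' => by
      rw [map_add, add_lie, h, h', add_mul, map_add, map_add, mul_add, map_add]; abel)
    fun c r => ?_
  simp only [map_smul, smul_lie, smul_mul_assoc, mul_smul_comm, ← smul_sub]
  congr 1
  refine augIdeal_ind (p := fun g => ⁅laurentI Φ u (mono r - 1), laurentI Φ v g⁆ =
      laurentI Φ v ((mono r - 1) * dd u g) - laurentI Φ u (g * dd v (mono r - 1))) hg (by simp)
    (fun f f' h h' => by
      rw [map_add, lie_add, h, h', add_mul, map_add, map_add, mul_add, map_add]; abel)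
    fun c s => ?_
  simp only [map_smul, lie_smul, smul_mul_assoc, mul_smul_comm, ← smul_sub]
  congr 1
  simp only [map_smul, map_sub, laurentI_one, sub_zero, dd_one, laurentI_mono,
    ← LieHom.map_lie, LI_lie_LI, pairing_dil_rescale, dd_mono, mul_smul_comm,
    sub_mul, one_mul, ← mono_add, map_add, add_comm s r]

/-- The degree `k` of `X(k)` need not lie in `Γ`; in the coordinates `xᵢ` it becomes the fractional
shift `kᵢ / mᵢ` in the derivation. -/
theorem laurentI_lie_laurentX (Φ : C.Ltilde →ₗ⁅ℂ⁆ Module.End ℂ M) (u : Fin n → ℂ)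
    (a : Σ k, C.gcircComp k) {f : Laurent (Fin n)} (hf : f ∈ augIdeal n) (g : Laurent (Fin n)) :
    ⁅laurentI Φ u f, laurentX Φ a g⁆ = laurentX Φ a
      (f * (dd u g + (u ⬝ᵥ fun i => (a.1 i : ℂ) * (S.m i.succ : ℂ)⁻¹) • g)) := by
  have hp : ∀ s : Fin n → ℤ, pairing _ (a.1 + (dil S s : Fin n → ℤ)) (rescale S u) =
      pairing _ s u + u ⬝ᵥ fun i => (a.1 i : ℂ) * (S.m i.succ : ℂ)⁻¹ := fun s => by
    rw [pairing_add, pairing_dil_rescale, add_comm, pairing_apply, pairing_apply]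
    congr 1
    refine Finset.sum_congr rfl fun i _ => ?_
    change _ * (u i * _) = u i * (_ * _)
    ring
  set b := u ⬝ᵥ fun i => (a.1 i : ℂ) * (S.m i.succ : ℂ)⁻¹
  refine augIdeal_ind (p := fun f => ⁅laurentI Φ u f, laurentX Φ a g⁆ =
      laurentX Φ a (f * (dd u g + b • g))) hf (by simp)
    (fun f f' h h' => by rw [map_add, add_lie, h, h', add_mul, map_add])
    fun c r => ?_
  rw [map_smul, smul_lie, smul_mul_assoc, map_smul]
  congr 1
  induction g using Laurent.ind with
  | h0 => simp
  | ha f f' h h' =>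
    rw [map_add, lie_add, h, h', ← map_add, ← mul_add, map_add]
    congr 2
    module
  | hs e s =>
    simp only [map_smul, lie_smul, map_sub, laurentI_one, sub_zero, laurentI_mono, laurentX_mono,
      ← LieHom.map_lie, LI_lie_LXs, hp, dd_mono, mul_smul_comm,
      mul_add, sub_mul, one_mul, ← mono_add, map_add]
    module

/-- An irreducible representation of `L̃`, seen as a family of operators depending on Laurent
polynomials in `tᵢ^{mᵢ}`. -/
def jetAction {Φ : C.Ltilde →ₗ⁅ℂ⁆ Module.End ℂ M} (hΦ : IsIrreducibleAction Φ) :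
    JetAction n (Σ k, C.gcircComp k) M where
  P :=
    { toFun := laurentI Φ
      map_add' := fun u v => Laurent.hom_ext fun r => by
        rw [LinearMap.add_apply, laurentI_mono, laurentI_mono, laurentI_mono, map_add,
          LI_add, map_add]
      map_smul' := fun d u => Laurent.hom_ext fun r => by
        rw [LinearMap.smul_apply, laurentI_mono, laurentI_mono, map_smul, LI_smul, map_smul,
          RingHom.id_apply] }
  Q := laurentX Φ
  s a i := (a.1 i : ℂ) * (S.m i.succ : ℂ)⁻¹
  bracket a b := ⟨a.1 + b.1, C.gcircBracket a.2 b.2⟩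
  PP u v _ hf _ hg := laurentI_lie_laurentI Φ u v hf hg
  PQ u a _ hf g := laurentI_lie_laurentX Φ u a hf g
  QQ a b f g := by
    induction f using Laurent.ind with
    | h0 => simp
    | ha f f' h h' => rw [map_add, add_lie, h, h', add_mul, map_add]
    | hs d r =>
      induction g using Laurent.ind with
      | h0 => simp
      | ha f f' h h' => rw [map_add, lie_add, h, h', mul_add, map_add]
      | hs e s =>
        simp only [map_smul, smul_lie, lie_smul, laurentX_mono, ← LieHom.map_lie, LXs_lie_LXs,
          smul_mul_assoc, mul_smul_comm, ← mono_add, map_add]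
  irr N hP hQ := by
    refine hΦ.2 N fun x => ?_
    induction x using C.Ltilde_ind with
    | h0 => rw [map_zero]; exact fun v _ => N.zero_mem
    | ha x y hx hy => rw [map_add]; exact fun v hv => N.add_mem (hx hv) (hy hv)
    | hs d x hx => rw [map_smul]; exact fun v hv => N.smul_mem d (hx hv)
    | hX k x =>
      have h := hQ ⟨k, x⟩ (mono 0)
      rwa [laurentX_mono, map_zero, LXs_zero] at h
    | hI u r =>
      obtain ⟨u, rfl⟩ := rescale_surjective (S := S) u
      obtain ⟨r, rfl⟩ := dil_surjective (S := S) r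
      have h := hP u _ (mono_sub_one_mem r)
      change N ≤ N.comap (laurentI Φ u (mono r - 1)) at h
      rwa [map_sub, laurentI_one, sub_zero, laurentI_mono] at h

theorem jetAction_P {Φ : C.Ltilde →ₗ⁅ℂ⁆ Module.End ℂ M} (hΦ : IsIrreducibleAction Φ)
    (u : Fin n → ℂ) (r : Fin n → ℤ) :
    (jetAction hΦ).P u (mono r) = Φ (C.LI (rescale S u) (dil S r)) := Laurent.lin_mono _ _

theorem jetAction_Q {Φ : C.Ltilde →ₗ⁅ℂ⁆ Module.End ℂ M} (hΦ : IsIrreducibleAction Φ)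
    (k : Fin n → ℤ) (x : C.gcircComp k) (r : Fin n → ℤ) :
    (jetAction hΦ).Q ⟨k, x⟩ (mono r) = Φ (C.LXs k x (dil S r)) := Laurent.lin_mono _ _

variable [FiniteDimensional ℂ M] {Φ : C.Ltilde →ₗ⁅ℂ⁆ Module.End ℂ M}

/-- The difference is the value of `Q` at `x^r - 1 ∈ 𝔪`, which vanishes. -/
theorem map_LXs_eq (hΦ : IsIrreducibleAction Φ) (k : Fin n → ℤ) (x : C.gcircComp k) (r : S.Gam) :
    Φ (C.LXs k x r) = Φ (C.LX k x) := by
  have := hΦ.1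
  obtain ⟨r, rfl⟩ := dil_surjective (S := S) r
  have h := (jetAction hΦ).vanishesAt_one.2 ⟨k, x⟩ _
    (by rw [pow_one]; exact mono_sub_one_mem r)
  rw [map_sub, ← mono_zero, jetAction_Q, jetAction_Q, map_zero, LXs_zero, sub_eq_zero] at h
  exact h

/-- The defect of additivity in `r` is the value of `P` at `(x^r - 1)(x^s - 1) ∈ 𝔪²`, which
vanishes. -/
theorem map_LI_add (hΦ : IsIrreducibleAction Φ) (u : Fin n → ℂ) (r s : S.Gam) :
    Φ (C.LI u (r + s)) = Φ (C.LI u r) + Φ (C.LI u s) := by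
  have := hΦ.1
  obtain ⟨u, rfl⟩ := rescale_surjective (S := S) u
  obtain ⟨r, rfl⟩ := dil_surjective (S := S) r
  obtain ⟨s, rfl⟩ := dil_surjective (S := S) s
  have h := (jetAction hΦ).vanishesAt_one.1 u ((mono r - 1) * (mono s - 1)) (by
    rw [one_add_one_eq_two, pow_two]
    exact Ideal.mul_mem_mul (mono_sub_one_mem r) (mono_sub_one_mem s))
  rw [show (mono r - 1) * (mono s - 1 : Laurent (Fin n)) =
    mono (r + s) - mono r - (mono s - mono 0) by rw [mono_add, mono_zero]; ring, map_sub, map_sub,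
    map_sub, jetAction_P, jetAction_P, jetAction_P, jetAction_P, map_zero, LI_zero, map_zero,
    sub_zero, sub_sub, sub_eq_zero, map_add] at h
  exact h

/-- `I₂ ⊕ F₁` acts trivially in an irreducible finite-dimensional representation. -/
theorem map_eq_zero_of_mem (hΦ : IsIrreducibleAction Φ) (x : C.Ltilde)
    (hx : (x : LoopDer (Fin n) 𝔤) ∈ idealI S 2 ⊔ C.idealF 1) : Φ x = 0 := by
  have hle : idealI S 2 ⊔ C.idealF 1 ≤
      (LinearMap.ker (Φ : C.Ltilde →ₗ[ℂ] Module.End ℂ M)).map C.Ltilde.toSubmodule.subtype := by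
    refine sup_le (Submodule.span_le.2 ?_) (Submodule.span_le.2 ?_)
    · rintro _ ⟨u, r, s, rfl⟩
      have huniv : (Finset.univ : Finset (Finset (Fin 2))) = {∅, {0}, {1}, {0, 1}} := by decide
      -- The four terms are the alternating sum over the subsets of a two-element set; additivity in
      -- the exponent makes it cancel.
      refine ⟨C.LI u r - C.LI u (r + s 0) - (C.LI u (r + s 1) - C.LI u (r + (s 0 + s 1))),
        LinearMap.mem_ker.2 ?_, ?_⟩
      · change Φ _ = 0
        simp only [map_sub, map_LI_add hΦ]
        abel
      · rw [huniv, Finset.sum_insert (by decide), Finset.sum_insert (by decide),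
          Finset.sum_insert (by decide), Finset.sum_singleton]
        simp only [Finset.card_empty, Finset.card_singleton, Finset.sum_empty,
          Finset.sum_singleton, Finset.sum_pair (show (0 : Fin 2) ≠ 1 by decide),
          Finset.card_pair (show (0 : Fin 2) ≠ 1 by decide), pow_zero, pow_one, add_zero, one_smul]
        change elI 𝔤 u (r : Fin n → ℤ) - elI 𝔤 u ((r : Fin n → ℤ) + (s 0 : Fin n → ℤ)) -
          (elI 𝔤 u ((r : Fin n → ℤ) + (s 1 : Fin n → ℤ)) -
            elI 𝔤 u ((r : Fin n → ℤ) + ((s 0 : Fin n → ℤ) + (s 1 : Fin n → ℤ)))) = _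
        module
    · rintro _ ⟨k, x, r, rfl⟩
      have huniv : (Finset.univ : Finset (Finset (Fin 1))) = {∅, {0}} := by decide
      refine ⟨C.LXs k x 0 - C.LXs k x (r 0), LinearMap.mem_ker.2 ?_, ?_⟩
      · change Φ _ = 0
        rw [map_sub, map_LXs_eq hΦ, map_LXs_eq hΦ, sub_self]
      · rw [huniv, Finset.sum_insert (by decide), Finset.sum_singleton]
        simp only [Finset.card_empty, Finset.card_singleton, Finset.sum_empty,
          Finset.sum_singleton, pow_zero, pow_one, one_smul]
        change LoopDer.X ((x : C.gcirc) : 𝔤) (k + 0) -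
          LoopDer.X ((x : C.gcirc) : 𝔤) (k + (r 0 : Fin n → ℤ)) = _
        module
  obtain ⟨y, hy, hyx⟩ := hle hx
  obtain rfl : y = x := Subtype.ext hyx
  exact LinearMap.mem_ker.1 hy

end CartanData
end Twisted
end Toroidal

/-! ### Factorisation through 𝔤𝔩ₙ ⊕ 𝔤° -/

namespace Toroidal

section Twisted
variable {𝔤 : Type*} [LieRing 𝔤] [LieAlgebra ℂ 𝔤] {n : ℕ} {S : TwistData 𝔤 n}

namespace TwistData

theorem toC_dil (r : Fin n → ℤ) (i : Fin n) :
    toC (dil S r : Fin n → ℤ) i = S.m i.succ * r i := by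
  change ((S.m i.succ * r i : ℤ) : ℂ) = _
  push_cast
  rfl

variable (S) in
/-- Matrices are sums of matrices of rank one whose columns are multiples of elements of `Γ`. -/
theorem matrix_ind {p : Matrix (Fin n) (Fin n) ℂ → Prop} (A : Matrix (Fin n) (Fin n) ℂ)
    (h0 : p 0) (ha : ∀ A B, p A → p B → p (A + B))
    (hs : ∀ (r : S.Gam) u, p (Matrix.vecMulVec (toC (r : Fin n → ℤ)) u)) : p A := by
  have hA : A = ∑ i, Matrix.vecMulVec (toC (dil S (Pi.single i 1) : Fin n → ℤ))
      ((S.m i.succ : ℂ)⁻¹ • A i) := by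
    ext i j
    rw [Matrix.sum_apply, Finset.sum_eq_single i]
    · rw [Matrix.vecMulVec_apply, toC_dil, Pi.single_eq_same, Int.cast_one, mul_one,
        Pi.smul_apply, smul_eq_mul, mul_inv_cancel_left₀ (m_ne_zero _)]
    · intro k _ hk
      rw [Matrix.vecMulVec_apply, toC_dil, Pi.single_eq_of_ne hk.symm, Int.cast_zero, mul_zero,
        zero_mul]
    · exact fun h => (h (Finset.mem_univ i)).elim
  rw [hA]
  exact Finset.sum_induction _ p ha h0 fun i _ => hs _ _

end TwistData

namespace CartanData
open TwistData
variable {C : CartanData S} {M : Type*} [AddCommGroup M] [Module ℂ M]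

/-- The action of `𝔤𝔩ₙ`, given by that of the elements `I(u, mᵢ eᵢ)`. -/
def glPart (Φ : C.Ltilde →ₗ⁅ℂ⁆ Module.End ℂ M) :
    Matrix (Fin n) (Fin n) ℂ →ₗ[ℂ] Module.End ℂ M where
  toFun A := ∑ i, (S.m i.succ : ℂ)⁻¹ • Φ (C.LI (A i) (dil S (Pi.single i 1)))
  map_add' A B := by
    rw [← Finset.sum_add_distrib]
    refine Finset.sum_congr rfl fun i _ => ?_
    rw [← smul_add, ← map_add, ← LI_add]
    rfl
  map_smul' c A := by
    rw [Finset.smul_sum]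
    refine Finset.sum_congr rfl fun i _ => ?_
    rw [RingHom.id_apply, smul_comm c, ← map_smul Φ c, ← LI_smul]
    rfl

variable (C) in
/-- The restriction of `σᵢ` to `𝔤°`. -/
def gcircAut (i : Fin n) : Module.End ℂ C.gcirc :=
  LinearMap.restrict (p := C.gcirc.toSubmodule) (q := C.gcirc.toSubmodule)
    ((S.σ i.succ : 𝔤 →ₗ⁅ℂ⁆ 𝔤) : 𝔤 →ₗ[ℂ] 𝔤) fun x hx => by
      refine ⟨?_, fun h hh => ?_⟩
      · change S.σ 0 (S.σ i.succ x) = S.σ i.succ x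
        rw [S.comm, hx.1]
      · change ⁅h, S.σ i.succ x⁆ = 0
        -- The automorphisms fix `𝔥(0)` pointwise, so they preserve its centraliser.
        have h1 : S.σ i.succ h = h := (C.h0_le hh i.succ).trans (by simp)
        rw [← h1, ← LieEquiv.map_lie, hx.2 h hh, map_zero]

theorem coe_gcircAut (i : Fin n) (x : C.gcirc) :
    (C.gcircAut i x : 𝔤) = S.σ i.succ (x : 𝔤) := rfl

theorem gcircAut_pow (i : Fin n) : C.gcircAut i ^ S.m i.succ = 1 := by
  refine LinearMap.ext fun x => Subtype.ext ?_
  have h : ∀ k, ((C.gcircAut i ^ k) x : 𝔤) =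
      ((((S.σ i.succ : 𝔤 →ₗ⁅ℂ⁆ 𝔤) : 𝔤 →ₗ[ℂ] 𝔤) : Module.End ℂ 𝔤) ^ k) (x : 𝔤) := fun k => by
    induction k with
    | zero => rfl
    | succ k ih =>
      rw [pow_succ', pow_succ', Module.End.mul_apply, Module.End.mul_apply, coe_gcircAut, ih]
      rfl
  rw [h, ← S.order, pow_orderOf_eq_one]
  rfl

theorem gcircAut_commute (i j : Fin n) : Commute (C.gcircAut i) (C.gcircAut j) :=
  LinearMap.ext fun x => Subtype.ext (S.comm i.succ j.succ x)

theorem gcircComp_eq (k : Fin n → ℤ) :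
    C.gcircComp k = ⨅ i, (C.gcircAut i).eigenspace (S.ξ i.succ ^ k i) := by
  ext x
  rw [Submodule.mem_iInf]
  refine forall_congr' fun i => ?_
  rw [Module.End.mem_eigenspace_iff, Subtype.ext_iff]
  rfl

/-- Joint eigenspaces of `σ₁, …, σₙ` on `𝔤°` are graded components. -/
theorem exists_gcircComp_of_ne_bot {χ : Fin n → ℂ}
    (h : ⨅ i, (C.gcircAut i).eigenspace (χ i) ≠ ⊥) :
    ∃ k : Fin n → ℤ, ⨅ i, (C.gcircAut i).eigenspace (χ i) = C.gcircComp k := by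
  obtain ⟨x, hx, hx0⟩ := Submodule.exists_mem_ne_zero_of_ne_bot h
  rw [Submodule.mem_iInf] at hx
  have hroot : ∀ i, ∃ k : ℤ, χ i = S.ξ i.succ ^ k := fun i => by
    -- The `mᵢ`-th power of the automorphism is the identity, so the eigenvalue is an `mᵢ`-th root
    -- of unity, hence a power of the primitive root `ξᵢ`.
    have h1 : ∀ k, (C.gcircAut i ^ k) x = χ i ^ k • x := fun k => by
      induction k with
      | zero => simp
      | succ k ih =>
        rw [pow_succ', Module.End.mul_apply, ih, map_smul,
          Module.End.mem_eigenspace_iff.1 (hx i), smul_smul, pow_succ]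
    have h2 := h1 (S.m i.succ)
    rw [gcircAut_pow, Module.End.one_apply, eq_comm, ← sub_eq_zero] at h2
    have h3 : (χ i ^ S.m i.succ - 1) • x = 0 := by rw [sub_smul, one_smul, h2]
    have h4 := sub_eq_zero.1 ((smul_eq_zero.1 h3).resolve_right hx0)
    have := NeZero.of_pos (S.m_pos i.succ)
    obtain ⟨k, -, hk⟩ := (S.prim i.succ).eq_pow_of_pow_eq_one h4
    exact ⟨k, by rw [zpow_natCast, hk]⟩
  choose k hk using hroot
  exact ⟨k, by rw [gcircComp_eq]; simp only [hk]⟩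

variable (C) in
/-- `LX` as a linear map. -/
def LXₗ (k : Fin n → ℤ) : C.gcircComp k →ₗ[ℂ] C.Ltilde where
  toFun := C.LX k
  map_add' := C.LX_add k
  map_smul' := C.LX_smul k

theorem iSup_gcircComp [FiniteDimensional ℂ 𝔤] : ⨆ k, C.gcircComp k = ⊤ := by
  have : FiniteDimensional ℂ C.gcirc := inferInstanceAs (FiniteDimensional ℂ C.gcirc.toSubmodule)
  rw [eq_top_iff, ← (iSupIndep_iInf_eigenspace C.gcircAut _ (fun i => S.m_pos i.succ) gcircAut_pow
    gcircAut_commute).2]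
  refine iSup_le fun χ => ?_
  by_cases h : ⨅ i, (C.gcircAut i).eigenspace (χ i) = ⊥
  · rw [h]; exact bot_le
  · obtain ⟨k, hk⟩ := exists_gcircComp_of_ne_bot h
    rw [hk]; exact le_iSup C.gcircComp k

theorem gcirc_ind [FiniteDimensional ℂ 𝔤] {p : C.gcirc → Prop} (x : C.gcirc) (h0 : p 0)
    (ha : ∀ x y, p x → p y → p (x + y)) (hs : ∀ (k : Fin n → ℤ) (x : C.gcircComp k), p x) :
    p x := by
  have hx : x ∈ ⨆ k, C.gcircComp k := by rw [iSup_gcircComp]; exact Submodule.mem_top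
  exact Submodule.iSup_induction _ (motive := p) hx (fun k x hx => hs k ⟨x, hx⟩) h0 ha

theorem sub_mem_Gam {k l : Fin n → ℤ} (h : ∀ i, S.ξ i.succ ^ k i = S.ξ i.succ ^ l i) :
    l - k ∈ S.Gam := fun i => by
  rw [← (S.prim i.succ).zpow_eq_one_iff_dvd, Pi.sub_apply, zpow_sub₀ (S.ξ_ne_zero _), h i,
    div_self (zpow_ne_zero _ (S.ξ_ne_zero _))]

variable [FiniteDimensional ℂ M] {Φ : C.Ltilde →ₗ⁅ℂ⁆ Module.End ℂ M}

theorem map_LI_dil (hΦ : IsIrreducibleAction Φ) (u : Fin n → ℂ) (r : Fin n → ℤ) :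
    Φ (C.LI u (dil S r)) = ∑ i, r i • Φ (C.LI u (dil S (Pi.single i 1))) := by
  let φ : (Fin n → ℤ) →+ Module.End ℂ M :=
    { toFun := fun r => Φ (C.LI u (dil S r))
      map_zero' := by rw [map_zero, LI_zero, map_zero]
      map_add' := fun r s => by rw [map_add, map_LI_add hΦ] }
  change φ r = (∑ i, r i • φ (Pi.single i 1) : Module.End ℂ M)
  have hr : r = ∑ i, r i • (Pi.single i 1 : Fin n → ℤ) := pi_eq_sum_univ' r
  conv_lhs => rw [hr]
  simp only [map_sum, map_zsmul]

/-- `I(u,r)` is additive in `r` by `map_LI_add`, so its operator is determined by the values at `r =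
mᵢ eᵢ` that define `glPart`. -/
theorem glPart_vecMulVec (hΦ : IsIrreducibleAction Φ) (u : Fin n → ℂ) (r : S.Gam) :
    glPart Φ (Matrix.vecMulVec (toC (r : Fin n → ℤ)) u) = Φ (C.LI u r) := by
  obtain ⟨r, rfl⟩ := dil_surjective (S := S) r
  rw [map_LI_dil hΦ]
  change ∑ i, (S.m i.succ : ℂ)⁻¹ • Φ (C.LI
    (Matrix.vecMulVec (toC (dil S r : Fin n → ℤ)) u i) (dil S (Pi.single i 1))) = _
  refine Finset.sum_congr rfl fun i _ => ?_
  have h : Matrix.vecMulVec (toC (dil S r : Fin n → ℤ)) u i = ((S.m i.succ : ℂ) * r i) • u := by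
    ext j
    rw [Matrix.vecMulVec_apply, toC_dil, Pi.smul_apply, smul_eq_mul]
  rw [h, LI_smul, map_smul, smul_smul, inv_mul_cancel_left₀ (m_ne_zero _), Int.cast_smul_eq_zsmul]

/-- On rank-one matrices the product is `(r uᵀ)(s vᵀ) = (u,s) r vᵀ`. This matches the bracket of
`I(u,r)` and `I(v,s)`, where additivity turns `I(v,r+s) - I(v,s)` into `I(v,r)`. -/
theorem glPart_lie (hΦ : IsIrreducibleAction Φ) (A B : Matrix (Fin n) (Fin n) ℂ) :
    glPart Φ ⁅A, B⁆ = ⁅glPart Φ A, glPart Φ B⁆ := by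
  induction A using matrix_ind S with
  | h0 => simp
  | ha A A' h h' => rw [add_lie, map_add, map_add, add_lie, h, h']
  | hs r u =>
    induction B using matrix_ind S with
    | h0 => simp
    | ha A A' h h' => rw [lie_add, map_add, map_add, lie_add, h, h']
    | hs s v =>
      rw [Ring.lie_def, Matrix.vecMulVec_mul_vecMulVec, Matrix.vecMulVec_mul_vecMulVec,
        dotProduct_toC, dotProduct_toC, map_sub, Matrix.vecMulVec_smul, Matrix.vecMulVec_smul,
        map_smul, map_smul, glPart_vecMulVec hΦ, glPart_vecMulVec hΦ, glPart_vecMulVec hΦ,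
        glPart_vecMulVec hΦ, ← LieHom.map_lie, LI_lie_LI]
      simp only [map_sub, map_smul, map_LI_add hΦ, add_sub_cancel_right, add_sub_cancel_left]

/-- By `map_LXs_eq` the operator of `X(k)` depends only on `X` and `k` modulo `Γ`, and the residue
is recorded by the joint eigenvalues. The decomposition is indexed by eigenvalue tuples because the
family indexed by `k` repeats each component and is not independent. -/
theorem exists_gcircPart [FiniteDimensional ℂ 𝔤] (hΦ : IsIrreducibleAction Φ) :
    ∃ F : C.gcirc →ₗ[ℂ] Module.End ℂ M, ∀ k (x : C.gcircComp k),
      F (x : C.gcirc) = Φ (C.LX k x) := by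
  classical
  have : FiniteDimensional ℂ C.gcirc := inferInstanceAs (FiniteDimensional ℂ C.gcirc.toSubmodule)
  obtain ⟨hind, htop⟩ := iSupIndep_iInf_eigenspace C.gcircAut _ (fun i => S.m_pos i.succ)
    gcircAut_pow gcircAut_commute
  have hg : ∀ χ : Fin n → ℂ,
      ∃ g : (⨅ i, (C.gcircAut i).eigenspace (χ i) : Submodule ℂ C.gcirc) →ₗ[ℂ] Module.End ℂ M,
      ∀ (k : Fin n → ℤ) (x : (⨅ i, (C.gcircAut i).eigenspace (χ i) : Submodule ℂ C.gcirc))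
        (hx : (x : C.gcirc) ∈ C.gcircComp k), (∀ i, χ i = S.ξ i.succ ^ k i) →
        g x = Φ (C.LX k ⟨x, hx⟩) := by
    intro χ
    by_cases h : ∃ l : Fin n → ℤ, ∀ i, χ i = S.ξ i.succ ^ l i
    · obtain ⟨l, hl⟩ := h
      refine ⟨(Φ : C.Ltilde →ₗ[ℂ] Module.End ℂ M) ∘ₗ C.LXₗ l ∘ₗ Submodule.inclusion
        (by rw [gcircComp_eq]; simp only [hl]; exact le_rfl), fun k x hx hk => ?_⟩
      -- Two exponents giving the same eigenvalues differ by an element of `Γ`, so the choice of `l`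
      -- is immaterial.
      have hr := sub_mem_Gam (S := S) fun i => (hk i).symm.trans (hl i)
      rw [← map_LXs_eq hΦ k ⟨x, hx⟩ ⟨l - k, hr⟩]
      refine congrArg Φ (Subtype.ext ?_)
      change LoopDer.X ((x : C.gcirc) : 𝔤) l = LoopDer.X ((x : C.gcirc) : 𝔤) (k + (l - k))
      rw [add_sub_cancel]
    · exact ⟨0, fun k x hx hk => (h ⟨k, hk⟩).elim⟩
  choose g hg using hg
  obtain ⟨F, hF⟩ := exists_linearMap_of_iSupIndep hind htop g
  refine ⟨F, fun k x => ?_⟩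
  have hx : (x : C.gcirc) ∈ (⨅ i, (C.gcircAut i).eigenspace (S.ξ i.succ ^ k i) :
      Submodule ℂ C.gcirc) := by rw [← gcircComp_eq]; exact x.2
  rw [hF (fun i => S.ξ i.succ ^ k i) ⟨x, hx⟩, hg _ k _ x.2 fun i => rfl]

/-- An irreducible finite-dimensional representation of `L̃` factors through `𝔤𝔩ₙ ⊕ 𝔤°`. -/
theorem exists_factor [FiniteDimensional ℂ 𝔤] (hΦ : IsIrreducibleAction Φ) :
    ∃ ρ : (Matrix (Fin n) (Fin n) ℂ × C.gcirc) →ₗ⁅ℂ⁆ Module.End ℂ M,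
      IsIrreducibleAction ρ ∧
      (∀ (u : Fin n → ℂ) (r : S.Gam),
        Φ (C.LI u r) = ρ (Matrix.vecMulVec (toC (r : Fin n → ℤ)) u, 0)) ∧
      ∀ (k : Fin n → ℤ) (x : C.gcircComp k), Φ (C.LX k x) = ρ (0, (x : C.gcirc)) := by
  obtain ⟨F, hF⟩ := exists_gcircPart hΦ
  have hFlie : ∀ x y, F ⁅x, y⁆ = ⁅F x, F y⁆ := fun x y => by
    induction x using gcirc_ind with
    | h0 => simp
    | ha x x' h h' => rw [add_lie, map_add, map_add, add_lie, h, h']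
    | hs k x =>
      induction y using gcirc_ind with
      | h0 => simp
      | ha x x' h h' => rw [lie_add, map_add, map_add, lie_add, h, h']
      | hs l y =>
        rw [hF, hF, ← LieHom.map_lie, LX_lie_LX, ← hF]
        rfl
  -- The bracket of `I(u,r)` with `X(k)` is a multiple of `X(k+r) - X(k)`, which acts as zero.
  have hcross : ∀ A y, ⁅glPart Φ A, F y⁆ = 0 := fun A y => by
    induction A using matrix_ind S with
    | h0 => simp
    | ha A A' h h' => rw [map_add, add_lie, h, h', add_zero]
    | hs r u =>
      induction y using gcirc_ind with
      | h0 => simp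
      | ha x x' h h' => rw [map_add, lie_add, h, h', add_zero]
      | hs k x =>
        rw [glPart_vecMulVec hΦ, hF, ← LXs_zero, ← LieHom.map_lie, LI_lie_LXs, map_smul, map_sub,
          map_LXs_eq hΦ, map_LXs_eq hΦ, sub_self, smul_zero]
  have hcross' : ∀ y A, ⁅F y, glPart Φ A⁆ = 0 := fun y A => by
    rw [← lie_skew, hcross, neg_zero]
  let ρ : (Matrix (Fin n) (Fin n) ℂ × C.gcirc) →ₗ⁅ℂ⁆ Module.End ℂ M :=
    { (glPart Φ).coprod F with
      map_lie' := fun {a b} => by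
        change glPart Φ ⁅a.1, b.1⁆ + F ⁅a.2, b.2⁆ =
          ⁅glPart Φ a.1 + F a.2, glPart Φ b.1 + F b.2⁆
        rw [glPart_lie hΦ, hFlie, add_lie, lie_add, lie_add, hcross, hcross', add_zero, zero_add] }
  have hI : ∀ (u : Fin n → ℂ) (r : S.Gam),
      Φ (C.LI u r) = ρ (Matrix.vecMulVec (toC (r : Fin n → ℤ)) u, 0) := fun u r => by
    change _ = glPart Φ (Matrix.vecMulVec (toC (r : Fin n → ℤ)) u) + F 0
    rw [glPart_vecMulVec hΦ, map_zero, add_zero]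
  have hX : ∀ (k : Fin n → ℤ) (x : C.gcircComp k), Φ (C.LX k x) = ρ (0, (x : C.gcirc)) :=
    fun k x => by
      change _ = glPart Φ 0 + F x
      rw [hF, map_zero, zero_add]
  -- Every operator of `L̃` is an operator of `ρ`, so a subspace stable under `ρ` is stable under
  -- `L̃`.
  refine ⟨ρ, ⟨hΦ.1, fun N hN => hΦ.2 N fun x => ?_⟩, hI, hX⟩
  induction x using C.Ltilde_ind with
  | h0 => rw [map_zero]; exact fun v _ => N.zero_mem
  | ha x y hx hy => rw [map_add]; exact fun v hv => N.add_mem (hx hv) (hy hv)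
  | hs d x hx => rw [map_smul]; exact fun v hv => N.smul_mem d (hx hv)
  | hX k x => rw [hX]; exact hN _
  | hI u r => rw [hI]; exact hN _

end CartanData
end Twisted
end Toroidal

end

/-- `act` is a priori only linear, so the existence of the Lie homomorphism `Φ` with the same
operators is part of the claim. The matrix `vecMulVec r u` has entry `r_j u_i` at `(j, i)`, that is,
it equals `∑ u_i r_j E_{ji}`. -/
theorem theorem9p4 {𝔤 : Type*} [LieRing 𝔤] [LieAlgebra ℂ 𝔤] [FiniteDimensional ℂ 𝔤]
    [LieAlgebra.IsSimple ℂ 𝔤] {n : ℕ} (hn : 0 < n)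
    (S : Toroidal.TwistData 𝔤 n) (C : Toroidal.CartanData S)
    (V : Type*) [AddCommGroup V] [Module ℂ V] [LieRingModule S.tau V] [LieModule ℂ S.tau V]
    (hirr : LieModule.IsIrreducible ℂ S.tau V) (hint : C.IsIntegrable V)
    (C₀ : ℝ) (hC₀ : 0 < C₀)
    (hK₀ : ∀ v : V, ⁅S.tK (Pi.single 0 1) 0, v⁆ = (C₀ : ℂ) • v)
    (hK : ∀ i ≠ 0, ∀ v : V, ⁅S.tK (Pi.single i 1) 0, v⁆ = 0)
    (lam : C.Weight) (hlam : C.weightSpace V lam ≠ ⊥)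
    (p : Fin n → ℤ) (N : ℕ) (hN : IsLeast {j : ℕ | 0 < j ∧ j • p ∈ S.Gam} N)
    (ζ : ℂ) (hζ : IsPrimitiveRoot ζ N)
    (θ : C.Vtilde V (C₀ : ℂ) ≃ₗ[ℂ] C.Vtilde V (C₀ : ℂ))
    (hθ : C.IsGradedAut V (C₀ : ℂ) lam p θ) (hθN : θ ^ N = 1)
    (hM : ∀ i < N, C.IsIrreducibleSub (C.Mtilde θ ζ i)) :
    ∀ i < N, FiniteDimensional ℂ (C.Mtilde θ ζ i) ∧
      ∃ Φ : C.Ltilde →ₗ⁅ℂ⁆ Module.End ℂ (C.Mtilde θ ζ i),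
        (∀ x v, (Φ x v : C.Vtilde V (C₀ : ℂ)) = C.act V (C₀ : ℂ) x v) ∧
        Toroidal.IsIrreducibleAction Φ ∧
        (∀ x : C.Ltilde, (x : Toroidal.LoopDer (Fin n) 𝔤) ∈
          Toroidal.CartanData.idealI S 2 ⊔ C.idealF 1 → Φ x = 0) ∧
        ∃ ρ : (Matrix (Fin n) (Fin n) ℂ × C.gcirc) →ₗ⁅ℂ⁆ Module.End ℂ (C.Mtilde θ ζ i),
          Toroidal.IsIrreducibleAction ρ ∧
          (∀ (u : Fin n → ℂ) (r : S.Gam),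
            Φ (C.LI u r) = ρ (Matrix.vecMulVec (Toroidal.toC (r : Fin n → ℤ)) u, 0)) ∧
          ∀ (k : Fin n → ℤ) (x : C.gcircComp k), Φ (C.LX k x) = ρ (0, (x : C.gcirc)) := by
  intro i hi
  have hfd := (hM i hi).finiteDimensional hint
  refine ⟨hfd, (hM i hi).rep hint hK, fun x v => rfl, ?_⟩
  have hΦ : Toroidal.IsIrreducibleAction ((hM i hi).rep hint hK) :=
    ⟨(hM i hi).nontrivial, fun N hN => (hM i hi).irr N hN⟩
  exact ⟨hΦ, Toroidal.CartanData.map_eq_zero_of_mem hΦ, Toroidal.CartanData.exists_factor hΦ⟩
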